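/- Let $n\ge 1$ and let $K$ be a centrally symmetric convex $(2n+4)$-gon. A diagonal of $K$ is central if it passes through the center of $K$. Every triangulation of $K$ that is invariant under the central inversion contains exactly one central diagonal and $n$ centrally symmetric pairs of non-central diagonals. A colored triangulation is such a triangulation together with an assignment of colors from a fixed $n$-set to its non-central diagonals such that two of them have the same color if and only if they are equal or form a centrally symmetric pair; the central diagonal carries the extra label $c^*$. Flips (replacing a diagonal by the other diagonal of the quadrilateral formed by its two adjacent triangles) are performed on the central diagonal, or simultaneously on the two diagonals of a centrally symmetric pair, and preserve labels. For a set $C$ of labels (colors, or $c^*$), write $t\sim_C t'$ if the colored triangulation $t'$ is obtained from $t$ by a sequence of flips of diagonals with labels in $C$. The colorful $(n+1)$-cyclohedron $\mathcal{Z}^c_n$ is the abstract $(n+1)$-polytope whose faces are the empty set and all equivalence classes of the relations $\sim_C$, ordered by inclusion; the classes for $|C|=j$ are its $j$-faces. The ordinary $(n+1)$-cyclohedron $\mathcal{Z}_n$ is the polytope whose non-empty faces are the centrally symmetric sets of pairwise non-crossing diagonals of $K$, ordered by reverse inclusion. Let $\Gamma(\mathcal{P})$ denote the group of order-automorphisms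 of the face poset of $\mathcal{P}$ (which includes the empty face), $S_n$ the symmetric group on $n$ letters, and $D_m$ the dihedral group of order $2m$. **Theorem.** 1. If $n>1$, then $\Gamma(\mathcal{Z}^c_n)\cong S_n\times D_{n+2}$. 2. $\Gamma(\mathcal{Z}^c_1)\cong D_6$. 3. If $n>1$, then $\Gamma(\mathcal{Z}_n)\cong D_{n+2}$. -/

import Mathlib

namespace Cyclohedron

/-- The vertices of the centrally symmetric convex `(2n+4)`-gon `K`, labelled in cyclic order. -/
abbrev Vertex (n : ℕ) : Type := ZMod (2 * n + 4)

/-- The central inversion of `K`, acting on line segments between vertices of `K`. -/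
def inversion (n : ℕ) (d : Sym2 (Vertex n)) : Sym2 (Vertex n) :=
  d.map fun v => v + ((n + 2 : ℕ) : Vertex n)

/-- The segment `d` is a boundary edge of `K`. -/
def IsSide (n : ℕ) (d : Sym2 (Vertex n)) : Prop :=
  ∃ a : Vertex n, d = s(a, a + 1)

/-- The segment `d` is a diagonal of `K`: it joins two distinct vertices and is not a boundary
edge. -/
def IsDiagonal (n : ℕ) (d : Sym2 (Vertex n)) : Prop :=
  ¬ d.IsDiag ∧ ¬ IsSide n d

/-- The diagonal `d` passes through the center of `K`: its ends are opposite vertices. -/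
def IsCentral (n : ℕ) (d : Sym2 (Vertex n)) : Prop :=
  ∃ a : Vertex n, d = s(a, a + ((n + 2 : ℕ) : Vertex n))

/-- The segments `d` and `e` cross in the interior of `K`: they have four distinct ends, and the
ends of `e` lie on different sides of `d`. -/
def Cross (n : ℕ) (d e : Sym2 (Vertex n)) : Prop :=
  ∃ a b x y : Vertex n, d = s(a, b) ∧ e = s(x, y) ∧ sbtw a x b ∧ sbtw b y a

/-- A dissection of `K`: a set of pairwise non-crossing diagonals. -/
def IsDissection (n : ℕ) (D : Set (Sym2 (Vertex n))) : Prop :=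
  (∀ d ∈ D, IsDiagonal n d) ∧ ∀ d ∈ D, ∀ e ∈ D, ¬ Cross n d e

/-- A triangulation of `K`, given by its set of diagonals: a dissection that no further diagonal
refines. -/
def IsTriangulation (n : ℕ) (T : Set (Sym2 (Vertex n))) : Prop :=
  Maximal (IsDissection n) T

/-- A set of diagonals that is invariant under the central inversion of `K`. -/
def IsCentrallySymmetric (n : ℕ) (D : Set (Sym2 (Vertex n))) : Prop :=
  ∀ d ∈ D, inversion n d ∈ D

/-- A colored centrally symmetric triangulation of `K`. The colors are the elements of `Fin n`;
`none` stands for "no color". Each non-central diagonal has a color, and two non-central diagonals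
have the same color exactly when they are equal or form a centrally symmetric pair. The central
diagonal has no color. (So that equal colored triangulations are equal as terms, `color` is set to
`none` outside the triangulation.) -/
@[ext]
structure ColoredTriangulation (n : ℕ) where
  /-- the underlying uncolored triangulation -/
  supp : Set (Sym2 (Vertex n))
  /-- the color of a diagonal -/
  color : Sym2 (Vertex n) → Option (Fin n)
  isTriangulation : IsTriangulation n supp
  isCentrallySymmetric : IsCentrallySymmetric n supp
  color_of_notMem : ∀ d, d ∉ supp → color d = none
  color_eq_none_iff : ∀ d ∈ supp, (color d = none ↔ IsCentral n d)
  color_eq_color_iff : ∀ d ∈ supp, ∀ e ∈ supp, ¬ IsCentral n d → ¬ IsCentral n e →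
    (color d = color e ↔ e = d ∨ e = inversion n d)

/-- In the triangulation `T`, the flip of the diagonal `d` is `d'`: the two triangles of `T` that
share the edge `d = {a, c}` form a quadrilateral `a, b, c, e`, and `d' = {b, e}` is the other
diagonal of this quadrilateral. -/
def IsDiagonalFlip (n : ℕ) (T : Set (Sym2 (Vertex n))) (d d' : Sym2 (Vertex n)) : Prop :=
  d ∈ T ∧ ∃ a b c e : Vertex n, sbtw a b c ∧ sbtw c e a ∧ d = s(a, c) ∧ d' = s(b, e) ∧
    ∀ f ∈ ({s(a, b), s(b, c), s(c, e), s(e, a)} : Set (Sym2 (Vertex n))), f ∈ T ∨ IsSide n f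

/-- `t'` arises from `t` by the flip with label `c`, where `c` is a color, or `none` (the "uncolor"
`c*`) for the flip of the central diagonal. A diagonal `d` of `t` with label `c` is flipped to
`d'`, simultaneously with its image under the central inversion (which is `d` itself if `d` is
central); the new diagonals get the label of the old ones, and all other diagonals stay, with their
colors. -/
def IsFlip (n : ℕ) (c : Option (Fin n)) (t t' : ColoredTriangulation n) : Prop :=
  ∃ d d' : Sym2 (Vertex n), IsDiagonalFlip n t.supp d d' ∧ t.color d = c ∧
    t'.supp = (t.supp \ {d, inversion n d}) ∪ {d', inversion n d'} ∧
    t'.color d' = c ∧ t'.color (inversion n d') = c ∧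
    ∀ f ∈ t.supp \ {d, inversion n d}, t'.color f = t.color f

/-- The equivalence relation `∼_C` for a set `C` of labels: `t` and `t'` are joined by a sequence
of flips with labels in `C`. -/
def FlipEquiv (n : ℕ) (C : Set (Option (Fin n))) :
    ColoredTriangulation n → ColoredTriangulation n → Prop :=
  Relation.EqvGen fun t t' => ∃ c ∈ C, IsFlip n c t t'

/-- The colorful `(n+1)`-cyclohedron as a partially ordered set. A face is identified with its set
of vertices: it is the empty set (the face of rank `-1`) or an equivalence class `(C, t)` of some
`∼_C`, of rank `|C|`, where `C` is a subset of the `(n+1)`-element set of labels. Faces are ordered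
by inclusion. -/
abbrev ColorfulCyclohedron (n : ℕ) : Type :=
  {F : Set (ColoredTriangulation n) //
    F = ∅ ∨ ∃ (C : Set (Option (Fin n))) (t : ColoredTriangulation n), F = {t' | FlipEquiv n C t t'}}

/-- A centrally symmetric dissection of `K`. -/
abbrev SymmetricDissection (n : ℕ) : Type :=
  {D : Set (Sym2 (Vertex n)) // IsDissection n D ∧ IsCentrallySymmetric n D}

/-- The face lattice of the ordinary `(n+1)`-cyclohedron: the non-empty faces are the centrally
symmetric dissections of `K` (the vertices of such a face are the centrally symmetric
triangulations that contain the given diagonals), ordered by reverse inclusion, together with the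
empty face. -/
abbrev OrdinaryCyclohedron (n : ℕ) : Type :=
  WithBot (SymmetricDissection n)ᵒᵈ

/-- The automorphism group `Γ(P)`: the order-preserving bijections of the set of faces (whose
inverses preserve the order as well), under composition. -/
abbrev AutGroup (P : Type) [PartialOrder P] : Type := P ≃o P

end Cyclohedron

/-!
Modulo the central inversion, the diagonals of `K` are arcs of length between `2` and `n + 2` on a
circle with `n + 2` points, the central ones having length `n + 2`, and the colored triangulations
are the maximal non-crossing families of arcs, labelled by the colors and `c*`.

The face poset of the colorful cyclohedron remembers the vertices as its atoms and the labels as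
the edges at a vertex. As the faces at a vertex form the Boolean lattice of all sets of labels and
the flips act transitively, an automorphism is a permutation of the vertices and one of the labels
that are compatible with the flips. If `n > 1`, the permutation of the labels fixes `c*`: flipping
two colors alternately may lead to a cycle of length ten (a pentagon run through twice, as one
round exchanges the labels), whereas cycles that involve the central flip have a length that divides
twelve. Composing with a permutation of the colors, we may assume that all labels are fixed. Which
flips commute at a triangulation and its neighbors tells whether the triangulation is a dihedral
image of a given labelled fan, so the image of this fan is such an image, and the automorphism is
the corresponding element of the dihedral group. If `n = 1`, the flip graph is a hexagon.

An automorphism of the ordinary cyclohedron permutes the orbits of diagonals and preserves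
compatibility, hence it acts on labelled triangulations and commutes with the flips. It maps
central orbits to central orbits, since their label is the only one that the flips and the
permutations of the other labels cannot move, and the case of the colorful cyclohedron applies.
-/

namespace Cyclohedron

/-! ### Flip systems and their face posets -/

open Relation

section FlipSystem

variable {L X Y : Type*}

theorem eqvGen_map {r : X → X → Prop} {s : Y → Y → Prop} {f : X → Y}
    (h : ∀ a b, r a b → s (f a) (f b)) {x y : X} (hxy : EqvGen r x y) : EqvGen s (f x) (f y) :=
  Setoid.eqvGen_le (s := (EqvGen.setoid s).comap f) (fun a b hab => .rel _ _ (h a b hab)) hxy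

theorem exists_perm_of_orderIso_set (E : Set L ≃o Set L) :
    ∃ σ : Equiv.Perm L, ∀ C, E C = σ '' C := by
  have atom (E : Set L ≃o Set L) (c : L) : ∃ d, E {c} = {d} :=
    Set.isAtom_iff.1 ((E.isAtom_iff _).2 (Set.isAtom_singleton c))
  choose s hs using atom E
  choose t ht using atom E.symm
  have left (c : L) : t (s c) = c :=
    Set.singleton_injective (by rw [← ht, ← hs, E.symm_apply_apply])
  have right (c : L) : s (t c) = c :=
    Set.singleton_injective (by rw [← hs, ← ht, E.apply_symm_apply])
  refine ⟨⟨s, t, left, right⟩, fun C => Set.ext fun c => ?_⟩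
  rw [← right c, ← Set.singleton_subset_iff, ← hs]
  exact (E.le_iff_le.trans Set.singleton_subset_iff).trans
    (Equiv.injective ⟨s, t, left, right⟩).mem_set_image.symm

/-- The equivalence class of `x` under the flips with labels in `C`. -/
def flipClass (flip : L → X → X) (C : Set L) (x : X) : Set X :=
  {y | EqvGen (fun a b => ∃ c ∈ C, b = flip c a) x y}

theorem mem_flipClass_self (flip : L → X → X) (C : Set L) (x : X) : x ∈ flipClass flip C x :=
  .refl x

theorem flip_mem_flipClass {flip : L → X → X} {C : Set L} {c : L} (hc : c ∈ C) {x y : X}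
    (hy : y ∈ flipClass flip C x) : flip c y ∈ flipClass flip C x :=
  .trans _ _ _ hy (.rel _ _ ⟨c, hc, rfl⟩)

theorem flipClass_eq {flip : L → X → X} {C : Set L} {x y : X} (h : y ∈ flipClass flip C x) :
    flipClass flip C y = flipClass flip C x :=
  Set.ext fun _ => ⟨fun hz => h.trans _ _ _ hz, fun hz => (h.symm _ _).trans _ _ _ hz⟩

theorem flipClass_mono (flip : L → X → X) {C D : Set L} (h : C ⊆ D) (x : X) :
    flipClass flip C x ⊆ flipClass flip D x :=
  EqvGen.mono (fun _ _ ⟨c, hc, hab⟩ => ⟨c, h hc, hab⟩) x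

theorem flipClass_induction {flip : L → X → X} (hflip : ∀ c, Function.Involutive (flip c))
    {C : Set L} {x y : X} {P : X → Prop} (hy : y ∈ flipClass flip C x) (base : P x)
    (step : ∀ z, P z → ∀ c ∈ C, P (flip c z)) : P y := by
  suffices key : ∀ a b, EqvGen (fun a b => ∃ c ∈ C, b = flip c a) a b → (P a ↔ P b) from
    (key x y hy).1 base
  intro a b hab
  induction hab with
  | rel a b h =>
    obtain ⟨c, hc, rfl⟩ := h
    exact ⟨fun ha => step a ha c hc, fun hb => hflip c a ▸ step _ hb c hc⟩
  | refl => rfl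
  | symm _ _ _ ih => exact ih.symm
  | trans _ _ _ _ _ ih₁ ih₂ => exact ih₁.trans ih₂

/-- The vertices and flips of a colorful polytope, abstractly: involutions `flip c` of `X`, one for
each label `c`, that act transitively and are independent of each other. -/
structure FlipSystem (L X : Type*) where
  flip : L → X → X
  flip_involutive : ∀ c, Function.Involutive (flip c)
  mem_of_flip_mem : ∀ (C : Set L) (x : X) (c : L), flip c x ∈ flipClass flip C x → c ∈ C
  mem_flipClass_univ : ∀ x y, y ∈ flipClass flip Set.univ x

namespace FlipSystem

variable (S : FlipSystem L X)

/-- The poset of faces of a flip system: the flip classes and the empty set. -/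
abbrev FacePoset : Type _ :=
  {F : Set X // F = ∅ ∨ ∃ (C : Set L) (x : X), F = flipClass S.flip C x}

instance : OrderBot S.FacePoset where
  bot := ⟨∅, .inl rfl⟩
  bot_le F := Set.empty_subset F.1

/-- The face that contains the vertex `x` and whose edges at `x` have the labels in `C`. -/
def face (C : Set L) (x : X) : S.FacePoset := ⟨flipClass S.flip C x, .inr ⟨C, x, rfl⟩⟩

variable {S} {C D : Set L} {x y : X} {F : S.FacePoset}

theorem mem_face_self (C : Set L) (x : X) : x ∈ (S.face C x).1 := mem_flipClass_self _ C x

theorem face_eq (h : y ∈ (S.face C x).1) : S.face C y = S.face C x := Subtype.ext (flipClass_eq h)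

theorem face_flip {c : L} (hc : c ∈ C) (x : X) : S.face C (S.flip c x) = S.face C x :=
  face_eq (flip_mem_flipClass hc (mem_face_self C x))

theorem face_empty (x : X) : (S.face ∅ x).1 = {x} := by
  refine Set.Subset.antisymm (fun y hy => ?_) (Set.singleton_subset_iff.2 (mem_face_self ∅ x))
  exact flipClass_induction (P := (· ∈ ({x} : Set X))) S.flip_involutive hy rfl (by simp)

theorem face_empty_le : S.face ∅ x ≤ F ↔ x ∈ F.1 := by
  rw [← Subtype.coe_le_coe, face_empty]
  exact Set.singleton_subset_iff

theorem face_le_face : S.face C x ≤ S.face D x ↔ C ⊆ D := by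
  refine ⟨fun h c hc => S.mem_of_flip_mem D x c (h ?_), fun h => flipClass_mono _ h x⟩
  exact flip_mem_flipClass hc (mem_face_self C x)

theorem eq_or_eq_of_mem_face_singleton {c : L} (h : y ∈ (S.face {c} x).1) :
    y = x ∨ y = S.flip c x := by
  refine flipClass_induction (P := fun y => y = x ∨ y = S.flip c x) S.flip_involutive h
    (.inl rfl) ?_
  rintro y (rfl | rfl) c' rfl
  exacts [.inr rfl, .inl (S.flip_involutive _ _)]

theorem flip_ne (c : L) (x : X) : S.flip c x ≠ x := fun h =>
  S.mem_of_flip_mem ∅ x c (h.symm ▸ mem_face_self ∅ x)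

theorem exists_eq_face (hx : x ∈ F.1) : ∃ C, F = S.face C x := by
  rcases F.2 with h | ⟨C, y, h⟩
  · exact absurd (h ▸ hx) (Set.notMem_empty x)
  · exact ⟨C, (Subtype.ext h).trans (face_eq (h.subset hx)).symm⟩

theorem isAtom_face_empty (x : X) : IsAtom (S.face ∅ x) := by
  refine ⟨fun h => Set.notMem_empty x (face_empty_le.1 h.le), fun F hF => ?_⟩
  by_contra hne
  obtain ⟨y, hy⟩ := Set.nonempty_iff_ne_empty.2 fun h => hne (Subtype.ext h)
  obtain rfl : y = x := by simpa [face_empty] using hF.le hy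
  exact hF.not_ge (face_empty_le.2 hy)

theorem exists_eq_face_empty_of_isAtom (hF : IsAtom F) : ∃ x, S.face ∅ x = F := by
  obtain ⟨x, hx⟩ := Set.nonempty_iff_ne_empty.2 fun h => hF.1 (Subtype.ext h)
  exact ⟨x, hF.le_iff_eq (isAtom_face_empty x).1 |>.1 (face_empty_le.2 hx)⟩

variable (S) in
/-- The vertices of a flip system are the atoms of its face poset. -/
noncomputable def atomEquiv : X ≃ {F : S.FacePoset // IsAtom F} :=
  .ofBijective (fun x => ⟨S.face ∅ x, isAtom_face_empty x⟩)
    ⟨fun x y h => by simpa [face_empty] using congrArg (fun F => F.1.1) h,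
      fun F => (exists_eq_face_empty_of_isAtom F.2).imp fun _ h => Subtype.ext h⟩

variable (S) in
/-- The faces at the vertex `x` are indexed by sets of labels. -/
noncomputable def faceIso (x : X) : Set L ≃o Set.Ici (S.face ∅ x) :=
  .ofSurjective (.ofMapLEIff (fun C => ⟨S.face C x, face_empty_le.2 (mem_face_self C x)⟩)
      fun _ _ => face_le_face)
    fun F => (exists_eq_face (face_empty_le.1 F.2)).imp fun _ h => Subtype.ext h.symm

variable (S) in
/-- The pairs of a permutation of the vertices and a permutation of the labels that are compatible
with the flips. -/
def autGroup : Subgroup (Equiv.Perm X × Equiv.Perm L) where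
  carrier := {g | ∀ c x, g.1 (S.flip c x) = S.flip (g.2 c) (g.1 x)}
  one_mem' _ _ := rfl
  mul_mem' hg hk c x := by
    simp only [Prod.fst_mul, Prod.snd_mul, Equiv.Perm.mul_apply, hk c x, hg (_) (_)]
  inv_mem' {g} hg c x := by
    rw [Prod.fst_inv, Equiv.Perm.inv_eq_iff_eq, hg]
    simp

theorem apply_flip (g : S.autGroup) (c : L) (x : X) :
    g.1.1 (S.flip c x) = S.flip (g.1.2 c) (g.1.1 x) := g.2 c x

theorem autGroup_apply_mem_face (g : S.autGroup) (h : y ∈ (S.face C x).1) :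
    g.1.1 y ∈ (S.face (g.1.2 '' C) (g.1.1 x)).1 := by
  refine flipClass_induction (P := fun y => g.1.1 y ∈ (S.face (g.1.2 '' C) (g.1.1 x)).1)
    S.flip_involutive h (mem_face_self _ _) fun z hz c hc => ?_
  rw [apply_flip]
  exact flip_mem_flipClass (Set.mem_image_of_mem _ hc) hz

theorem autGroup_image_face (g : S.autGroup) (C : Set L) (x : X) :
    g.1.1 '' (S.face C x).1 = (S.face (g.1.2 '' C) (g.1.1 x)).1 := by
  refine Set.Subset.antisymm (Set.image_subset_iff.2 fun y => autGroup_apply_mem_face g)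
    fun y hy => ?_
  have h := autGroup_apply_mem_face g⁻¹ hy
  exact ⟨g⁻¹.1.1 y, by simpa [Set.image_image] using h, by simp⟩

/-- The flips act transitively, hence the image of one vertex determines all others. -/
theorem autGroup_ext {g k : S.autGroup} (hL : g.1.2 = k.1.2) (x : X) (hx : g.1.1 x = k.1.1 x) :
    g = k := by
  refine Subtype.ext (Prod.ext (Equiv.ext fun y => ?_) hL)
  refine flipClass_induction (P := fun y => g.1.1 y = k.1.1 y) S.flip_involutive
    (S.mem_flipClass_univ x y) hx fun z hz c _ => ?_
  rw [apply_flip, apply_flip, hL, hz]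

variable (S) in
/-- The action of the compatible pairs of permutations on the face poset. -/
def faceAction : S.autGroup →* (S.FacePoset ≃o S.FacePoset) :=
  have isFace (g : S.autGroup) (F : S.FacePoset) : g.1.1 '' F.1 = ∅ ∨
      ∃ (C : Set L) (x : X), g.1.1 '' F.1 = flipClass S.flip C x := by
    obtain ⟨F, rfl | ⟨C, x, rfl⟩⟩ := F
    exacts [.inl (Set.image_empty _), .inr ⟨_, _, autGroup_image_face g C x⟩]
  MonoidHom.mk'
    (fun g =>
      { toFun := fun F => ⟨g.1.1 '' F.1, isFace g F⟩
        invFun := fun F => ⟨g⁻¹.1.1 '' F.1, isFace g⁻¹ F⟩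
        left_inv := fun F => Subtype.ext (by simp [Set.image_image])
        right_inv := fun F => Subtype.ext (by simp [Set.image_image])
        map_rel_iff' := Set.image_subset_image_iff g.1.1.injective })
    fun g k => by
      ext F : 2
      exact Subtype.ext (Set.image_image g.1.1 k.1.1 F.1).symm

theorem coe_faceAction (g : S.autGroup) (F : S.FacePoset) : (S.faceAction g F).1 = g.1.1 '' F.1 :=
  rfl

theorem faceAction_injective [Nonempty X] : Function.Injective S.faceAction := by
  refine (injective_iff_map_eq_one _).2 fun g hg => ?_
  have fixes (x : X) : g.1.1 x = x := by
    have h := coe_faceAction g (S.face ∅ x)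
    rw [hg, RelIso.one_apply, face_empty, Set.image_singleton] at h
    exact (Set.singleton_injective h).symm
  obtain ⟨x⟩ := ‹Nonempty X›
  refine Subtype.ext (Prod.ext (Equiv.ext fixes) (Equiv.ext fun c => ?_))
  refine S.mem_of_flip_mem {c} x _ ?_
  rw [← fixes x, ← apply_flip, fixes, fixes]
  exact flip_mem_flipClass (Set.mem_singleton c) (mem_face_self {c} x)

section Surjective

variable (Φ : S.FacePoset ≃o S.FacePoset)

/-- The permutation of the vertices that is induced by an automorphism of the face poset. -/
noncomputable def vertexPerm : Equiv.Perm X :=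
  S.atomEquiv.trans
    ((Φ.toEquiv.subtypeEquiv fun F => (Φ.isAtom_iff F).symm).trans S.atomEquiv.symm)

theorem face_empty_vertexPerm (x : X) : S.face ∅ (vertexPerm Φ x) = Φ (S.face ∅ x) :=
  congrArg Subtype.val (S.atomEquiv.apply_symm_apply ⟨Φ (S.face ∅ x), _⟩)

theorem vertexPerm_mem : vertexPerm Φ x ∈ (Φ F).1 ↔ x ∈ F.1 := by
  rw [← face_empty_le, face_empty_vertexPerm, Φ.le_iff_le, face_empty_le]

theorem coe_apply_eq_vertexPerm_image (F : S.FacePoset) : (Φ F).1 = vertexPerm Φ '' F.1 := by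
  ext y
  rw [Equiv.image_eq_preimage_symm, Set.mem_preimage, ← vertexPerm_mem Φ (F := F),
    Equiv.apply_symm_apply]

theorem exists_perm_apply_face (x : X) :
    ∃ σ : Equiv.Perm L, ∀ C, Φ (S.face C x) = S.face (σ '' C) (vertexPerm Φ x) := by
  let Φx : Set.Ici (S.face ∅ x) ≃o Set.Ici (S.face ∅ (vertexPerm Φ x)) :=
    { toEquiv := Φ.toEquiv.subtypeEquiv fun F => by
        rw [face_empty_vertexPerm]
        exact Φ.le_iff_le.symm
      map_rel_iff' := Φ.le_iff_le }
  obtain ⟨σ, hσ⟩ :=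
    exists_perm_of_orderIso_set (((S.faceIso x).trans Φx).trans (S.faceIso (vertexPerm Φ x)).symm)
  refine ⟨σ, fun C => ?_⟩
  rw [← hσ]
  exact congrArg Subtype.val
    ((S.faceIso (vertexPerm Φ x)).apply_symm_apply (Φx (S.faceIso x C))).symm

/-- The label permutations at the two ends of an edge agree: they agree on the label `c` of the
edge, and on any other label `d` because they agree on the set `{c, d}`. -/
theorem perm_eq_of_flip {c : L} {σ τ : Equiv.Perm L}
    (hσ : ∀ C, Φ (S.face C x) = S.face (σ '' C) (vertexPerm Φ x))
    (hτ : ∀ C, Φ (S.face C (S.flip c x)) = S.face (τ '' C) (vertexPerm Φ (S.flip c x))) :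
    τ = σ := by
  have image_eq (C : Set L) (hc : c ∈ C) : τ '' C = σ '' C := by
    have h : S.face (τ '' C) (vertexPerm Φ (S.flip c x)) = S.face (σ '' C) (vertexPerm Φ x) := by
      rw [← hτ, ← hσ, face_flip hc]
    have hmem : vertexPerm Φ (S.flip c x) ∈ (S.face (σ '' C) (vertexPerm Φ x)).1 :=
      h ▸ mem_face_self _ _
    rw [← face_eq hmem] at h
    exact (face_le_face.1 h.le).antisymm (face_le_face.1 h.ge)
  have hc : τ c = σ c := by simpa using image_eq {c} rfl
  ext d
  have hpair : ({τ c, τ d} : Set L) = {σ c, σ d} := by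
    simpa only [Set.image_pair] using image_eq {c, d} (Set.mem_insert c _)
  rw [Set.pair_eq_pair_iff, hc] at hpair
  rcases hpair with h | h
  · exact h.2
  · exact h.2.trans h.1

theorem vertexPerm_flip {σ : Equiv.Perm L}
    (hσ : ∀ C, Φ (S.face C x) = S.face (σ '' C) (vertexPerm Φ x)) (c : L) :
    vertexPerm Φ (S.flip c x) = S.flip (σ c) (vertexPerm Φ x) := by
  have h : vertexPerm Φ (S.flip c x) ∈ (Φ (S.face {c} x)).1 :=
    (vertexPerm_mem Φ).2 (flip_mem_flipClass (Set.mem_singleton c) (mem_face_self {c} x))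
  rw [hσ, Set.image_singleton] at h
  exact (eq_or_eq_of_mem_face_singleton h).resolve_left fun h =>
    flip_ne c x ((vertexPerm Φ).injective h)

end Surjective

theorem faceAction_surjective [Nonempty X] : Function.Surjective S.faceAction := by
  intro Φ
  obtain ⟨x⟩ := ‹Nonempty X›
  choose σ hσ using exists_perm_apply_face Φ
  have const (y : X) : σ y = σ x :=
    flipClass_induction (P := fun y => σ y = σ x) S.flip_involutive (S.mem_flipClass_univ x y) rfl
      fun z hz c _ => (perm_eq_of_flip Φ (hσ z) (hσ _)).trans hz
  refine ⟨⟨(vertexPerm Φ, σ x), fun c y => ?_⟩, ?_⟩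
  · rw [vertexPerm_flip Φ (hσ y), const y]
  · ext F : 2
    exact Subtype.ext (coe_apply_eq_vertexPerm_image Φ F).symm

variable (S) in
/-- The automorphism group of the face poset of a flip system. -/
noncomputable def faceAut [Nonempty X] : S.autGroup ≃* (S.FacePoset ≃o S.FacePoset) :=
  .ofBijective S.faceAction ⟨faceAction_injective, faceAction_surjective⟩

variable (S) in
theorem image_setOf_eqvGen (e : Y ≃ X) {R : L → Y → Y → Prop}
    (hR : ∀ c y z, R c y z ↔ e z = S.flip c (e y)) (C : Set L) (y : Y) :
    e '' {z | EqvGen (fun a b => ∃ c ∈ C, R c a b) y z} = flipClass S.flip C (e y) := by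
  ext x
  rw [Equiv.image_eq_preimage_symm, Set.mem_preimage]
  constructor
  · intro h
    refine e.apply_symm_apply x ▸ eqvGen_map ?_ h
    exact fun a b ⟨c, hc, hab⟩ => ⟨c, hc, (hR c a b).1 hab⟩
  · intro h
    refine e.symm_apply_apply y ▸ eqvGen_map ?_ h
    exact fun a b ⟨c, hc, hab⟩ => ⟨c, hc, (hR c _ _).2 (by simpa using hab)⟩

variable (S) in
/-- A bijection of the vertices with a set that carries an equivalent flip relation identifies the
face posets. -/
def facePosetCongr (e : Y ≃ X) {R : L → Y → Y → Prop}
    (hR : ∀ c y z, R c y z ↔ e z = S.flip c (e y)) :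
    {F : Set Y //
      F = ∅ ∨ ∃ (C : Set L) (y : Y), F = {z | EqvGen (fun a b => ∃ c ∈ C, R c a b) y z}}
      ≃o S.FacePoset where
  toEquiv := (Equiv.Set.congr e).subtypeEquiv fun F => by
    refine or_congr Set.image_eq_empty.symm (exists_congr fun C => ?_)
    refine e.exists_congr fun y => ?_
    rw [← image_setOf_eqvGen S e hR]
    exact e.injective.image_injective.eq_iff.symm
  map_rel_iff' := Set.image_subset_image_iff e.injective

end FlipSystem

end FlipSystem

/-! ### Orbits of segments -/

/-- An orbit of segments of `K` under the central inversion: the segment from `i` to `j`, where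
`i < j ≤ i + (n + 2)`, is recorded by the class of `i` modulo `n + 2` and the length `j - i`. -/
abbrev Arc (n : ℕ) : Type := ZMod (n + 2) × ℤ

/-- The orbit of the segment from `i` to `j`, where `i` and `j` are lifts of vertices of `K` to the
integers. -/
def arc (n : ℕ) (i j : ℤ) : Arc n := ((i : ZMod (n + 2)), j - i)

variable {n : ℕ}

theorem arc_fst (i j : ℤ) : (arc n i j).1 = (i : ZMod (n + 2)) := rfl

theorem arc_snd (i j : ℤ) : (arc n i j).2 = j - i := rfl

theorem intCast_zmod_eq_iff {i p : ℤ} :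
    (i : ZMod (n + 2)) = (p : ZMod (n + 2)) ↔ ((n : ℤ) + 2) ∣ p - i := by
  exact_mod_cast ZMod.intCast_eq_intCast_iff_dvd_sub i p (n + 2)

theorem arc_eq_arc_iff {i j p q : ℤ} :
    arc n i j = arc n p q ↔ ((n : ℤ) + 2) ∣ p - i ∧ q - p = j - i := by
  rw [arc, arc, Prod.mk.injEq, intCast_zmod_eq_iff, eq_comm (a := j - i)]

theorem exists_arc (α : Arc n) : ∃ i, arc n i (i + α.2) = α := by
  obtain ⟨i, hi⟩ := ZMod.intCast_surjective α.1
  exact ⟨i, Prod.ext hi (add_sub_cancel_left i α.2)⟩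

theorem arc_shift {k : ℤ} (hk : ((n : ℤ) + 2) ∣ k) (i j : ℤ) :
    arc n (i + k) (j + k) = arc n i j :=
  arc_eq_arc_iff.2 ⟨by simpa using hk, by ring⟩

theorem eq_zero_of_dvd_of_lt {k : ℤ} (hk : ((n : ℤ) + 2) ∣ k) (hlo : -((n : ℤ) + 2) < k)
    (hhi : k < (n : ℤ) + 2) : k = 0 :=
  Int.eq_zero_of_abs_lt_dvd hk (abs_lt.2 ⟨hlo, hhi⟩)

theorem exists_dvd_and_le_and_lt (a i : ℤ) :
    ∃ k : ℤ, ((n : ℤ) + 2) ∣ k ∧ a + k ≤ i ∧ i < a + k + ((n : ℤ) + 2) := by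
  have hle := Int.mul_ediv_self_le (x := i - a) (k := (n : ℤ) + 2) (by omega)
  have hlt := Int.lt_mul_ediv_self_add (x := i - a) (k := (n : ℤ) + 2) (by omega)
  exact ⟨((n : ℤ) + 2) * ((i - a) / ((n : ℤ) + 2)), dvd_mul_right _ _, by omega, by omega⟩

theorem arc_ne_of_start {i j p q : ℤ} (hne : i ≠ p) (hip : p - i < (n : ℤ) + 2)
    (hpi : i - p < (n : ℤ) + 2) : arc n i j ≠ arc n p q := by
  intro h
  have := eq_zero_of_dvd_of_lt (arc_eq_arc_iff.1 h).1 (by omega) hip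
  omega

theorem arc_ne_of_length {i j p q : ℤ} (hne : j - i ≠ q - p) : arc n i j ≠ arc n p q :=
  fun h => hne (arc_eq_arc_iff.1 h).2.symm

/-- The segment from `i` to `j` is a side of `K`, or its orbit belongs to `S`. -/
def Edge (S : Set (Arc n)) (i j : ℤ) : Prop := j = i + 1 ∨ arc n i j ∈ S

namespace Edge

variable {S T : Set (Arc n)} {i j k : ℤ}

theorem side (S : Set (Arc n)) (i : ℤ) : Edge S i (i + 1) := Or.inl rfl

theorem mono (hST : S ⊆ T) (h : Edge S i j) : Edge T i j := h.imp_right fun h => hST h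

theorem shift (h : Edge S i j) (hk : ((n : ℤ) + 2) ∣ k) : Edge S (i + k) (j + k) :=
  h.imp (fun h => by omega) fun h => by rwa [arc_shift hk]

theorem mem (h : Edge S i j) (hij : i + 2 ≤ j) : arc n i j ∈ S :=
  h.resolve_left (by omega)

end Edge

/-- A set of pairwise non-crossing orbits of diagonals. -/
structure Noncrossing (S : Set (Arc n)) : Prop where
  length_mem : ∀ α ∈ S, 2 ≤ α.2 ∧ α.2 ≤ (n : ℤ) + 2
  not_cross : ∀ i j p q : ℤ, arc n i j ∈ S → arc n p q ∈ S → ¬ (i < p ∧ p < j ∧ j < q)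

/-- The edge from `i` to `j` is the innermost edge of `S` over the point `x`. (The edges of a
non-crossing set over a given point are nested.) -/
structure Innermost (S : Set (Arc n)) (x i j : ℤ) : Prop where
  edge : Edge S i j
  left_lt : i < x
  lt_right : x < j
  eq_of_le : ∀ p q, Edge S p q → p < x → x < q → i ≤ p → q ≤ j → p = i ∧ q = j

namespace Noncrossing

variable {S : Set (Arc n)}

theorem mono {T : Set (Arc n)} (hS : Noncrossing S) (h : T ⊆ S) : Noncrossing T :=
  ⟨fun α hα => hS.length_mem α (h hα),
    fun i j p q hij hpq => hS.not_cross i j p q (h hij) (h hpq)⟩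

theorem lt (hS : Noncrossing S) {i j : ℤ} (h : Edge S i j) : i < j := by
  rcases h with h | h
  · omega
  · have := hS.length_mem _ h
    rw [arc_snd] at this
    omega

theorem le (hS : Noncrossing S) {i j : ℤ} (h : Edge S i j) : j ≤ i + ((n : ℤ) + 2) := by
  rcases h with h | h
  · omega
  · have := hS.length_mem _ h
    rw [arc_snd] at this
    omega

theorem edge (hS : Noncrossing S) {i j p q : ℤ} (h : Edge S i j) (h' : Edge S p q) :
    ¬ (i < p ∧ p < j ∧ j < q) := by
  rcases h with h | h
  · omega
  rcases h' with h' | h'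
  · omega
  exact hS.not_cross i j p q h h'

theorem insert_arc (hS : Noncrossing S) {i j : ℤ} (hij : i + 2 ≤ j) (hji : j ≤ i + ((n : ℤ) + 2))
    (h : ∀ p q, arc n p q ∈ S → ¬ (p < i ∧ i < q ∧ q < j) ∧ ¬ (i < p ∧ p < j ∧ j < q)) :
    Noncrossing (insert (arc n i j) S) := by
  constructor
  · rintro α (rfl | hα)
    · rw [arc_snd]
      omega
    · exact hS.length_mem α hα
  · rintro a b p q (hab | hab) (hpq | hpq) hcross
    · have hap := (arc_eq_arc_iff.1 (hab.trans hpq.symm)).1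
      have hlen := (arc_eq_arc_iff.1 hab).2
      have := eq_zero_of_dvd_of_lt hap (by omega) (by omega)
      omega
    · obtain ⟨hdvd, hlen⟩ := arc_eq_arc_iff.1 hab
      rw [← arc_shift hdvd] at hpq
      have := h _ _ hpq
      omega
    · obtain ⟨hdvd, hlen⟩ := arc_eq_arc_iff.1 hpq
      rw [← arc_shift hdvd] at hab
      have := h _ _ hab
      omega
    · exact hS.not_cross _ _ _ _ hab hpq hcross

theorem exists_innermost_of_edge (hS : Noncrossing S) {i j : ℤ} (h : Edge S i j)
    (hij : i + 2 ≤ j) : ∃ x, Edge S i x ∧ Innermost S x i j := by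
  obtain ⟨x, ⟨hx, hxj⟩, hmax⟩ := Int.exists_greatest_of_bdd (P := fun x => Edge S i x ∧ x < j)
    ⟨j, fun z hz => hz.2.le⟩ ⟨i + 1, Edge.side S i, by omega⟩
  refine ⟨x, hx, h, hS.lt hx, hxj, fun p q hpq hpx hxq hip hqj => ?_⟩
  have hcross := hS.edge hx hpq
  obtain rfl : p = i := by omega
  refine ⟨rfl, ?_⟩
  by_contra hne
  have := hmax q ⟨hpq, by omega⟩
  omega

theorem exists_innermost_of_lt (hS : Noncrossing S) {x a b : ℤ} (h : Edge S a b) (hax : a < x)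
    (hxb : x < b) : ∃ i j, Innermost S x i j := by
  obtain ⟨k, ⟨i, hi, hix, hxk⟩, hmin⟩ := Int.exists_least_of_bdd
    (P := fun k => ∃ i, Edge S i (i + k) ∧ i < x ∧ x < i + k)
    ⟨0, fun z ⟨i, hi, _⟩ => by have := hS.lt hi; omega⟩
    ⟨b - a, a, by simpa using h, hax, by simpa using hxb⟩
  refine ⟨i, i + k, hi, hix, hxk, fun p q hpq hpx hxq hip hqk => ?_⟩
  have := hmin (q - p) ⟨p, by simpa using hpq, hpx, by simpa using hxq⟩
  omega

theorem innermost_unique (hS : Noncrossing S) {x i j p q : ℤ} (h : Innermost S x i j)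
    (h' : Innermost S x p q) : p = i ∧ q = j := by
  have hcross := hS.edge h.edge h'.edge
  have hcross' := hS.edge h'.edge h.edge
  have := h.left_lt
  have := h.lt_right
  have := h'.left_lt
  have := h'.lt_right
  have hin := h.eq_of_le _ _ h'.edge h'.left_lt h'.lt_right
  have hin' := h'.eq_of_le _ _ h.edge h.left_lt h.lt_right
  omega

theorem exists_uncovered (hS : Noncrossing S) : ∃ a, ∀ p q, Edge S p q → ¬ (p < a ∧ a < q) := by
  obtain ⟨k, ⟨i, hi⟩, hmax⟩ := Int.exists_greatest_of_bdd (P := fun k => ∃ i, Edge S i (i + k))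
    ⟨(n : ℤ) + 2, fun z ⟨i, hi⟩ => by have := hS.le hi; omega⟩ ⟨1, 0, Edge.side S 0⟩
  refine ⟨i + k, fun p q hpq hover => ?_⟩
  have hcross := hS.edge hi hpq
  have hlen := hmax (q - p) ⟨p, by simpa using hpq⟩
  have := hS.lt hi
  omega

theorem finite (hS : Noncrossing S) : S.Finite :=
  (Set.finite_univ.prod (Set.finite_Icc 2 ((n : ℤ) + 2))).subset
    fun α hα => ⟨Set.mem_univ _, hS.length_mem α hα⟩

end Noncrossing

theorem Innermost.shift {S : Set (Arc n)} {x i j k : ℤ} (h : Innermost S x i j)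
    (hk : ((n : ℤ) + 2) ∣ k) : Innermost S (x + k) (i + k) (j + k) := by
  refine ⟨h.edge.shift hk, by linarith [h.left_lt], by linarith [h.lt_right],
    fun p q hpq hpx hxq hip hqj => ?_⟩
  have := h.eq_of_le _ _ (hpq.shift hk.neg_right) (by omega) (by omega) (by omega) (by omega)
  omega

theorem ncard_compl_singleton_zmod (a : ZMod (n + 2)) :
    ({a}ᶜ : Set (ZMod (n + 2))).ncard = n + 1 := by
  rw [Set.ncard_compl, Set.ncard_singleton, Nat.card_zmod]
  rfl

theorem Noncrossing.ncard_le {S : Set (Arc n)} (hS : Noncrossing S) : S.ncard ≤ n + 1 := by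
  obtain ⟨a, ha⟩ := hS.exists_uncovered
  have hinner : ∀ α ∈ S, ∃ x i j : ℤ, arc n i j = α ∧ Innermost S x i j := by
    intro α hα
    obtain ⟨i, hi⟩ := exists_arc α
    have hlen := (hS.length_mem α hα).1
    obtain ⟨x, -, hx⟩ := hS.exists_innermost_of_edge (Or.inr (hi.symm ▸ hα)) (by omega)
    exact ⟨x, i, _, hi, hx⟩
  choose! x hx using hinner
  rw [← ncard_compl_singleton_zmod (a : ZMod (n + 2))]
  refine Set.ncard_le_ncard_of_injOn (fun α => (x α : ZMod (n + 2))) ?_ ?_ (Set.toFinite _)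
  · intro α hα hxa
    obtain ⟨i, j, -, hij⟩ := hx α hα
    have hij' := hij.shift (intCast_zmod_eq_iff.1 hxa)
    exact ha _ _ hij'.edge ⟨by linarith [hij.left_lt], by linarith [hij.lt_right]⟩
  · intro α hα β hβ hxy
    obtain ⟨i, j, hα', hij⟩ := hx α hα
    obtain ⟨p, q, hβ', hpq⟩ := hx β hβ
    have hdvd := intCast_zmod_eq_iff.1 hxy
    have hij' := hij.shift hdvd
    rw [add_sub_cancel] at hij'
    obtain ⟨rfl, rfl⟩ := hS.innermost_unique hij' hpq
    rw [← hα', ← hβ', arc_shift hdvd]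

/-- A maximal set of pairwise non-crossing orbits of diagonals. -/
structure Full (S : Set (Arc n)) : Prop extends Noncrossing S where
  arc_mem : ∀ i j : ℤ, i + 2 ≤ j → j ≤ i + ((n : ℤ) + 2) →
    (∀ p q, arc n p q ∈ S → ¬ (p < i ∧ i < q ∧ q < j) ∧ ¬ (i < p ∧ p < j ∧ j < q)) →
    arc n i j ∈ S

namespace Noncrossing

variable {S : Set (Arc n)}

theorem full_of_ncard (hS : Noncrossing S) (h : S.ncard = n + 1) : Full S := by
  refine ⟨hS, fun i j hij hji hcross => ?_⟩
  by_contra hnotMem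
  have hle := (hS.insert_arc hij hji hcross).ncard_le
  rw [Set.ncard_insert_of_notMem hnotMem hS.finite] at hle
  omega

theorem apex_unique (hS : Noncrossing S) {i j x y : ℤ} (hix : Edge S i x) (hxj : Edge S x j)
    (hiy : Edge S i y) (hyj : Edge S y j) : x = y := by
  have hxy := hS.edge hix hyj
  have hyx := hS.edge hiy hxj
  have := hS.lt hix
  have := hS.lt hxj
  have := hS.lt hiy
  have := hS.lt hyj
  omega

theorem not_lt_central_lt (hS : Noncrossing S) {a p q : ℤ} (ha : Edge S a (a + ((n : ℤ) + 2)))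
    (h : Edge S p q) : ¬ (p < a ∧ a < q) := by
  have hcross := hS.edge h ha
  have hle := hS.le h
  omega

theorem dvd_sub_of_central (hS : Noncrossing S) {a b : ℤ} (ha : Edge S a (a + ((n : ℤ) + 2)))
    (hb : Edge S b (b + ((n : ℤ) + 2))) : ((n : ℤ) + 2) ∣ a - b := by
  obtain ⟨k, hk, hle, hlt⟩ := exists_dvd_and_le_and_lt (n := n) b a
  have hcover := hS.not_lt_central_lt ha (hb.shift hk)
  rwa [show a - b = k by omega]

theorem eq_of_central (hS : Noncrossing S) {α β : Arc n} (hα : α ∈ S) (hβ : β ∈ S)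
    (hαn : α.2 = (n : ℤ) + 2) (hβn : β.2 = (n : ℤ) + 2) : α = β := by
  obtain ⟨a, ha⟩ := exists_arc α
  obtain ⟨b, hb⟩ := exists_arc β
  rw [hαn] at ha
  rw [hβn] at hb
  rw [← ha, ← hb, arc_eq_arc_iff]
  exact ⟨hS.dvd_sub_of_central (Or.inr (hb ▸ hβ)) (Or.inr (ha ▸ hα)), by ring⟩

end Noncrossing

namespace Full

variable {S : Set (Arc n)}

theorem edge_of_forall (hS : Full S) {i j : ℤ} (hij : i < j) (hji : j ≤ i + ((n : ℤ) + 2))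
    (h : ∀ p q, Edge S p q → ¬ (p < i ∧ i < q ∧ q < j) ∧ ¬ (i < p ∧ p < j ∧ j < q)) :
    Edge S i j := by
  by_cases hside : j = i + 1
  · exact Or.inl hside
  · exact Or.inr (hS.arc_mem i j (by omega) hji fun p q hpq => h p q (Or.inr hpq))

theorem exists_apex (hS : Full S) {i j : ℤ} (h : Edge S i j) (hij : i + 2 ≤ j) :
    ∃ x, i < x ∧ x < j ∧ Edge S i x ∧ Edge S x j := by
  obtain ⟨x, hix, hx⟩ := hS.exists_innermost_of_edge h hij
  have hle := hS.le h
  have hlt := hx.left_lt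
  refine ⟨x, hlt, hx.lt_right, hix, hS.edge_of_forall hx.lt_right (by omega) fun p q hpq => ?_⟩
  have hin := hx.eq_of_le p q hpq
  have hcross := hS.edge h hpq
  have hcross' := hS.edge hpq h
  omega

theorem edges_of_innermost (hS : Full S) {x i j : ℤ} (h : Innermost S x i j) :
    Edge S i x ∧ Edge S x j := by
  have := h.left_lt
  have := h.lt_right
  obtain ⟨y, hiy, hyj, hy, hy'⟩ := hS.exists_apex h.edge (by omega)
  have hleft := h.eq_of_le i y hy
  have hright := h.eq_of_le y j hy'
  obtain rfl : x = y := by omega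
  exact ⟨hy, hy'⟩

theorem exists_central (hS : Full S) : ∃ a, Edge S a (a + ((n : ℤ) + 2)) := by
  obtain ⟨a, ha⟩ := hS.exists_uncovered
  refine ⟨a, hS.edge_of_forall (by omega) le_rfl fun p q hpq => ?_⟩
  have hcover := ha p q hpq
  have hcover' := ha _ _ (hpq.shift (k := -((n : ℤ) + 2)) (dvd_refl _).neg_right)
  omega

theorem exists_central_le (hS : Full S) (i : ℤ) :
    ∃ a, Edge S a (a + ((n : ℤ) + 2)) ∧ a ≤ i ∧ i < a + ((n : ℤ) + 2) := by
  obtain ⟨a, ha⟩ := hS.exists_central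
  obtain ⟨k, hk, hle, hlt⟩ := exists_dvd_and_le_and_lt (n := n) a i
  exact ⟨a + k, by simpa only [add_right_comm] using ha.shift hk, hle, hlt⟩

theorem exists_outer_apex (hS : Full S) {i j : ℤ} (h : Edge S i j)
    (hij : j < i + ((n : ℤ) + 2)) :
    ∃ x, (j < x ∧ x ≤ i + ((n : ℤ) + 2) ∧ Edge S j x ∧ Edge S i x) ∨
      (x < i ∧ j ≤ x + ((n : ℤ) + 2) ∧ Edge S x i ∧ Edge S x j) := by
  obtain ⟨a, ha, hai, hia⟩ := hS.exists_central_le i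
  have hlt := hS.lt h
  have hcentral := hS.edge ha h
  -- The apex lies on the shortest edge that strictly contains the given one.
  obtain ⟨k, ⟨p, hp, hpi, hjp, hne⟩, hmin⟩ := Int.exists_least_of_bdd
    (P := fun k => ∃ p, Edge S p (p + k) ∧ p ≤ i ∧ j ≤ p + k ∧ j - i ≠ k)
    ⟨0, fun z ⟨p, hp, _⟩ => by have := hS.lt hp; omega⟩
    ⟨(n : ℤ) + 2, a, ha, hai, by omega, by omega⟩
  obtain ⟨x, hpx, hxq, hx, hx'⟩ := hS.exists_apex hp (by omega)
  have hle := hS.le hp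
  have hcross := hS.edge hx h
  have hcross' := hS.edge h hx'
  have hleft := fun hpi hjx hne => hmin (x - p) ⟨p, by simpa using hx, hpi, hjx, hne⟩
  have hright := fun hxi hjk hne => hmin (p + k - x) ⟨x, by simpa using hx', hxi, hjk, hne⟩
  rcases lt_or_ge i x with hix | hxi
  · obtain rfl : x = j := by omega
    obtain rfl : p = i := by omega
    exact ⟨p + k, Or.inl ⟨hxq, by omega, hx', hp⟩⟩
  · obtain rfl : x = i := by omega
    obtain rfl : p + k = j := by omega
    exact ⟨p, Or.inr ⟨hpx, by omega, hx, hp⟩⟩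

theorem exists_innermost_of_ne (hS : Full S) {a x : ℤ} (ha : Edge S a (a + ((n : ℤ) + 2)))
    (hx : (x : ZMod (n + 2)) ≠ (a : ZMod (n + 2))) : ∃ i j, Innermost S x i j := by
  obtain ⟨b, hb, hbx, hxb⟩ := hS.exists_central_le x
  have hne : b ≠ x := by
    rintro rfl
    exact hx (intCast_zmod_eq_iff.2 (hS.dvd_sub_of_central ha hb))
  exact hS.exists_innermost_of_lt hb (by omega) hxb

theorem ncard (hS : Full S) : S.ncard = n + 1 := by
  refine le_antisymm hS.ncard_le ?_
  obtain ⟨a, ha⟩ := hS.exists_central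
  have hinner : ∀ c ∈ ({(a : ZMod (n + 2))}ᶜ : Set (ZMod (n + 2))), ∃ α ∈ S, ∃ i j x : ℤ,
      arc n i j = α ∧ (x : ZMod (n + 2)) = c ∧ Edge S i x ∧ Edge S x j := by
    intro c hc
    obtain ⟨x, rfl⟩ := ZMod.intCast_surjective c
    obtain ⟨i, j, hx⟩ := hS.exists_innermost_of_ne ha hc
    have := hx.left_lt
    have := hx.lt_right
    exact ⟨_, hx.edge.mem (by omega), i, j, x, rfl, rfl, hS.edges_of_innermost hx⟩
  choose! g hg hg' using hinner
  rw [← ncard_compl_singleton_zmod (a : ZMod (n + 2))]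
  refine Set.ncard_le_ncard_of_injOn g hg ?_ hS.finite
  intro c hc d hd hcd
  obtain ⟨i, j, x, hij, rfl, hix, hxj⟩ := hg' c hc
  obtain ⟨p, q, y, hpq, rfl, hpy, hyq⟩ := hg' d hd
  obtain ⟨hdvd, hlen⟩ := arc_eq_arc_iff.1 (hij.trans (hcd.trans hpq.symm))
  have hpx := hix.shift hdvd
  have hxq := hxj.shift hdvd
  rw [add_sub_cancel] at hpx
  rw [show j + (p - i) = q by omega] at hxq
  rw [intCast_zmod_eq_iff, ← hS.apex_unique hpx hxq hpy hyq]
  simpa using hdvd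

end Full

/-! ### Exchanges -/

theorem Edge.diff {S : Set (Arc n)} {i j : ℤ} (h : Edge S i j) {α : Arc n} (hα : arc n i j ≠ α) :
    Edge (S \ {α}) i j :=
  h.imp_right fun h => ⟨h, hα⟩

/-- The four sides of the quadrilateral `w < x < y < z` are edges of `S`. -/
structure Quad (S : Set (Arc n)) (w x y z : ℤ) : Prop where
  wx : w < x
  xy : x < y
  yz : y < z
  le : z ≤ w + ((n : ℤ) + 2)
  edge_wx : Edge S w x
  edge_xy : Edge S x y
  edge_yz : Edge S y z
  edge_wz : Edge S w z

namespace Quad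

variable {S : Set (Arc n)} {w x y z : ℤ}

theorem mono {T : Set (Arc n)} (h : Quad S w x y z) (hST : S ⊆ T) : Quad T w x y z :=
  { h with
    edge_wx := h.edge_wx.mono hST
    edge_xy := h.edge_xy.mono hST
    edge_yz := h.edge_yz.mono hST
    edge_wz := h.edge_wz.mono hST }

theorem diff_left (h : Quad S w x y z) : Quad (S \ {arc n w y}) w x y z := by
  obtain ⟨wx, xy, yz, le, hwx, hxy, hyz, hwz⟩ := h
  exact ⟨wx, xy, yz, le, hwx.diff (arc_ne_of_length (by omega)),
    hxy.diff (arc_ne_of_length (by omega)),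
    hyz.diff (arc_ne_of_start (by omega) (by omega) (by omega)),
    hwz.diff (arc_ne_of_length (by omega))⟩

theorem diff_right (h : Quad S w x y z) : Quad (S \ {arc n x z}) w x y z := by
  obtain ⟨wx, xy, yz, le, hwx, hxy, hyz, hwz⟩ := h
  exact ⟨wx, xy, yz, le, hwx.diff (arc_ne_of_start (by omega) (by omega) (by omega)),
    hxy.diff (arc_ne_of_length (by omega)), hyz.diff (arc_ne_of_length (by omega)),
    hwz.diff (arc_ne_of_length (by omega))⟩

theorem not_cross_side (h : Quad S w x y z) (hS : Noncrossing S) {p q : ℤ} (hpq : Edge S p q)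
    {i j : ℤ} (hij : (i, j) ∈ ({(w, x), (x, y), (y, z), (w, z)} : Set (ℤ × ℤ))) :
    ¬ (p < i ∧ i < q ∧ q < j) ∧ ¬ (i < p ∧ p < j ∧ j < q) := by
  have hij' : Edge S i j := by
    rcases hij with h' | h' | h' | h' <;> obtain ⟨rfl, rfl⟩ := Prod.mk.inj h'
    exacts [h.edge_wx, h.edge_xy, h.edge_yz, h.edge_wz]
  exact ⟨hS.edge hpq hij', hS.edge hij' hpq⟩

theorem eq_of_cross_left (h : Quad S w x y z) (hS : Noncrossing S) {p q : ℤ} (hpq : Edge S p q)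
    (hcross : (p < w ∧ w < q ∧ q < y) ∨ (w < p ∧ p < y ∧ y < q)) : p = x ∧ q = z := by
  have hwx := h.not_cross_side hS hpq (i := w) (j := x) (by simp)
  have hxy := h.not_cross_side hS hpq (i := x) (j := y) (by simp)
  have hyz := h.not_cross_side hS hpq (i := y) (j := z) (by simp)
  have hwz := h.not_cross_side hS hpq (i := w) (j := z) (by simp)
  obtain ⟨wx, xy, yz, -, -, -, -, -⟩ := h
  omega

theorem eq_of_cross_right (h : Quad S w x y z) (hS : Noncrossing S) {p q : ℤ} (hpq : Edge S p q)
    (hcross : (p < x ∧ x < q ∧ q < z) ∨ (x < p ∧ p < z ∧ z < q)) : p = w ∧ q = y := by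
  have hwx := h.not_cross_side hS hpq (i := w) (j := x) (by simp)
  have hxy := h.not_cross_side hS hpq (i := x) (j := y) (by simp)
  have hyz := h.not_cross_side hS hpq (i := y) (j := z) (by simp)
  have hwz := h.not_cross_side hS hpq (i := w) (j := z) (by simp)
  obtain ⟨wx, xy, yz, -, -, -, -, -⟩ := h
  omega

end Quad

/-- The four sides of the centrally symmetric quadrilateral with vertices `a`, `x` and their
antipodes are edges of `S`. -/
structure CentralQuad (S : Set (Arc n)) (a x : ℤ) : Prop where
  lt : a < x
  lt_add : x < a + ((n : ℤ) + 2)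
  edge : Edge S a x
  edge_add : Edge S x (a + ((n : ℤ) + 2))

namespace CentralQuad

variable {S : Set (Arc n)} {a x : ℤ}

theorem mono {T : Set (Arc n)} (h : CentralQuad S a x) (hST : S ⊆ T) : CentralQuad T a x :=
  ⟨h.lt, h.lt_add, h.edge.mono hST, h.edge_add.mono hST⟩

theorem symm (h : CentralQuad S a x) : CentralQuad S x (a + ((n : ℤ) + 2)) :=
  ⟨h.lt_add, by linarith [h.lt], h.edge_add, h.edge.shift (dvd_refl _)⟩

theorem diff (h : CentralQuad S a x) : CentralQuad (S \ {arc n a (a + ((n : ℤ) + 2))}) a x := by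
  obtain ⟨lt, lt_add, hax, hxa⟩ := h
  exact ⟨lt, lt_add, hax.diff (arc_ne_of_length (by omega)),
    hxa.diff (arc_ne_of_length (by omega))⟩

theorem eq_of_cross (h : CentralQuad S a x) (hS : Noncrossing S) {p q : ℤ} (hpq : Edge S p q)
    (hcross : (p < a ∧ a < q ∧ q < a + ((n : ℤ) + 2)) ∨
      (a < p ∧ p < a + ((n : ℤ) + 2) ∧ a + ((n : ℤ) + 2) < q)) :
    (p = x ∧ q = x + ((n : ℤ) + 2)) ∨ (p = x - ((n : ℤ) + 2) ∧ q = x) := by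
  obtain ⟨lt, lt_add, hax, hxa⟩ := h
  have hle := hS.le hpq
  rcases hcross with hcross | hcross
  · have hcross_ax := hS.edge hpq hax
    have hcross_xa := hS.edge hpq hxa
    have hcross_shift := hS.edge (hxa.shift (dvd_refl ((n : ℤ) + 2)).neg_right) hpq
    omega
  · have := hS.edge hax hpq
    have hcross_xa := hS.edge hxa hpq
    have hcross_shift := hS.edge hpq (hax.shift (dvd_refl ((n : ℤ) + 2)))
    omega

end CentralQuad

/-- `α` and `β` are the two diagonals of a quadrilateral with sides in `S`. -/
inductive Exchange (S : Set (Arc n)) : Arc n → Arc n → Prop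
  | left {w x y z : ℤ} (h : Quad S w x y z) : Exchange S (arc n w y) (arc n x z)
  | right {w x y z : ℤ} (h : Quad S w x y z) : Exchange S (arc n x z) (arc n w y)
  | central {a x : ℤ} (h : CentralQuad S a x) :
      Exchange S (arc n a (a + ((n : ℤ) + 2))) (arc n x (x + ((n : ℤ) + 2)))

namespace Exchange

variable {S : Set (Arc n)} {α β : Arc n}

theorem mono {T : Set (Arc n)} (h : Exchange S α β) (hST : S ⊆ T) : Exchange T α β := by
  cases h with
  | left h => exact .left (h.mono hST)
  | right h => exact .right (h.mono hST)
  | central h => exact .central (h.mono hST)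

theorem symm (h : Exchange S α β) : Exchange S β α := by
  cases h with
  | left h => exact .right h
  | right h => exact .left h
  | @central a x h => simpa only [arc_shift (dvd_refl _) a] using Exchange.central h.symm

theorem diff (h : Exchange S α β) : Exchange (S \ {α}) α β := by
  cases h with
  | left h => exact .left h.diff_left
  | right h => exact .right h.diff_right
  | central h => exact .central h.diff

theorem exists_cross (h : Exchange S α β) : ∃ i j p q, arc n i j = α ∧ arc n p q = β ∧
    ((i < p ∧ p < j ∧ j < q) ∨ (p < i ∧ i < q ∧ q < j)) := by
  cases h with
  | left h => exact ⟨_, _, _, _, rfl, rfl, Or.inl ⟨h.wx, h.xy, h.yz⟩⟩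
  | right h => exact ⟨_, _, _, _, rfl, rfl, Or.inr ⟨h.wx, h.xy, h.yz⟩⟩
  | central h => exact ⟨_, _, _, _, rfl, rfl, Or.inl ⟨h.lt, h.lt_add, by linarith [h.lt]⟩⟩

theorem ne (h : Exchange S α β) : α ≠ β := by
  cases h with
  | left h => exact arc_ne_of_start h.wx.ne (by linarith [h.xy, h.yz, h.le]) (by linarith [h.wx])
  | right h =>
    exact arc_ne_of_start h.wx.ne' (by linarith [h.wx]) (by linarith [h.xy, h.yz, h.le])
  | central h => exact arc_ne_of_start h.lt.ne (by linarith [h.lt_add]) (by linarith [h.lt])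

theorem central_iff (h : Exchange S α β) : α.2 = (n : ℤ) + 2 ↔ β.2 = (n : ℤ) + 2 := by
  cases h with
  | left h | right h =>
    obtain ⟨wx, -, yz, le, -, -, -, -⟩ := h
    simp only [arc_snd]
    omega
  | central h => simp only [arc_snd, add_sub_cancel_left]

theorem exists_lift (h : Exchange S α β) (hS : Noncrossing S) :
    ∃ i j, α = arc n i j ∧ i + 2 ≤ j ∧ j ≤ i + ((n : ℤ) + 2) ∧ ∀ p q, arc n p q ∈ S →
      (p < i ∧ i < q ∧ q < j) ∨ (i < p ∧ p < j ∧ j < q) → arc n p q = β := by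
  cases h with
  | @left w x y z h =>
    refine ⟨w, y, rfl, by linarith [h.wx, h.xy], by linarith [h.yz, h.le], fun p q hpq hcross => ?_⟩
    obtain ⟨rfl, rfl⟩ := h.eq_of_cross_left hS (Or.inr hpq) hcross
    rfl
  | @right w x y z h =>
    refine ⟨x, z, rfl, by linarith [h.xy, h.yz], by linarith [h.wx, h.le], fun p q hpq hcross => ?_⟩
    obtain ⟨rfl, rfl⟩ := h.eq_of_cross_right hS (Or.inr hpq) hcross
    rfl
  | @central a x h =>
    refine ⟨a, _, rfl, by linarith [h.lt, h.lt_add], le_rfl, fun p q hpq hcross => ?_⟩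
    obtain ⟨rfl, rfl⟩ | ⟨rfl, rfl⟩ := h.eq_of_cross hS (Or.inr hpq) hcross
    · rfl
    · exact arc_eq_arc_iff.2 ⟨by simp, by ring⟩

theorem noncrossing (h : Exchange S α β) (hS : Noncrossing S) :
    Noncrossing (insert β (S \ {α})) := by
  have hS' := hS.mono (Set.sdiff_subset (s := S) (t := {α}))
  obtain ⟨i, j, rfl, hij, hji, heq⟩ := h.diff.symm.exists_lift hS'
  refine hS'.insert_arc hij hji fun p q hpq => ?_
  have := mt (heq p q hpq) hpq.2
  tauto

end Exchange

theorem Full.exists_exchange {S : Set (Arc n)} (hS : Full S) {α : Arc n} (hα : α ∈ S) :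
    ∃ β, Exchange S α β := by
  obtain ⟨i, hi⟩ := exists_arc α
  have hlen := hS.length_mem α hα
  have hedge : Edge S i (i + α.2) := Or.inr (hi.symm ▸ hα)
  obtain ⟨x, hix, hxj, hx, hx'⟩ := hS.exists_apex hedge (by omega)
  rw [← hi]
  rcases hlen.2.lt_or_eq with hlt | heq
  · obtain ⟨y, ⟨hjy, hyi, hy, hy'⟩ | ⟨hyi, hjy, hy, hy'⟩⟩ :=
      hS.exists_outer_apex hedge (by omega)
    · exact ⟨_, .left ⟨hix, hxj, hjy, hyi, hx, hx', hy, hy'⟩⟩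
    · exact ⟨_, .right ⟨hyi, hix, hxj, hjy, hy, hx, hx', hy'⟩⟩
  · rw [heq] at hxj hx' ⊢
    exact ⟨_, .central ⟨hix, hxj, hx, hx'⟩⟩

/-! ### Labelled triangulations -/

theorem injective_update {X Y : Type*} [DecidableEq X] {f : X → Y} (hf : Function.Injective f)
    (a : X) {b : Y} (hb : ∀ x, f x ≠ b) : Function.Injective (Function.update f a b) := by
  intro x y hxy
  by_cases hx : x = a <;> by_cases hy : y = a <;>
    simp only [Function.update_apply, hx, hy, if_true, if_false] at hxy ⊢
  exacts [(hb _ hxy.symm).elim, (hb _ hxy).elim, hf hxy]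

/-- A labelling of the orbits of diagonals of a centrally symmetric triangulation. Since a
non-crossing set has at most `n + 1` elements, the image of `f` is a full triangulation. -/
structure IsLabelling (f : Option (Fin n) → Arc n) : Prop where
  noncrossing : Noncrossing (Set.range f)
  injective : Function.Injective f

theorem IsLabelling.full {f : Option (Fin n) → Arc n} (hf : IsLabelling f) :
    Full (Set.range f) := by
  refine hf.noncrossing.full_of_ncard ?_
  rw [← Set.image_univ, Set.ncard_image_of_injective _ hf.injective, Set.ncard_univ,
    Nat.card_eq_fintype_card, Fintype.card_option, Fintype.card_fin]

/-- The centrally symmetric triangulations with labelled orbits of diagonals. The label of the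
central diagonal is arbitrary. -/
abbrev Labelling (n : ℕ) : Type := {f : Option (Fin n) → Arc n // IsLabelling f}

namespace Labelling

instance : CoeFun (Labelling n) fun _ => Option (Fin n) → Arc n := ⟨Subtype.val⟩

theorem edge_of_apply_eq (f : Labelling n) {l : Option (Fin n)} {i j : ℤ}
    (h : f l = arc n i j) : Edge (Set.range f) i j :=
  Or.inr ⟨l, h⟩

theorem not_cross (f : Labelling n) {l k : Option (Fin n)} {i j p q : ℤ} (hl : f l = arc n i j)
    (hk : f k = arc n p q) : ¬ (i < p ∧ p < j ∧ j < q) ∧ ¬ (p < i ∧ i < q ∧ q < j) :=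
  ⟨f.2.noncrossing.edge (f.edge_of_apply_eq hl) (f.edge_of_apply_eq hk),
    f.2.noncrossing.edge (f.edge_of_apply_eq hk) (f.edge_of_apply_eq hl)⟩

theorem length_mem (f : Labelling n) (l : Option (Fin n)) :
    2 ≤ (f l).2 ∧ (f l).2 ≤ (n : ℤ) + 2 :=
  f.2.noncrossing.length_mem _ ⟨l, rfl⟩

theorem apply_ne_of_exchange (f : Labelling n) {l : Option (Fin n)} {β : Arc n}
    (h : Exchange (Set.range f) (f l) β) (k : Option (Fin n)) : f k ≠ β := by
  rintro rfl
  obtain ⟨i, j, p, q, hij, hpq, hcross⟩ := h.exists_cross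
  have := f.not_cross hij.symm hpq.symm
  tauto

theorem isLabelling_update (f : Labelling n) {l : Option (Fin n)} {β : Arc n}
    (h : Exchange (Set.range f) (f l) β) : IsLabelling (Function.update f.1 l β) := by
  constructor
  · refine (h.noncrossing f.2.noncrossing).mono ?_
    rintro _ ⟨k, rfl⟩
    rcases eq_or_ne k l with rfl | hk
    · exact Or.inl (Function.update_self ..)
    · rw [Function.update_of_ne hk]
      exact Or.inr ⟨⟨k, rfl⟩, fun hkl => hk (f.2.injective hkl)⟩
  · exact injective_update f.2.injective l (f.apply_ne_of_exchange h)

theorem exists_exchange (f : Labelling n) (l : Option (Fin n)) :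
    ∃ β, Exchange (Set.range f) (f l) β :=
  f.2.full.exists_exchange ⟨l, rfl⟩

/-- The flip of the orbit with label `l`. -/
noncomputable def flip (l : Option (Fin n)) (f : Labelling n) : Labelling n :=
  ⟨_, f.isLabelling_update (f.exists_exchange l).choose_spec⟩

theorem flip_apply_of_ne (f : Labelling n) {l k : Option (Fin n)} (h : k ≠ l) :
    f.flip l k = f k :=
  Function.update_of_ne h _ _

theorem exchange_flip (f : Labelling n) (l : Option (Fin n)) :
    Exchange (Set.range f) (f l) (f.flip l l) := by
  have h : f.flip l l = (f.exists_exchange l).choose := Function.update_self _ _ _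
  rw [h]
  exact (f.exists_exchange l).choose_spec

theorem flip_apply_ne (f : Labelling n) (l : Option (Fin n)) : f.flip l l ≠ f l :=
  (f.exchange_flip l).ne.symm

theorem range_diff_subset_range {f g : Labelling n} {l : Option (Fin n)}
    (h : ∀ k, k ≠ l → g k = f k) : Set.range f \ {f l} ⊆ Set.range g := by
  rintro _ ⟨⟨k, rfl⟩, hk⟩
  exact ⟨k, h k fun hkl => hk (congrArg f.1 hkl)⟩

theorem eq_of_exchange (f g : Labelling n) {l : Option (Fin n)} (h : ∀ k, k ≠ l → g k = f k)
    (hl : g l ≠ f l) {β : Arc n} (hβ : Exchange (Set.range f) (f l) β) : g l = β := by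
  obtain ⟨i, j, hij, hlo, hhi, heq⟩ :=
    (hβ.diff.mono (range_diff_subset_range h)).exists_lift g.2.noncrossing
  by_contra hne
  have hmem : arc n i j ∈ Set.range g := by
    refine g.2.full.arc_mem i j hlo hhi fun p q ⟨k, hk⟩ => ?_
    rcases eq_or_ne k l with rfl | hkl
    · have := mt (heq p q ⟨k, hk⟩) fun hpq => hne (hk.trans hpq)
      tauto
    · have := f.not_cross hij ((h k hkl).symm.trans hk)
      tauto
  obtain ⟨k, hk⟩ := hmem
  rw [← hij] at hk
  rcases eq_or_ne k l with rfl | hkl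
  · exact hl hk
  · exact hkl (f.2.injective ((h k hkl).symm.trans hk))

theorem flip_eq_iff (f g : Labelling n) (l : Option (Fin n)) :
    g = f.flip l ↔ (∀ k, k ≠ l → g k = f k) ∧ g l ≠ f l := by
  constructor
  · rintro rfl
    exact ⟨fun k hk => f.flip_apply_of_ne hk, f.flip_apply_ne l⟩
  · rintro ⟨hne, hl⟩
    refine Subtype.ext (funext fun k => ?_)
    rcases eq_or_ne k l with rfl | hk
    · exact eq_of_exchange f g hne hl (f.exchange_flip k)
    · rw [hne k hk, f.flip_apply_of_ne hk]

theorem range_flip (f : Labelling n) (l : Option (Fin n)) :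
    Set.range (f.flip l) = insert (f.flip l l) (Set.range f \ {f l}) := by
  refine Set.Subset.antisymm ?_ (Set.insert_subset ⟨l, rfl⟩
    (range_diff_subset_range fun _ hk => f.flip_apply_of_ne hk))
  rintro _ ⟨k, rfl⟩
  rcases eq_or_ne k l with rfl | hk
  · exact Or.inl rfl
  · rw [f.flip_apply_of_ne hk]
    exact Or.inr ⟨⟨k, rfl⟩, f.2.injective.ne hk⟩

theorem flip_flip (f : Labelling n) (l : Option (Fin n)) : (f.flip l).flip l = f :=
  (((f.flip l).flip_eq_iff f l).2
    ⟨fun _ hk => (f.flip_apply_of_ne hk).symm, (f.flip_apply_ne l).symm⟩).symm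

theorem flip_apply_self (f : Labelling n) {l : Option (Fin n)} {β : Arc n}
    (h : Exchange (Set.range f) (f l) β) : f.flip l l = β :=
  eq_of_exchange f _ (fun _ hk => f.flip_apply_of_ne hk) (f.flip_apply_ne l) h

theorem edge_flip_of_ne (f : Labelling n) {l : Option (Fin n)} {i j : ℤ}
    (h : Edge (Set.range f) i j) (hl : arc n i j ≠ f l) : Edge (Set.range (f.flip l)) i j :=
  (h.diff hl).mono (range_diff_subset_range fun _ hk => f.flip_apply_of_ne hk)

theorem central_flip_iff (f : Labelling n) (l k : Option (Fin n)) :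
    (f.flip l k).2 = (n : ℤ) + 2 ↔ (f k).2 = (n : ℤ) + 2 := by
  rcases eq_or_ne k l with rfl | hk
  · exact (f.exchange_flip k).central_iff.symm
  · rw [f.flip_apply_of_ne hk]

theorem flip_comm_of_exchange (f : Labelling n) {c d : Option (Fin n)} (hcd : c ≠ d) {β : Arc n}
    (h : Exchange (Set.range f \ {f d}) (f c) β) :
    (f.flip d).flip c = (f.flip c).flip d := by
  have hflip : Exchange (Set.range (f.flip d)) (f.flip d c) β := by
    rw [f.flip_apply_of_ne hcd]
    exact h.mono (range_diff_subset_range fun _ hk => f.flip_apply_of_ne hk)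
  rw [flip_eq_iff]
  refine ⟨fun k hk => ?_, ?_⟩
  · rcases eq_or_ne k c with rfl | hkc
    · rw [flip_apply_self _ hflip, f.flip_apply_self (h.mono Set.sdiff_subset)]
    · rw [flip_apply_of_ne _ hkc, flip_apply_of_ne _ hkc, flip_apply_of_ne _ hk]
  · rw [flip_apply_of_ne _ hcd.symm, flip_apply_of_ne _ hcd.symm]
    exact f.flip_apply_ne d

theorem exists_central (f : Labelling n) : ∃ l, (f l).2 = (n : ℤ) + 2 := by
  obtain ⟨a, ha⟩ := f.2.full.exists_central
  obtain ⟨l, hl⟩ := ha.mem (by omega)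
  exact ⟨l, by rw [hl, arc_snd, add_sub_cancel_left]⟩

theorem central_unique (f : Labelling n) {l k : Option (Fin n)} (hl : (f l).2 = (n : ℤ) + 2)
    (hk : (f k).2 = (n : ℤ) + 2) : l = k :=
  f.2.injective (f.2.noncrossing.eq_of_central ⟨l, rfl⟩ ⟨k, rfl⟩ hl hk)

/-- Permute the labels. -/
def relabel (π : Equiv.Perm (Option (Fin n))) (f : Labelling n) : Labelling n :=
  ⟨fun l => f (π.symm l),
    f.2.noncrossing.mono (Set.range_comp_subset_range π.symm f.1),
    f.2.injective.comp π.symm.injective⟩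

theorem relabel_apply (π : Equiv.Perm (Option (Fin n))) (f : Labelling n) (l : Option (Fin n)) :
    relabel π f l = f (π.symm l) := rfl

theorem flip_relabel (π : Equiv.Perm (Option (Fin n))) (f : Labelling n) (l : Option (Fin n)) :
    (relabel π f).flip (π l) = relabel π (f.flip l) := by
  symm
  rw [flip_eq_iff]
  refine ⟨fun k hk => ?_, ?_⟩
  · exact f.flip_apply_of_ne fun h => hk ((Equiv.symm_apply_eq π).1 h)
  · rw [relabel_apply, relabel_apply, Equiv.symm_apply_apply]
    exact f.flip_apply_ne l

theorem relabel_relabel (π τ : Equiv.Perm (Option (Fin n))) (f : Labelling n) :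
    relabel π (relabel τ f) = relabel (π * τ) f := rfl

theorem relabel_one (f : Labelling n) : relabel 1 f = f := rfl

end Labelling

/-! ### Periods of alternating flips -/

namespace Labelling

/-- The segment from `i` to `j` is a side of `K`, or its label in `f` is neither `c` nor `d`. Such
segments survive all flips with labels `c` and `d`. -/
def OtherEdge (f : Labelling n) (c d : Option (Fin n)) (i j : ℤ) : Prop :=
  j = i + 1 ∨ ∃ k, k ≠ c ∧ k ≠ d ∧ f k = arc n i j

namespace OtherEdge

variable {f : Labelling n} {c d : Option (Fin n)} {i j : ℤ}

theorem edge (h : OtherEdge f c d i j) : Edge (Set.range f) i j :=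
  h.imp_right fun ⟨k, _, _, hk⟩ => ⟨k, hk⟩

theorem of_edge (h : Edge (Set.range f) i j) (hc : arc n i j ≠ f c) (hd : arc n i j ≠ f d) :
    OtherEdge f c d i j :=
  h.imp_right fun ⟨k, hk⟩ => ⟨k, fun hkc => hc (hk ▸ congrArg f.1 hkc),
    fun hkd => hd (hk ▸ congrArg f.1 hkd), hk⟩

theorem swap (h : OtherEdge f c d i j) : OtherEdge f d c i j :=
  h.imp_right fun ⟨k, hkc, hkd, hk⟩ => ⟨k, hkd, hkc, hk⟩

theorem flip_left (h : OtherEdge f c d i j) : OtherEdge (f.flip c) c d i j :=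
  h.imp_right fun ⟨k, hkc, hkd, hk⟩ => ⟨k, hkc, hkd, (f.flip_apply_of_ne hkc).trans hk⟩

theorem flip_right (h : OtherEdge f c d i j) : OtherEdge (f.flip d) c d i j :=
  h.swap.flip_left.swap

theorem shift (h : OtherEdge f c d i j) {k : ℤ} (hk : ((n : ℤ) + 2) ∣ k) :
    OtherEdge f c d (i + k) (j + k) :=
  h.imp (fun h => by omega) fun h => by rwa [arc_shift hk]

end OtherEdge

/-- The sides of the pentagon `v < w < x < y < z` belong to the triangulation `f`, and their labels
are not `c` or `d`. -/
structure PentagonSides (f : Labelling n) (c d : Option (Fin n)) (v w x y z : ℤ) : Prop where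
  vw : v < w
  wx : w < x
  xy : x < y
  yz : y < z
  le : z ≤ v + ((n : ℤ) + 2)
  side_vw : OtherEdge f c d v w
  side_wx : OtherEdge f c d w x
  side_xy : OtherEdge f c d x y
  side_yz : OtherEdge f c d y z
  side_vz : OtherEdge f c d v z

namespace PentagonSides

variable {f : Labelling n} {c d : Option (Fin n)} {v w x y z : ℤ}

theorem of_edge (vw : v < w) (wx : w < x) (xy : x < y) (yz : y < z)
    (le : z ≤ v + ((n : ℤ) + 2)) (hvw : Edge (Set.range f) v w) (hwx : Edge (Set.range f) w x)
    (hxy : Edge (Set.range f) x y) (hyz : Edge (Set.range f) y z) (hvz : Edge (Set.range f) v z)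
    (hc : f c = arc n v x) (hd : f d = arc n v y) : PentagonSides f c d v w x y z := by
  refine ⟨vw, wx, xy, yz, le, .of_edge hvw ?_ ?_, .of_edge hwx ?_ ?_, .of_edge hxy ?_ ?_,
    .of_edge hyz ?_ ?_, .of_edge hvz ?_ ?_⟩ <;>
  first
  | rw [hc]
  | rw [hd]
  all_goals first
    | exact arc_ne_of_length (by omega)
    | exact arc_ne_of_start (by omega) (by omega) (by omega)

theorem swap (h : PentagonSides f c d v w x y z) : PentagonSides f d c v w x y z :=
  { h with
    side_vw := h.side_vw.swap
    side_wx := h.side_wx.swap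
    side_xy := h.side_xy.swap
    side_yz := h.side_yz.swap
    side_vz := h.side_vz.swap }

theorem flip_left (h : PentagonSides f c d v w x y z) :
    PentagonSides (f.flip c) c d v w x y z :=
  { h with
    side_vw := h.side_vw.flip_left
    side_wx := h.side_wx.flip_left
    side_xy := h.side_xy.flip_left
    side_yz := h.side_yz.flip_left
    side_vz := h.side_vz.flip_left }

theorem flip_right (h : PentagonSides f c d v w x y z) :
    PentagonSides (f.flip d) c d v w x y z :=
  h.swap.flip_left.swap

theorem exchange_vx (h : PentagonSides f c d v w x y z) (hvy : Edge (Set.range f) v y) :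
    Exchange (Set.range f) (arc n v x) (arc n w y) :=
  .left ⟨h.vw, h.wx, h.xy, by linarith [h.yz, h.le], h.side_vw.edge, h.side_wx.edge,
    h.side_xy.edge, hvy⟩

theorem exchange_vy (h : PentagonSides f c d v w x y z) (hwy : Edge (Set.range f) w y) :
    Exchange (Set.range f) (arc n v y) (arc n w z) :=
  .left ⟨h.vw, h.wx.trans h.xy, h.yz, h.le, h.side_vw.edge, hwy, h.side_yz.edge, h.side_vz.edge⟩

theorem exchange_wy (h : PentagonSides f c d v w x y z) (hwz : Edge (Set.range f) w z) :
    Exchange (Set.range f) (arc n w y) (arc n x z) :=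
  .left ⟨h.wx, h.xy, h.yz, by linarith [h.vw, h.le], h.side_wx.edge, h.side_xy.edge,
    h.side_yz.edge, hwz⟩

theorem exchange_wz (h : PentagonSides f c d v w x y z) (hxz : Edge (Set.range f) x z) :
    Exchange (Set.range f) (arc n w z) (arc n v x) :=
  .right ⟨h.vw, h.wx, h.xy.trans h.yz, h.le, h.side_vw.edge, h.side_wx.edge, hxz,
    h.side_vz.edge⟩

theorem exchange_xz (h : PentagonSides f c d v w x y z) (hvx : Edge (Set.range f) v x) :
    Exchange (Set.range f) (arc n x z) (arc n v y) :=
  .right ⟨h.vw.trans h.wx, h.xy, h.yz, h.le, hvx, h.side_xy.edge, h.side_yz.edge,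
    h.side_vz.edge⟩

end PentagonSides

theorem flip_apply_of_exchange (f : Labelling n) {l k : Option (Fin n)} (hkl : k ≠ l)
    {α β γ : Arc n} (hl : f l = α) (hk : f k = γ) (h : Exchange (Set.range f) α β) :
    f.flip l l = β ∧ f.flip l k = γ :=
  ⟨f.flip_apply_self (hl ▸ h), (f.flip_apply_of_ne hkl).trans hk⟩

theorem flip_pentagon {f : Labelling n} {c d : Option (Fin n)} (hcd : c ≠ d) {v w x y z : ℤ}
    (h : PentagonSides f c d v w x y z) (hc : f c = arc n v x) (hd : f d = arc n v y) :
    ((((f.flip c).flip d).flip c).flip d).flip c = relabel (Equiv.swap c d) f := by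
  obtain ⟨hc₁, hd₁⟩ := f.flip_apply_of_exchange hcd.symm hc hd
    (h.exchange_vx (f.edge_of_apply_eq hd))
  have h₁ := h.flip_left
  obtain ⟨hd₂, hc₂⟩ := flip_apply_of_exchange _ hcd hd₁ hc₁
    (h₁.exchange_vy (edge_of_apply_eq _ hc₁))
  have h₂ := h₁.flip_right
  obtain ⟨hc₃, hd₃⟩ := flip_apply_of_exchange _ hcd.symm hc₂ hd₂
    (h₂.exchange_wy (edge_of_apply_eq _ hd₂))
  have h₃ := h₂.flip_left
  obtain ⟨hd₄, hc₄⟩ := flip_apply_of_exchange _ hcd hd₃ hc₃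
    (h₃.exchange_wz (edge_of_apply_eq _ hc₃))
  have h₄ := h₃.flip_right
  obtain ⟨hc₅, hd₅⟩ := flip_apply_of_exchange _ hcd.symm hc₄ hd₄
    (h₄.exchange_xz (edge_of_apply_eq _ hd₄))
  refine Subtype.ext (funext fun k => ?_)
  change _ = f ((Equiv.swap c d).symm k)
  rw [Equiv.symm_swap]
  rcases eq_or_ne k c with rfl | hkc
  · rw [hc₅, Equiv.swap_apply_left, hd]
  rcases eq_or_ne k d with rfl | hkd
  · rw [hd₅, Equiv.swap_apply_right, hc]
  · simp only [Equiv.swap_apply_of_ne_of_ne hkc hkd, flip_apply_of_ne _ hkc,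
      flip_apply_of_ne _ hkd]

theorem flip_not_comm_of_pentagon {f : Labelling n} {c d : Option (Fin n)} (hcd : c ≠ d)
    {v w x y z : ℤ} (h : PentagonSides f c d v w x y z) (hc : f c = arc n v x)
    (hd : f d = arc n v y) : (f.flip c).flip d ≠ (f.flip d).flip c := by
  intro hcomm
  have hswap := flip_pentagon hcd h hc hd
  rw [hcomm, flip_flip, flip_flip] at hswap
  have hd' := congrArg (fun g : Labelling n => g d) hswap
  simp only [relabel_apply, Equiv.symm_swap, Equiv.swap_apply_right,
    f.flip_apply_of_ne hcd.symm] at hd'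
  exact hcd (f.2.injective hd'.symm)

/-- The labels `m` of the central diagonal and `c` of an adjacent diagonal in the centrally
symmetric hexagon with vertices `p`, `q`, `r` and their antipodes. -/
structure Hexagon (m c : Option (Fin n)) (p q r : ℤ) (f : Labelling n) : Prop where
  ne : c ≠ m
  pq : p < q
  qr : q < r
  rp : r < p + ((n : ℤ) + 2)
  side_pq : OtherEdge f m c p q
  side_qr : OtherEdge f m c q r
  side_rp : OtherEdge f m c r (p + ((n : ℤ) + 2))
  apply_central : f m = arc n p (p + ((n : ℤ) + 2))
  apply_adjacent : f c = arc n p r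

namespace Hexagon

variable {m c : Option (Fin n)} {p q r : ℤ} {f : Labelling n}

theorem of_edge (pq : p < q) (qr : q < r) (rp : r < p + ((n : ℤ) + 2))
    (hpq : Edge (Set.range f) p q) (hqr : Edge (Set.range f) q r)
    (hrp : Edge (Set.range f) r (p + ((n : ℤ) + 2))) (hm : f m = arc n p (p + ((n : ℤ) + 2)))
    (hc : f c = arc n p r) : Hexagon m c p q r f := by
  have hne : c ≠ m := by
    rintro rfl
    exact arc_ne_of_length (by omega) (hc.symm.trans hm)
  refine ⟨hne, pq, qr, rp, .of_edge hpq ?_ ?_, .of_edge hqr ?_ ?_, .of_edge hrp ?_ ?_, hm, hc⟩ <;>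
  first
  | rw [hm]
  | rw [hc]
  all_goals first
    | exact arc_ne_of_length (by omega)
    | exact arc_ne_of_start (by omega) (by omega) (by omega)

theorem step (h : Hexagon m c p q r f) :
    Hexagon m c r (p + ((n : ℤ) + 2)) (q + ((n : ℤ) + 2)) ((f.flip m).flip c) := by
  obtain ⟨ne, pq, qr, rp, hpq, hqr, hrp, hm, hc⟩ := h
  have hm₁ : f.flip m m = arc n r (r + ((n : ℤ) + 2)) :=
    f.flip_apply_self (hm ▸ .central ⟨by omega, rp, f.edge_of_apply_eq hc, hrp.edge⟩)
  have hc₁ : f.flip m c = arc n (p + ((n : ℤ) + 2)) (r + ((n : ℤ) + 2)) := by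
    rw [f.flip_apply_of_ne ne, hc, arc_shift (dvd_refl _)]
  have hpq₁ := (hpq.shift (dvd_refl _)).flip_left
  have hqr₁ := (hqr.shift (dvd_refl _)).flip_left
  refine ⟨ne, rp, by omega, by omega, hrp.flip_left.flip_right, hpq₁.flip_right,
    hqr₁.flip_right, (flip_apply_of_ne _ ne.symm).trans hm₁, flip_apply_self _ ?_⟩
  rw [hc₁]
  exact .right ⟨by omega, by omega, by omega, le_rfl, hrp.flip_left.edge, hpq₁.edge, hqr₁.edge,
    edge_of_apply_eq _ hm₁⟩

theorem iterate (h : Hexagon m c p q r f) :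
    (fun g : Labelling n => (g.flip m).flip c)^[3] f = f := by
  have h₃ := h.step.step.step
  change (((((f.flip m).flip c).flip m).flip c).flip m).flip c = f
  refine Subtype.ext (funext fun k => ?_)
  rcases eq_or_ne k m with rfl | hkm
  · rw [h₃.apply_central, h.apply_central, arc_eq_arc_iff]
    exact ⟨⟨-2, by ring⟩, by ring⟩
  rcases eq_or_ne k c with rfl | hkc
  · rw [h₃.apply_adjacent, h.apply_adjacent, arc_eq_arc_iff]
    exact ⟨⟨-2, by ring⟩, by ring⟩
  · simp only [flip_apply_of_ne _ hkm, flip_apply_of_ne _ hkc]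

theorem flip_not_comm (h : Hexagon m c p q r f) :
    (f.flip c).flip m ≠ (f.flip m).flip c := by
  intro hcomm
  have hiterate : (((((f.flip m).flip c).flip m).flip c).flip m).flip c = f := h.iterate
  rw [← hcomm, flip_flip, flip_flip] at hiterate
  have hm := (flip_apply_of_ne _ h.ne.symm).symm.trans
    (congrArg (fun g : Labelling n => g m) hiterate)
  exact f.flip_apply_ne m hm

end Hexagon

theorem flip_comm_or_exists_hexagon (f : Labelling n) {m c : Option (Fin n)}
    (hm : (f m).2 = (n : ℤ) + 2) (hcm : c ≠ m) :
    (f.flip c).flip m = (f.flip m).flip c ∨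
      ∃ p q r, Hexagon m c p q r f ∨ Hexagon m c p q r (f.flip m) := by
  obtain ⟨a, ha⟩ := exists_arc (f m)
  rw [hm] at ha
  obtain ⟨x, hax, hxa, hx, hx'⟩ := f.2.full.exists_apex (f.edge_of_apply_eq ha.symm) (by omega)
  have hlen := f.length_mem c
  by_cases hc : arc n a x = f c
  · rw [← hc, arc_snd] at hlen
    obtain ⟨v, hav, hvx, hv, hv'⟩ := f.2.full.exists_apex hx (by omega)
    exact Or.inr ⟨a, v, x, Or.inl (.of_edge hav hvx hxa hv hv' hx' ha.symm hc.symm)⟩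
  by_cases hc' : arc n x (a + ((n : ℤ) + 2)) = f c
  · rw [← hc', arc_snd] at hlen
    obtain ⟨v, hxv, hva, hv, hv'⟩ := f.2.full.exists_apex hx' (by omega)
    have hedge {i j : ℤ} (h : Edge (Set.range f) i j) (hij : j - i < (n : ℤ) + 2) :
        Edge (Set.range (f.flip m)) i j :=
      f.edge_flip_of_ne h (ha ▸ arc_ne_of_length (by omega))
    exact Or.inr ⟨x, v, a + ((n : ℤ) + 2), Or.inr (.of_edge hxv hva (by omega)
      (hedge hv (by omega)) (hedge hv' (by omega)) (hedge (hx.shift (dvd_refl _)) (by omega))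
      (f.flip_apply_self (ha ▸ .central ⟨hax, hxa, hx, hx'⟩))
      ((f.flip_apply_of_ne hcm).trans hc'.symm))⟩
  · refine Or.inl (f.flip_comm_of_exchange hcm.symm (β := arc n x (x + ((n : ℤ) + 2))) ?_)
    rw [← ha]
    exact .central ⟨hax, hxa, hx.diff hc, hx'.diff hc'⟩

theorem iterate_central (f : Labelling n) {m : Option (Fin n)} (hm : (f m).2 = (n : ℤ) + 2)
    (c : Option (Fin n)) : (fun g : Labelling n => (g.flip c).flip m)^[6] f = f := by
  have hinv : Function.LeftInverse (fun g : Labelling n => (g.flip c).flip m)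
      (fun g : Labelling n => (g.flip m).flip c) := fun g => by
    simp only [flip_flip]
  have six_of_three (h : (fun g : Labelling n => (g.flip c).flip m)^[3] f = f) :
      (fun g : Labelling n => (g.flip c).flip m)^[6] f = f :=
    (Function.IsPeriodicPt.mul_const h 2 : _)
  have six_of_two (h : (fun g : Labelling n => (g.flip c).flip m)^[2] f = f) :
      (fun g : Labelling n => (g.flip c).flip m)^[6] f = f :=
    (Function.IsPeriodicPt.mul_const h 3 : _)
  rcases eq_or_ne c m with rfl | hcm
  · exact six_of_two (by simp only [Function.iterate_succ, Function.iterate_zero,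
      Function.comp_apply, id, flip_flip])
  obtain hcomm | ⟨p, q, r, hhex | hhex⟩ := f.flip_comm_or_exists_hexagon hm hcm
  · refine six_of_two ?_
    change (((f.flip c).flip m).flip c).flip m = f
    rw [hcomm, flip_flip, flip_flip]
  · refine six_of_three ?_
    conv_lhs => rw [← hhex.iterate]
    exact hinv.iterate 3 f
  · refine six_of_three ?_
    simpa only [Function.iterate_succ, Function.iterate_zero, Function.comp, id, flip_flip]
      using congrArg (flip m) hhex.iterate

end Labelling

/-! ### Connectedness of the flip graph -/

theorem Full.exists_triangle {S : Set (Arc n)} (hS : Full S) {a b p q : ℤ} (hap : a < p)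
    (hqb : q ≤ b) (hab : Edge S a b) (hpq : Edge S p q) :
    ∃ x y, x ≤ p ∧ q ≤ y ∧ Edge S a x ∧ Edge S x y ∧ Edge S a y := by
  have hlt := hS.lt hpq
  obtain ⟨x, hax, hxb, hx, hx'⟩ := hS.exists_apex hab (by omega)
  rcases le_or_gt x p with hxp | hpx
  · exact ⟨x, b, hxp, hqb, hx, hx', hab⟩
  · have hqx : q ≤ x := by
      have := hS.edge hx hpq
      omega
    exact hS.exists_triangle hap hqx hx hpq
termination_by (b - a).toNat

namespace Labelling

/-- The length of the segment with the given label in a fan. The label `none` is the longest. -/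
def fanLength (l : Option (Fin n)) : ℤ := (finSuccEquivLast.symm l : ℕ) + 2

theorem fanLength_none : fanLength (none : Option (Fin n)) = (n : ℤ) + 2 := by
  simp only [fanLength, finSuccEquivLast_symm_none, Fin.val_last]

theorem fanLength_some (i : Fin n) : fanLength (some i) = (i : ℤ) + 2 := by
  simp only [fanLength, finSuccEquivLast_symm_some, Fin.val_castSucc]

theorem two_le_fanLength (l : Option (Fin n)) : 2 ≤ fanLength l := by
  unfold fanLength
  omega

theorem fanLength_le (l : Option (Fin n)) : fanLength l ≤ (n : ℤ) + 2 := by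
  unfold fanLength
  omega

theorem fanLength_injective : Function.Injective (fanLength : Option (Fin n) → ℤ) := fun l k h =>
  finSuccEquivLast.symm.injective (Fin.ext (by unfold fanLength at h; omega))

theorem exists_fanLength_eq {k : ℤ} (hk : 2 ≤ k) (hkn : k ≤ (n : ℤ) + 2) :
    ∃ l : Option (Fin n), fanLength l = k :=
  ⟨finSuccEquivLast ⟨(k - 2).toNat, by omega⟩, by
    unfold fanLength
    rw [Equiv.symm_apply_apply]
    dsimp only
    omega⟩

theorem exists_fanLength_eq_add_one {l : Option (Fin n)} (hl : l ≠ none) :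
    ∃ k : Option (Fin n), fanLength k = fanLength l + 1 := by
  have hlt : fanLength l < (n : ℤ) + 2 := (fanLength_le l).lt_of_ne fun h =>
    hl (fanLength_injective (h.trans fanLength_none.symm))
  have hle := two_le_fanLength l
  exact exists_fanLength_eq (by omega) (by omega)

/-- The fan of all segments from `a` to `a + 2, …, a + (n + 2)`, labelled in this order. -/
def fan (n : ℕ) (a : ℤ) : Labelling n where
  val l := arc n a (a + fanLength l)
  property.noncrossing.length_mem := by
    rintro _ ⟨l, rfl⟩
    rw [arc_snd, add_sub_cancel_left]
    exact ⟨two_le_fanLength l, fanLength_le l⟩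
  property.noncrossing.not_cross := by
    rintro i j p q ⟨l, hl⟩ ⟨k, hk⟩ hcross
    obtain ⟨hi, hij⟩ := arc_eq_arc_iff.1 hl
    obtain ⟨hp, -⟩ := arc_eq_arc_iff.1 hk
    have hle := fanLength_le l
    have := eq_zero_of_dvd_of_lt (dvd_sub hp hi) (by omega) (by omega)
    omega
  property.injective l k h := by
    have := (arc_eq_arc_iff.1 h).2
    exact fanLength_injective (by omega)

theorem fan_apply (a : ℤ) (l : Option (Fin n)) : fan n a l = arc n a (a + fanLength l) := rfl

theorem fan_none (a : ℤ) : fan n a none = arc n a (a + ((n : ℤ) + 2)) := by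
  rw [fan_apply, fanLength_none]

theorem edge_fan {a x : ℤ} (hax : a < x) (hxa : x ≤ a + ((n : ℤ) + 2)) :
    Edge (Set.range (fan n a)) a x := by
  by_cases h : x = a + 1
  · exact Or.inl h
  · obtain ⟨l, hl⟩ := exists_fanLength_eq (n := n) (k := x - a) (by omega) (by omega)
    exact Or.inr ⟨l, by rw [fan_apply, hl, add_sub_cancel]⟩

/-- The permutation of the labels induced by a permutation of the colors. -/
def labelPerm : Equiv.Perm (Fin n) →* Equiv.Perm (Option (Fin n)) where
  toFun := Equiv.optionCongr
  map_one' := Equiv.optionCongr_one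
  map_mul' τ σ := Equiv.ext fun l => by cases l <;> rfl

theorem labelPerm_none (τ : Equiv.Perm (Fin n)) : labelPerm τ none = none := rfl

theorem labelPerm_swap (i j : Fin n) :
    labelPerm (Equiv.swap i j) = Equiv.swap (some i) (some j) :=
  Equiv.optionCongr_swap i j

theorem exists_labelPerm {π : Equiv.Perm (Option (Fin n))} (h : π none = none) :
    ∃ τ, labelPerm τ = π := by
  refine ⟨π.removeNone, Equiv.ext fun l => ?_⟩
  cases l with
  | none => rw [labelPerm_none, h]
  | some i =>
    refine Equiv.removeNone_some π (Option.ne_none_iff_exists'.1 fun hi => ?_)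
    exact Option.some_ne_none i (π.injective (hi.trans h.symm))

theorem exists_eq_relabel_fan (f : Labelling n) {a : ℤ}
    (hstart : ∀ l, (f l).1 = (a : ZMod (n + 2))) (hnone : (f none).2 = (n : ℤ) + 2) :
    ∃ τ, f = relabel (labelPerm τ) (fan n a) := by
  have hf (l : Option (Fin n)) : f l = arc n a (a + (f l).2) :=
    Prod.ext (hstart l) (by rw [arc_snd, add_sub_cancel_left])
  choose e he using fun l => exists_fanLength_eq (f.length_mem l).1 (f.length_mem l).2
  have hinj : Function.Injective e := fun l k hlk =>
    f.2.injective (by rw [hf l, hf k, ← he, ← he, hlk])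
  obtain ⟨τ, hτ⟩ := exists_labelPerm
    (π := (Equiv.ofBijective e (Finite.injective_iff_bijective.1 hinj)).symm)
    (by
      rw [Equiv.symm_apply_eq]
      exact fanLength_injective (by rw [fanLength_none, Equiv.ofBijective_apply, he, hnone]))
  refine ⟨τ, Subtype.ext (funext fun l => ?_)⟩
  rw [hτ, relabel_apply, Equiv.symm_symm, Equiv.ofBijective_apply, fan_apply, he]
  exact hf l

/-- Two labelled triangulations are joined by flips. -/
def Conn (f g : Labelling n) : Prop :=
  g ∈ flipClass flip Set.univ f

namespace Conn

variable {f g k : Labelling n}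

theorem refl (f : Labelling n) : Conn f f := mem_flipClass_self _ _ f

theorem symm (h : Conn f g) : Conn g f := Relation.EqvGen.symm _ _ h

theorem trans (h : Conn f g) (h' : Conn g k) : Conn f k := Relation.EqvGen.trans _ _ _ h h'

theorem flip (h : Conn f g) (l : Option (Fin n)) : Conn f (g.flip l) :=
  flip_mem_flipClass (Set.mem_univ l) h

theorem induction {P : Labelling n → Prop} (h : Conn f g) (base : P f)
    (step : ∀ k, P k → ∀ l, P (k.flip l)) : P g :=
  flipClass_induction (fun l k => k.flip_flip l) h base fun k hk l _ => step k hk l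

theorem relabel (h : Conn f g) (π : Equiv.Perm (Option (Fin n))) :
    Conn (relabel π f) (relabel π g) :=
  h.induction (P := fun k => Conn (Labelling.relabel π f) (Labelling.relabel π k)) (refl _)
    fun k hk l => flip_relabel π k l ▸ hk.flip (π l)

end Conn

theorem flip_pentagon_fan (a : ℤ) {i j : Fin n} (hij : (j : ℕ) = i + 1) :
    ((((((fan n a).flip (some i)).flip (some j)).flip (some i)).flip (some j)).flip (some i)) =
      relabel (Equiv.swap (some i) (some j)) (fan n a) := by
  have hj := j.2
  have hne : some i ≠ some j := fun h => by
    rw [Option.some_inj.1 h] at hij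
    omega
  have hci : fan n a (some i) = arc n a (a + i + 2) := by
    rw [fan_apply, fanLength_some, add_assoc]
  have hdj : fan n a (some j) = arc n a (a + i + 3) := by
    rw [fan_apply, fanLength_some, hij]
    push_cast
    congr 1
    ring
  exact flip_pentagon hne (.of_edge (w := a + i + 1) (z := a + i + 4) (by omega) (by omega)
    (by omega) (by omega) (by omega) (edge_fan (by omega) (by omega)) (.inl (by ring))
    (.inl (by ring)) (.inl (by ring)) (edge_fan (by omega) (by omega)) hci hdj) hci hdj

theorem conn_fan_relabel (a : ℤ) (τ : Equiv.Perm (Fin n)) :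
    Conn (fan n a) (relabel (labelPerm τ) (fan n a)) := by
  rcases n with - | n
  · rw [Subsingleton.elim τ 1, map_one, relabel_one]
    exact .refl _
  have hτ : τ ∈ Submonoid.closure (Set.range fun i : Fin n => Equiv.swap i.castSucc i.succ) := by
    rw [Equiv.Perm.mclosure_swap_castSucc_succ]
    trivial
  induction hτ using Submonoid.closure_induction with
  | mem τ hτ =>
    obtain ⟨i, rfl⟩ := hτ
    rw [labelPerm_swap, ← flip_pentagon_fan a (by simp)]
    exact (((((Conn.refl _).flip _).flip _).flip _).flip _).flip _
  | one =>
    rw [map_one, relabel_one]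
    exact .refl _
  | mul τ σ _ _ hτ hσ =>
    rw [map_mul, ← relabel_relabel]
    exact hτ.trans (hσ.relabel _)

/-- A triangle with apex `a` in front of a diagonal that avoids `a` yields a flip that adds a
diagonal at `a`. -/
theorem exists_flip_start (f : Labelling n) {a : ℤ} (hf : f none = arc n a (a + ((n : ℤ) + 2)))
    {l : Option (Fin n)} (hl : (f l).1 ≠ (a : ZMod (n + 2))) :
    ∃ c, c ≠ none ∧ (f c).1 ≠ (a : ZMod (n + 2)) ∧ (f.flip c c).1 = (a : ZMod (n + 2)) := by
  obtain ⟨p, hp⟩ := exists_arc (f l)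
  obtain ⟨k, hk, hak, hka⟩ := exists_dvd_and_le_and_lt (n := n) p (a + ((n : ℤ) + 1))
  have hpq := (f.edge_of_apply_eq hp.symm).shift hk
  have hlen := f.length_mem l
  have hap : a ≠ p + k := by
    rintro rfl
    exact hl (by rw [← hp, arc_fst, intCast_zmod_eq_iff]; simpa using hk)
  have hab := f.edge_of_apply_eq hf
  have hqb : p + (f l).2 + k ≤ a + ((n : ℤ) + 2) := by
    have := f.2.noncrossing.edge hab hpq
    omega
  obtain ⟨x, y, hxp, hqy, hx, hxy, hy⟩ := f.2.full.exists_triangle (by omega) hqb hab hpq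
  have hax := f.2.noncrossing.lt hx
  have hya := f.2.noncrossing.le hy
  obtain ⟨c, hc⟩ := hxy.mem (by omega)
  obtain ⟨v, hxv, hvy, hv, hv'⟩ := f.2.full.exists_apex hxy (by omega)
  refine ⟨c, ?_, ?_, ?_⟩
  · rintro rfl
    exact arc_ne_of_length (by omega) (hf.symm.trans hc)
  · rw [hc, arc_fst, Ne, intCast_zmod_eq_iff]
    intro h
    have := eq_zero_of_dvd_of_lt h (by omega) (by omega)
    omega
  · have hex : Exchange (Set.range f) (f c) (arc n a v) := by
      rw [hc]
      exact .right ⟨hax, hxv, hvy, hya, hx, hv, hv', hy⟩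
    rw [f.flip_apply_self hex, arc_fst]

theorem conn_fan_of_central (f : Labelling n) {a : ℤ}
    (hf : f none = arc n a (a + ((n : ℤ) + 2))) : Conn (fan n a) f := by
  by_cases h : ∃ l, (f l).1 ≠ (a : ZMod (n + 2))
  · obtain ⟨l, hl⟩ := h
    obtain ⟨c, hc, hstart, hflip⟩ := f.exists_flip_start hf hl
    have hlt : {l | (f.flip c l).1 ≠ (a : ZMod (n + 2))}.ncard <
        {l | (f l).1 ≠ (a : ZMod (n + 2))}.ncard := by
      refine Set.ncard_lt_ncard ⟨fun k hk => ?_, fun hsub => hsub hstart hflip⟩ (Set.toFinite _)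
      have hkc : k ≠ c := by
        rintro rfl
        exact hk hflip
      rwa [Set.mem_ofPred_eq, f.flip_apply_of_ne hkc] at hk
    have := (f.flip c).conn_fan_of_central ((f.flip_apply_of_ne hc.symm).trans hf)
    exact f.flip_flip c ▸ this.flip c
  · push Not at h
    obtain ⟨τ, rfl⟩ := f.exists_eq_relabel_fan h (by rw [hf, arc_snd, add_sub_cancel_left])
    exact conn_fan_relabel a τ
termination_by {l | (f l).1 ≠ (a : ZMod (n + 2))}.ncard

theorem conn_fan_sub_one (a : ℤ) : Conn (fan n (a - 1)) (fan n a) := by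
  have h : (fan n a).flip none none = arc n (a - 1) (a - 1 + ((n : ℤ) + 2)) := by
    rw [← arc_shift (dvd_refl _), show a - 1 + ((n : ℤ) + 2) = a + (n + 1) by ring]
    refine flip_apply_self _ ?_
    rw [fan_none]
    exact .central ⟨by omega, by omega, edge_fan (by omega) (by omega), .inl (by ring)⟩
  exact (conn_fan_of_central _ h).trans ((Conn.refl _).flip none).symm

theorem conn_fan_zero (a : ℤ) : Conn (fan n 0) (fan n a) := by
  induction a using Int.induction_on with
  | zero => exact .refl _
  | succ a ih =>
    have := conn_fan_sub_one (n := n) (a + 1)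
    rw [add_sub_cancel_right] at this
    exact ih.trans this
  | pred a ih => exact ih.trans (conn_fan_sub_one _).symm

theorem conn_fan (f : Labelling n) (hf : (f none).2 = (n : ℤ) + 2) : Conn (fan n 0) f := by
  obtain ⟨a, ha⟩ := exists_arc (f none)
  exact (conn_fan_zero a).trans (f.conn_fan_of_central (by rw [← ha, hf]))

end Labelling

/-! ### The dihedral action and fans -/

/-- The action of the dihedral group on the arcs, by the rotations `i ↦ i + c` and the reflections
`i ↦ -i - c`. A reflection exchanges the two ends of an arc. -/
def arcAction (n : ℕ) : DihedralGroup (n + 2) →* Equiv.Perm (Arc n) where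
  toFun
    | .r c =>
      { toFun := fun α => (α.1 + c, α.2)
        invFun := fun α => (α.1 - c, α.2)
        left_inv := fun α => by simp only [add_sub_cancel_right]
        right_inv := fun α => by simp only [sub_add_cancel] }
    | .sr c =>
      Function.Involutive.toPerm (fun α => (-α.1 - (α.2 : ZMod (n + 2)) - c, α.2))
        fun α => Prod.ext (by ring) rfl
  map_one' := Equiv.ext fun α => Prod.ext (add_zero α.1) rfl
  map_mul' := by
    rintro (a | a) (b | b) <;> refine Equiv.ext fun α => Prod.ext ?_ rfl
    · change α.1 + (a + b) = α.1 + b + a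
      ring
    · change -α.1 - (α.2 : ZMod (n + 2)) - (b - a) = -α.1 - α.2 - b + a
      ring
    · change -α.1 - (α.2 : ZMod (n + 2)) - (a + b) = -(α.1 + b) - α.2 - a
      ring
    · change α.1 + (b - a) = -(-α.1 - (α.2 : ZMod (n + 2)) - b) - α.2 - a
      ring

theorem arcAction_snd (g : DihedralGroup (n + 2)) (α : Arc n) : (arcAction n g α).2 = α.2 := by
  cases g <;> rfl

theorem arcAction_r (k i j : ℤ) :
    arcAction n (.r (k : ZMod (n + 2))) (arc n i j) = arc n (i + k) (j + k) :=
  Prod.ext (Int.cast_add i k).symm (by rw [arcAction_snd, arc_snd, arc_snd]; ring)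

theorem arcAction_sr (k i j : ℤ) :
    arcAction n (.sr (k : ZMod (n + 2))) (arc n i j) = arc n (-j - k) (-i - k) := by
  refine Prod.ext ?_ (by rw [arcAction_snd, arc_snd, arc_snd]; ring)
  change -(i : ZMod (n + 2)) - ((j - i : ℤ) : ZMod (n + 2)) - k = ((-j - k : ℤ) : ZMod (n + 2))
  push_cast
  ring

theorem Noncrossing.arcAction {S : Set (Arc n)} (hS : Noncrossing S) (g : DihedralGroup (n + 2)) :
    Noncrossing (arcAction n g '' S) where
  length_mem := by
    rintro _ ⟨α, hα, rfl⟩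
    rw [arcAction_snd]
    exact hS.length_mem α hα
  not_cross i j p q hij hpq hcross := by
    have hinv (α : Arc n) (hα : α ∈ Cyclohedron.arcAction n g '' S) :
        Cyclohedron.arcAction n g⁻¹ α ∈ S := by
      obtain ⟨β, hβ, rfl⟩ := hα
      rwa [← Equiv.Perm.mul_apply, ← map_mul, inv_mul_cancel, map_one]
    replace hij := hinv _ hij
    replace hpq := hinv _ hpq
    generalize g⁻¹ = g at hij hpq
    rcases g with c | c <;> obtain ⟨k, rfl⟩ := ZMod.intCast_surjective c
    · rw [arcAction_r] at hij hpq
      exact hS.not_cross _ _ _ _ hij hpq (by omega)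
    · rw [arcAction_sr] at hij hpq
      exact hS.not_cross _ _ _ _ hpq hij (by omega)

namespace Labelling

/-- The action of the dihedral group on labelled triangulations. -/
def move (g : DihedralGroup (n + 2)) (f : Labelling n) : Labelling n where
  val l := arcAction n g (f l)
  property.noncrossing := by
    rw [← Function.comp_def, Set.range_comp]
    exact f.2.noncrossing.arcAction g
  property.injective := (arcAction n g).injective.comp f.2.injective

theorem move_apply (g : DihedralGroup (n + 2)) (f : Labelling n) (l : Option (Fin n)) :
    move g f l = arcAction n g (f l) := rfl

theorem flip_move (g : DihedralGroup (n + 2)) (f : Labelling n) (l : Option (Fin n)) :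
    (move g f).flip l = move g (f.flip l) := by
  refine ((flip_eq_iff _ _ _).2 ⟨fun k hk => ?_, fun h => ?_⟩).symm
  · rw [move_apply, move_apply, flip_apply_of_ne _ hk]
  · exact f.flip_apply_ne l ((arcAction n g).injective h)

theorem move_mul (g k : DihedralGroup (n + 2)) (f : Labelling n) :
    move (g * k) f = move g (move k f) :=
  Subtype.ext (funext fun l => DFunLike.congr_fun (map_mul (arcAction n) g k) (f l))

theorem move_one (f : Labelling n) : move 1 f = f :=
  Subtype.ext (funext fun l => DFunLike.congr_fun (map_one (arcAction n)) (f l))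

theorem move_inv_move (g : DihedralGroup (n + 2)) (f : Labelling n) : move g⁻¹ (move g f) = f := by
  rw [← move_mul, inv_mul_cancel, move_one]

theorem fan_eq_move (a : ℤ) : fan n a = move (.r (a : ZMod (n + 2))) (fan n 0) :=
  Subtype.ext (funext fun l => by
    change fan n a l = arcAction n _ (fan n 0 l)
    rw [fan_apply, fan_apply, arcAction_r]
    congr 1 <;> ring)

/-- The flips with the labels `c` and `d` commute at `f`. -/
def FlipsCommute (f : Labelling n) (c d : Option (Fin n)) : Prop :=
  (f.flip d).flip c = (f.flip c).flip d

theorem flipsCommute_move (g : DihedralGroup (n + 2)) {f : Labelling n} {c d : Option (Fin n)} :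
    FlipsCommute (move g f) c d ↔ FlipsCommute f c d := by
  simp only [FlipsCommute, flip_move, (Function.LeftInverse.injective (move_inv_move g)).eq_iff]

/-- The segments with the labels `c` and `d` are consecutive in the fan at `a`: they lead to `x` and
`y`, and are separated by the triangle `a, x, y`. The second triangle at the segment to `y` has the
vertices `a`, `y` and `z`, unless this segment is central. -/
structure FanPair (f : Labelling n) (a x y : ℤ) (c d : Option (Fin n)) : Prop where
  lt : x < y
  apply_left : f c = arc n a x
  apply_right : f d = arc n a y
  edge : Edge (Set.range f) x y
  outer : y = a + ((n : ℤ) + 2) ∨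
    ∃ z, y < z ∧ z ≤ a + ((n : ℤ) + 2) ∧ Edge (Set.range f) y z ∧ Edge (Set.range f) a z

namespace FanPair

variable {f : Labelling n} {a v x y : ℤ} {b c d : Option (Fin n)}

theorem ne (h : FanPair f a x y c d) : c ≠ d := by
  rintro rfl
  exact arc_ne_of_length (by have := h.lt; omega) (h.apply_left.symm.trans h.apply_right)

theorem le (h : FanPair f a x y c d) : y ≤ a + ((n : ℤ) + 2) := by
  obtain rfl | ⟨z, hyz, hz, -⟩ := h.outer <;> omega

theorem not_flipsCommute (h : FanPair f a x y c d) (hav : a < v) (hvx : v < x)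
    (edge_av : Edge (Set.range f) a v) (edge_vx : Edge (Set.range f) v x) :
    ¬ FlipsCommute f d c := by
  have hxy := h.lt
  obtain rfl | ⟨z, hyz, hz, edge_yz, edge_az⟩ := h.outer
  · exact (Hexagon.of_edge hav hvx hxy edge_av edge_vx h.edge h.apply_right
      h.apply_left).flip_not_comm
  · exact flip_not_comm_of_pentagon h.ne (.of_edge hav hvx hxy hyz hz edge_av edge_vx h.edge
      edge_yz edge_az h.apply_left h.apply_right) h.apply_left h.apply_right

end FanPair

theorem fanPair_fan (a : ℤ) {c d : Option (Fin n)} (hcd : fanLength d = fanLength c + 1) :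
    FanPair (fan n a) a (a + fanLength c) (a + fanLength d) c d := by
  have hd := fanLength_le d
  have hc := two_le_fanLength c
  refine ⟨by omega, fan_apply a c, fan_apply a d, .inl (by omega), ?_⟩
  refine hd.eq_or_lt.imp (fun h => by rw [h]) fun h => ⟨a + fanLength d + 1, by omega, by omega,
    .inl rfl, edge_fan (by omega) (by omega)⟩

/-- Consecutive flips do not commute, not even after the flip of a label between them. This turns
out to characterize the fans up to symmetry. -/
structure IsFanLike (f : Labelling n) : Prop where
  adj : ∀ c d, fanLength d = fanLength c + 1 → ¬ FlipsCommute f d c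
  flip_adj : ∀ c d e, fanLength d = fanLength c + 1 → fanLength e = fanLength d + 1 →
    ¬ FlipsCommute (f.flip d) e c

theorem isFanLike_fan (a : ℤ) : IsFanLike (fan n a) where
  adj c d hcd := by
    have hc := two_le_fanLength c
    have hd := fanLength_le d
    exact (fanPair_fan a hcd).not_flipsCommute (v := a + fanLength c - 1) (by omega) (by omega)
      (edge_fan (by omega) (by omega)) (.inl (by omega))
  flip_adj c d e hcd hde := by
    have hc := two_le_fanLength c
    have he := fanLength_le e
    have hex : Exchange (Set.range (fan n a)) (fan n a d)
        (arc n (a + fanLength c) (a + fanLength e)) :=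
      .left ⟨by omega, by omega, by omega, by omega, edge_fan (by omega) (by omega),
        .inl (by omega), .inl (by omega), edge_fan (by omega) (by omega)⟩
    have hedge {x : ℤ} (hax : a < x) (hxa : x ≤ a + ((n : ℤ) + 2)) (hx : x ≠ a + fanLength d) :
        Edge (Set.range ((fan n a).flip d)) a x :=
      edge_flip_of_ne _ (edge_fan hax hxa) (by
        rw [fan_apply]
        exact arc_ne_of_length (by omega))
    have hpair : FanPair ((fan n a).flip d) a (a + fanLength c) (a + fanLength e) c e := by
      refine ⟨by omega, ?_, ?_, edge_of_apply_eq _ (flip_apply_self _ hex), ?_⟩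
      · exact flip_apply_of_ne _ fun h => by rw [h] at hcd; omega
      · exact flip_apply_of_ne _ fun h => by rw [h] at hde; omega
      · exact he.eq_or_lt.imp (fun h => by rw [h]) fun h => ⟨a + fanLength e + 1, by omega,
          by omega, .inl rfl, hedge (by omega) (by omega) (by omega)⟩
    exact hpair.not_flipsCommute (v := a + fanLength c - 1) (by omega) (by omega)
      (hedge (by omega) (by omega) (by omega)) (.inl (by omega))

theorem IsFanLike.move {f : Labelling n} (h : IsFanLike f) (g : DihedralGroup (n + 2)) :
    IsFanLike (move g f) where
  adj c d hcd := by
    rw [flipsCommute_move]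
    exact h.adj c d hcd
  flip_adj c d e hcd hde := by
    rw [flip_move, flipsCommute_move]
    exact h.flip_adj c d e hcd hde

namespace FanPair

variable {f : Labelling n} {a p q v x y : ℤ} {b c d : Option (Fin n)}

theorem flipsCommute_flip (h : FanPair f a x y c d) (hav : a < v) (hvx : v < x)
    (edge_av : Edge (Set.range f) a v) (edge_vx : Edge (Set.range f) v x)
    (hb : f b = arc n p q) (hap : a < p) (hpy : p < y) : FlipsCommute (f.flip c) d b := by
  have hxy := h.lt
  have hy := h.le
  have ne_of_start {j : ℤ} : arc n a j ≠ arc n p q :=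
    arc_ne_of_start (by omega) (by omega) (by omega)
  have hbc : b ≠ c := fun hbc => ne_of_start (h.apply_left.symm.trans (hbc ▸ hb))
  have hbd : b ≠ d := fun hbd => ne_of_start (h.apply_right.symm.trans (hbd ▸ hb))
  have hc : f.flip c c = arc n v y := by
    refine f.flip_apply_self ?_
    rw [h.apply_left]
    exact .left ⟨hav, hvx, hxy, hy, edge_av, edge_vx, h.edge, f.edge_of_apply_eq h.apply_right⟩
  have edge_vy : Edge (Set.range (f.flip c) \ {f.flip c b}) v y :=
    ((f.flip c).edge_of_apply_eq hc).diff (hc ▸ (f.flip c).2.injective.ne hbc.symm)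
  have hedge {i j : ℤ} (hij : Edge (Set.range f) i j) (hijc : arc n i j ≠ arc n a x)
      (hijb : arc n i j ≠ arc n p q) : Edge (Set.range (f.flip c) \ {f.flip c b}) i j := by
    rw [f.flip_apply_of_ne hbc, hb]
    exact (f.edge_flip_of_ne hij (h.apply_left ▸ hijc)).diff hijb
  have edge_av' := hedge edge_av (arc_ne_of_length (by omega)) ne_of_start
  have hd : f.flip c d = arc n a y := (f.flip_apply_of_ne h.ne.symm).trans h.apply_right
  obtain rfl | ⟨z, hyz, hz, edge_yz, edge_az⟩ := h.outer
  · refine flip_comm_of_exchange _ hbd.symm (β := arc n v (v + ((n : ℤ) + 2))) ?_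
    rw [hd]
    exact .central ⟨hav, by omega, edge_av', edge_vy⟩
  · refine flip_comm_of_exchange _ hbd.symm (β := arc n v z) ?_
    rw [hd]
    exact .left ⟨hav, by omega, hyz, hz, edge_av', edge_vy,
      hedge edge_yz (arc_ne_of_start (by omega) (by omega) (by omega))
        (arc_ne_of_start (by omega) (by omega) (by omega)),
      hedge edge_az (arc_ne_of_length (by omega)) ne_of_start⟩

theorem exists_pred (h : FanPair f a x y c d) (hf : IsFanLike f)
    (hbc : fanLength c = fanLength b + 1) (hcd : fanLength d = fanLength c + 1) :
    ∃ v, FanPair f a v x b c := by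
  have hxy := h.lt
  have hy := h.le
  have edge_ax := f.edge_of_apply_eq h.apply_left
  have edge_ay := f.edge_of_apply_eq h.apply_right
  have hx : 2 ≤ x - a := by
    have := (f.length_mem c).1
    rwa [h.apply_left, arc_snd] at this
  obtain ⟨v, hav, hvx, edge_av, edge_vx⟩ := f.2.full.exists_apex edge_ax (by omega)
  have hb_side : arc n a v = f b ∨ arc n v x = f b ∨ arc n x y = f b := by
    by_contra! hb
    have hne : c ≠ b := fun h => by rw [h] at hbc; omega
    have hne' : d ≠ b := fun h => by rw [h] at hcd; omega
    refine hf.adj b c hbc (flip_comm_of_exchange f hne (β := arc n v y) ?_)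
    rw [h.apply_left]
    exact .left ⟨hav, hvx, hxy, hy, edge_av.diff hb.1, edge_vx.diff hb.2.1, h.edge.diff hb.2.2,
      edge_ay.diff (h.apply_right ▸ f.2.injective.ne hne')⟩
  refine ⟨v, hvx, ?_, h.apply_left, edge_vx, .inr ⟨y, hxy, hy, h.edge, edge_ay⟩⟩
  have not_comm := hf.flip_adj b c d hbc hcd
  rcases hb_side with hb | hb | hb
  · exact hb.symm
  · exact (not_comm (h.flipsCommute_flip hav hvx edge_av edge_vx hb.symm hav (by omega))).elim
  · exact (not_comm (h.flipsCommute_flip hav hvx edge_av edge_vx hb.symm (by omega) hxy)).elim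

theorem exists_fanPair (h : FanPair f a x y b none) (hf : IsFanLike f)
    (hb : fanLength b = (n : ℤ) + 1) {c d : Option (Fin n)}
    (hcd : fanLength d = fanLength c + 1) : ∃ x y, FanPair f a x y c d := by
  rcases eq_or_ne d none with rfl | hd
  · rw [fanLength_none] at hcd
    obtain rfl : b = c := fanLength_injective (by omega)
    exact ⟨x, y, h⟩
  · obtain ⟨e, he⟩ := exists_fanLength_eq_add_one hd
    have hle := fanLength_le e
    obtain ⟨u, w, hde⟩ := h.exists_fanPair hf hb he
    obtain ⟨v, hv⟩ := hde.exists_pred hf hcd he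
    exact ⟨v, u, hv⟩
termination_by ((n : ℤ) + 2 - fanLength d).toNat

end FanPair

theorem eq_fanLength_of_lt {k : Option (Fin n) → ℤ} (two_le : ∀ l, 2 ≤ k l)
    (le : ∀ l, k l ≤ (n : ℤ) + 2) (lt : ∀ c d, fanLength d = fanLength c + 1 → k c < k d) :
    k = fanLength := by
  let e (i : Fin (n + 1)) : Fin (n + 1) :=
    ⟨(k (finSuccEquivLast i) - 2).toNat, by
      have := le (finSuccEquivLast i)
      omega⟩
  have he : StrictMono e := Fin.strictMono_iff_lt_succ.2 fun i => by
    have hlt := lt (finSuccEquivLast i.castSucc) (finSuccEquivLast i.succ) (by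
      simp only [fanLength, Equiv.symm_apply_apply, Fin.val_succ, Fin.val_castSucc]
      omega)
    have := two_le (finSuccEquivLast i.castSucc)
    rw [Fin.lt_def]
    dsimp only [e]
    omega
  funext l
  have heq : e (finSuccEquivLast.symm l) = finSuccEquivLast.symm l :=
    le_antisymm he.apply_le he.le_apply
  rw [Fin.ext_iff] at heq
  dsimp only [e] at heq
  rw [Equiv.apply_symm_apply] at heq
  have := two_le l
  unfold fanLength
  omega

theorem IsFanLike.eq_fan {f : Labelling n} (hf : IsFanLike f) {a x y : ℤ} {b : Option (Fin n)}
    (hb : fanLength b = (n : ℤ) + 1) (h : FanPair f a x y b none) : f = fan n a := by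
  have start (l : Option (Fin n)) : (f l).1 = (a : ZMod (n + 2)) := by
    rcases eq_or_ne l none with rfl | hl
    · rw [h.apply_right, arc_fst]
    · obtain ⟨e, he⟩ := exists_fanLength_eq_add_one hl
      obtain ⟨_, _, hle⟩ := h.exists_fanPair hf hb he
      rw [hle.apply_left, arc_fst]
  have length : (fun l => (f l).2) = fanLength := by
    refine eq_fanLength_of_lt (fun l => (f.length_mem l).1) (fun l => (f.length_mem l).2) ?_
    intro c d hcd
    obtain ⟨_, _, hle⟩ := h.exists_fanPair hf hb hcd
    rw [hle.apply_left, hle.apply_right, arc_snd, arc_snd]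
    have := hle.lt
    omega
  refine Subtype.ext (funext fun l => Prod.ext (start l) ?_)
  rw [congrFun length l, fan_apply, arc_snd, add_sub_cancel_left]

theorem IsFanLike.exists_move {f : Labelling n} (hf : IsFanLike f) (hn : 1 ≤ n)
    (hcentral : (f none).2 = (n : ℤ) + 2) : ∃ g, f = Labelling.move g (fan n 0) := by
  obtain ⟨a, ha⟩ := exists_arc (f none)
  rw [hcentral] at ha
  obtain ⟨x, hax, hxa, edge_ax, edge_xa⟩ :=
    f.2.full.exists_apex (f.edge_of_apply_eq ha.symm) (by omega)
  obtain ⟨b, hb⟩ := exists_fanLength_eq (n := n) (k := (n : ℤ) + 1) (by omega) (by omega)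
  have hb_side : arc n a x = f b ∨ arc n x (a + ((n : ℤ) + 2)) = f b := by
    by_contra! hcon
    refine hf.adj b none (by rw [fanLength_none]; omega) (flip_comm_of_exchange f ?_
      (β := arc n x (x + ((n : ℤ) + 2))) ?_)
    · rintro rfl
      rw [fanLength_none] at hb
      omega
    · rw [← ha]
      exact .central ⟨hax, hxa, edge_ax.diff hcon.1, edge_xa.diff hcon.2⟩
  rcases hb_side with hb_left | hb_right
  · rw [hf.eq_fan hb ⟨hxa, hb_left.symm, ha.symm, edge_xa, .inl rfl⟩]
    exact ⟨_, fan_eq_move a⟩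
  · -- This reflection exchanges the ends of the central segment.
    let ρ : DihedralGroup (n + 2) := .sr ((-(2 * a + (n + 2)) : ℤ) : ZMod (n + 2))
    have hρ (i j : ℤ) : arcAction n ρ (arc n i j) =
        arc n (2 * a + (n + 2) - j) (2 * a + (n + 2) - i) := by
      rw [arcAction_sr]
      congr 1 <;> ring
    have hpair :
        FanPair (Labelling.move ρ f) a (2 * a + (n + 2) - x) (a + ((n : ℤ) + 2)) b none := by
      refine ⟨by omega, ?_, ?_, edge_ax.imp (fun h => by omega) fun ⟨l, hl⟩ => ⟨l, ?_⟩, .inl rfl⟩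
      · rw [move_apply, ← hb_right, hρ]
        congr 1
        ring
      · rw [move_apply, ← ha, hρ]
        congr 1 <;> ring
      · rw [move_apply, hl, hρ]
        congr 1
        ring
    refine ⟨ρ⁻¹ * .r (a : ZMod (n + 2)), ?_⟩
    rw [move_mul, ← fan_eq_move, ← (hf.move ρ).eq_fan hb hpair, move_inv_move]

end Labelling

/-! ### The automorphisms of the flip system -/

open Labelling

/-- The labelled triangulations whose central diagonal has the label `none`. -/
abbrev Rooted (n : ℕ) : Type := {f : Labelling n // (f none).2 = (n : ℤ) + 2}

namespace Rooted

/-- The flip of a rooted labelled triangulation. -/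
noncomputable def flip (l : Option (Fin n)) (f : Rooted n) : Rooted n :=
  ⟨f.1.flip l, (f.1.central_flip_iff l none).2 f.2⟩

theorem flip_involutive (l : Option (Fin n)) : Function.Involutive (flip l) := fun f =>
  Subtype.ext (f.1.flip_flip l)

variable (n) in
/-- The colored triangulations in terms of arcs, with their flips. -/
noncomputable def flipSystem : FlipSystem (Option (Fin n)) (Rooted n) where
  flip := flip
  flip_involutive := flip_involutive
  mem_of_flip_mem C f l hl := by
    by_contra hlC
    refine f.1.flip_apply_ne l ?_
    refine flipClass_induction (P := fun g : Rooted n => g.1 l = f.1 l) flip_involutive hl rfl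
      fun g hg c hc => (g.1.flip_apply_of_ne ?_).trans hg
    rintro rfl
    exact hlC hc
  mem_flipClass_univ f g := by
    have hconn := (conn_fan f.1 f.2).symm.trans (conn_fan g.1 g.2)
    refine (hconn.induction (P := fun h => ∃ hh, (⟨h, hh⟩ : Rooted n) ∈ flipClass flip Set.univ f)
      ⟨f.2, mem_flipClass_self _ _ f⟩ fun h hh l => ?_).2
    exact hh.imp' (fun hh => (h.central_flip_iff l none).2 hh) fun _ hf =>
      flip_mem_flipClass (flip := flip) (Set.mem_univ l) hf

variable (n) in
/-- The fan at `0`. -/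
def fan : Rooted n := ⟨Labelling.fan n 0, by rw [fan_none, arc_snd]; ring⟩

instance : MulAction (Equiv.Perm (Fin n) × DihedralGroup (n + 2)) (Rooted n) where
  smul p f := ⟨relabel (labelPerm p.1) (move p.2 f.1), by
    rw [relabel_apply, move_apply, arcAction_snd,
      (Equiv.symm_apply_eq _).2 (labelPerm_none p.1).symm, f.2]⟩
  one_smul f := Subtype.ext (by
    change relabel (labelPerm 1) (move 1 f.1) = f.1
    rw [map_one, move_one, relabel_one])
  mul_smul p q f := Subtype.ext (by
    change relabel (labelPerm (p.1 * q.1)) (move (p.2 * q.2) f.1) =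
      relabel (labelPerm p.1) (move p.2 (relabel (labelPerm q.1) (move q.2 f.1)))
    rw [map_mul, move_mul, ← relabel_relabel]
    rfl)

theorem coe_smul (p : Equiv.Perm (Fin n) × DihedralGroup (n + 2)) (f : Rooted n) :
    (p • f).1 = relabel (labelPerm p.1) (move p.2 f.1) := rfl

theorem smul_flip (p : Equiv.Perm (Fin n) × DihedralGroup (n + 2)) (l : Option (Fin n))
    (f : Rooted n) : p • flip l f = flip (labelPerm p.1 l) (p • f) :=
  Subtype.ext (by
    change relabel _ (move p.2 (f.1.flip l)) = Labelling.flip _ (relabel _ (move p.2 f.1))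
    rw [flip_relabel, flip_move])

variable (n) in
/-- The automorphisms that permute the colors and move the polygon. -/
noncomputable def toAut : Equiv.Perm (Fin n) × DihedralGroup (n + 2) →* (flipSystem n).autGroup :=
  ((MulAction.toPermHom _ (Rooted n)).prod (labelPerm.comp (MonoidHom.fst _ _))).codRestrict _
    smul_flip

theorem eq_one_of_arcAction {g : DihedralGroup (n + 2)}
    (hg₂ : arcAction n g (arc n 0 2) = arc n 0 2) (hg₃ : arcAction n g (arc n 0 3) = arc n 0 3) :
    g = 1 := by
  rcases g with c | c <;> obtain ⟨k, rfl⟩ := ZMod.intCast_surjective c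
  · rw [arcAction_r, arc_eq_arc_iff] at hg₂
    rw [(intCast_zmod_eq_iff (p := 0)).2 (by simpa only [zero_add] using hg₂.1), Int.cast_zero]
    rfl
  · rw [arcAction_sr, arc_eq_arc_iff] at hg₂ hg₃
    have h := dvd_sub hg₂.1 hg₃.1
    have := eq_zero_of_dvd_of_lt h (by omega) (by omega)
    omega

theorem eq_one_of_smul_fan (hn : 1 ≤ n) {p : Equiv.Perm (Fin n) × DihedralGroup (n + 2)}
    (hp : p.1 = 1) (hfan : p • fan n = fan n) : p = 1 := by
  have hfix {k : ℤ} (hk : 2 ≤ k) (hkn : k ≤ (n : ℤ) + 2) :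
      arcAction n p.2 (arc n 0 k) = arc n 0 k := by
    obtain ⟨l, rfl⟩ := exists_fanLength_eq hk hkn
    have h := congrFun (congrArg (fun f => f.1.1) hfan) l
    rw [coe_smul, hp, map_one, relabel_one, move_apply] at h
    simpa only [fan, fan_apply, zero_add] using h
  exact Prod.ext hp (eq_one_of_arcAction (hfix le_rfl (by omega)) (hfix (by omega) (by omega)))

theorem toAut_injective (hn : 1 ≤ n) : Function.Injective (toAut n) := by
  refine (injective_iff_map_eq_one _).2 fun p hp => eq_one_of_smul_fan hn ?_ ?_
  · have hlabel : labelPerm p.1 = 1 := congrArg (fun g => g.1.2) hp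
    exact Equiv.optionCongr_injective (hlabel.trans (map_one labelPerm).symm)
  · exact Equiv.congr_fun (congrArg (fun g => g.1.1) hp) (fan n)

theorem isPeriodicPt_fan {i j : Fin n} (hij : (j : ℕ) = i + 1) :
    Function.IsPeriodicPt (fun f : Rooted n => flip (some j) (flip (some i) f)) 5 (fan n) := by
  have hpentagon := flip_pentagon_fan 0 hij
  have h := congrArg (relabel (Equiv.swap (some i) (some j))) hpentagon
  rw [relabel_relabel, Equiv.swap_mul_self, relabel_one, ← flip_relabel, ← flip_relabel,
    ← flip_relabel, ← flip_relabel, ← flip_relabel, Equiv.swap_apply_left,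
    Equiv.swap_apply_right, ← hpentagon] at h
  exact Subtype.ext h

theorem exists_isPeriodicPt (hn : 2 ≤ n) (i : Fin n) : ∃ c ≠ some i, ∃ f : Rooted n,
    Function.IsPeriodicPt (fun f => flip (some i) (flip c f)) 5 f := by
  have hne {j k : Fin n} (h : (k : ℕ) = j + 1) : j ≠ k := by
    rintro rfl
    omega
  by_cases hi : (i : ℕ) + 1 < n
  · have hij : ((⟨i + 1, hi⟩ : Fin n) : ℕ) = i + 1 := rfl
    refine ⟨some ⟨i + 1, hi⟩, (Option.some_injective _).ne (hne hij).symm,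
      flip (some i) (fan n), ?_⟩
    exact (isPeriodicPt_fan hij).map (g := flip (some i)) fun f => rfl
  · obtain ⟨j, hj⟩ : ∃ j : Fin n, (i : ℕ) = j + 1 := ⟨⟨i - 1, by omega⟩, by dsimp only; omega⟩
    exact ⟨some j, (Option.some_injective _).ne (hne hj), fan n, isPeriodicPt_fan hj⟩

theorem isPeriodicPt_none (c : Option (Fin n)) (f : Rooted n) :
    Function.IsPeriodicPt (fun f : Rooted n => flip none (flip c f)) 6 f :=
  have hsemiconj : Function.Semiconj Subtype.val (fun f : Rooted n => flip none (flip c f))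
    fun f : Labelling n => (f.flip c).flip none := fun _ => rfl
  Subtype.ext ((hsemiconj.iterate_right 6 f).trans (f.1.iterate_central f.2 c))

/-- The flips of two colors may generate a cycle of length ten, whereas the length of such a cycle
divides twelve if one of the flips is central. -/
theorem autGroup_apply_none (hn : 2 ≤ n) (g : (flipSystem n).autGroup) : g.1.2 none = none := by
  by_contra hne
  obtain ⟨i, hi⟩ := Option.ne_none_iff_exists'.1 hne
  obtain ⟨c, hc, f, hf⟩ := exists_isPeriodicPt hn i
  have hsix : Function.IsPeriodicPt (fun f => flip (some i) (flip c f)) 6 f := by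
    have h := (isPeriodicPt_none (g.1.2.symm c) (g.1.1.symm f)).map (g := g.1.1)
      (fb := fun f => flip (some i) (flip c f)) fun f => by
        have hc : g.1.1 (flip (g.1.2.symm c) f) = flip c (g.1.1 f) := by
          have h := g.2 (g.1.2.symm c) f
          rwa [Equiv.apply_symm_apply] at h
        have hnone := g.2 none (flip (g.1.2.symm c) f)
        rw [hi, hc] at hnone
        exact hnone
    rwa [Equiv.apply_symm_apply] at h
  have hfix : flip (some i) (flip c f) = f := hsix.gcd hf
  have h := congrArg (flip (some i)) hfix
  rw [flip_involutive] at h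
  have hval := congrFun (congrArg (fun f => f.1.1) h) c
  exact f.1.flip_apply_ne c (hval.trans (f.1.flip_apply_of_ne hc))

theorem flipsCommute_of_apply (g : (flipSystem n).autGroup) {f : Rooted n} {c d : Option (Fin n)}
    (h : FlipsCommute (g.1.1 f).1 (g.1.2 c) (g.1.2 d)) : FlipsCommute f.1 c d := by
  have hcomm : flip (g.1.2 c) (flip (g.1.2 d) (g.1.1 f)) =
      flip (g.1.2 d) (flip (g.1.2 c) (g.1.1 f)) := Subtype.ext h
  have hg (l : Option (Fin n)) (f : Rooted n) : flip (g.1.2 l) (g.1.1 f) = g.1.1 (flip l f) :=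
    (g.2 l f).symm
  simp only [hg] at hcomm
  exact congrArg Subtype.val (g.1.1.injective hcomm)

theorem isFanLike_apply_fan {g : (flipSystem n).autGroup} (hg : g.1.2 = 1) :
    IsFanLike (g.1.1 (fan n)).1 where
  adj c d hcd hcomm := by
    refine (isFanLike_fan 0).adj c d hcd (flipsCommute_of_apply g (f := fan n) ?_)
    rwa [hg]
  flip_adj c d e hcd hde hcomm := by
    refine (isFanLike_fan 0).flip_adj c d e hcd hde
      (flipsCommute_of_apply g (f := flip d (fan n)) ?_)
    rw [show g.1.1 (flip d (fan n)) = flip (g.1.2 d) (g.1.1 (fan n)) from g.2 d (fan n), hg]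
    exact hcomm

theorem toAut_surjective (hn : 2 ≤ n) : Function.Surjective (toAut n) := by
  intro g
  obtain ⟨τ, hτ⟩ := exists_labelPerm (autGroup_apply_none hn g)
  let k := (toAut n (τ, 1))⁻¹ * g
  have hk : k.1.2 = 1 := by
    change (labelPerm τ)⁻¹ * g.1.2 = 1
    rw [hτ, inv_mul_cancel]
  obtain ⟨δ, hδ⟩ := (isFanLike_apply_fan hk).exists_move (by omega) (k.1.1 (fan n)).2
  have hkδ : toAut n (1, δ) = k := by
    refine FlipSystem.autGroup_ext ((map_one labelPerm).trans hk.symm) (fan n) (Subtype.ext ?_)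
    rw [hδ]
    change relabel (labelPerm 1) (move δ (Labelling.fan n 0)) = _
    rw [map_one, relabel_one]
  exact ⟨(τ, 1) * (1, δ), by rw [map_mul, hkδ, mul_inv_cancel_left]⟩

end Rooted

/-! ### The hexagon -/

namespace Rooted

theorem flip_none_fan_one : flip none (fan 1) =
    ((1, .sr 1) : Equiv.Perm (Fin 1) × DihedralGroup (1 + 2)) • fan 1 := by
  refine Eq.symm (Subtype.ext ?_)
  rw [coe_smul, map_one, relabel_one]
  refine (flip_eq_iff _ _ none).2 ⟨fun k hk => ?_, fun h => ?_⟩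
  · obtain ⟨i, rfl⟩ := Option.ne_none_iff_exists'.1 hk
    obtain rfl := Subsingleton.elim i 0
    exact Prod.ext (by decide) rfl
  · exact absurd (congrArg Prod.fst h) (by decide)

theorem flip_some_fan_one (i : Fin 1) : flip (some i) (fan 1) =
    ((1, .sr 0) : Equiv.Perm (Fin 1) × DihedralGroup (1 + 2)) • fan 1 := by
  obtain rfl := Subsingleton.elim i 0
  refine Eq.symm (Subtype.ext ?_)
  rw [coe_smul, map_one, relabel_one]
  refine (flip_eq_iff _ _ (some 0)).2 ⟨fun k hk => ?_, fun h => ?_⟩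
  · rcases k with _ | i
    · exact Prod.ext (by decide) rfl
    · exact absurd (congrArg some (Subsingleton.elim i 0)) hk
  · exact absurd (congrArg Prod.fst h) (by decide)

/-- The reflection of the hexagon that maps the fan at `0` to its flip. -/
def hexReflection : Option (Fin 1) → DihedralGroup 3
  | none => .sr 1
  | some _ => .sr 0

theorem flip_smul_fan_one (g : DihedralGroup 3) (l : Option (Fin 1)) :
    flip l (((1, g) : Equiv.Perm (Fin 1) × DihedralGroup (1 + 2)) • fan 1) =
      ((1, g * hexReflection l) : Equiv.Perm (Fin 1) × DihedralGroup (1 + 2)) • fan 1 := by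
  have h := smul_flip ((1, g) : Equiv.Perm (Fin 1) × DihedralGroup (1 + 2)) l (fan 1)
  rw [map_one] at h
  refine h.symm.trans ?_
  cases l with
  | none => rw [flip_none_fan_one, smul_smul]; rfl
  | some i => rw [flip_some_fan_one, smul_smul]; rfl

theorem bijective_smul_fan_one : Function.Bijective fun g : DihedralGroup (1 + 2) =>
    ((1, g) : Equiv.Perm (Fin 1) × DihedralGroup (1 + 2)) • fan 1 := by
  constructor
  · intro g k h
    have hfix : ((1, k⁻¹ * g) : Equiv.Perm (Fin 1) × DihedralGroup (1 + 2)) • fan 1 = fan 1 := by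
      rw [show ((1, k⁻¹ * g) : Equiv.Perm (Fin 1) × DihedralGroup (1 + 2)) = (1, k)⁻¹ * (1, g) from
        Prod.ext rfl rfl, mul_smul, inv_smul_eq_iff]
      exact h
    exact (inv_mul_eq_one.1 (congrArg Prod.snd (eq_one_of_smul_fan le_rfl rfl hfix))).symm
  · intro f
    refine flipClass_induction (P := fun f => ∃ g : DihedralGroup (1 + 2),
      ((1, g) : Equiv.Perm (Fin 1) × DihedralGroup (1 + 2)) • fan 1 = f) flip_involutive
      ((flipSystem 1).mem_flipClass_univ (fan 1) f) ⟨1, one_smul _ (fan 1)⟩ ?_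
    rintro _ ⟨g, rfl⟩ l _
    exact ⟨_, (flip_smul_fan_one g l).symm⟩

/-- The triangulations of the hexagon as elements of the dihedral group. Flips become right
multiplications by reflections. -/
noncomputable def hexEquiv : DihedralGroup 3 ≃ Rooted 1 :=
  Equiv.ofBijective _ bijective_smul_fan_one

theorem flip_hexEquiv (l : Option (Fin 1)) (g : DihedralGroup 3) :
    flip l (hexEquiv g) = hexEquiv (g * hexReflection l) :=
  flip_smul_fan_one g l

/-- The symmetries of the hexagon formed by the six colored triangulations. Conjugation by `sr 2`
exchanges `sr 0` and `sr 1`, so that right multiplication by `sr 2` exchanges the two labels. -/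
def hexAction : DihedralGroup 6 →* Equiv.Perm (DihedralGroup 3) where
  toFun
    | .r c => ⟨fun x => .r c.cast * x * .sr 2 ^ c.val, fun x => .r (-c.cast) * x * .sr 2 ^ c.val,
        by revert c; decide, by revert c; decide⟩
    | .sr c => ⟨fun x => .sr c.cast * x * .sr 2 ^ c.val, fun x => .sr c.cast * x * .sr 2 ^ c.val,
        by revert c; decide, by revert c; decide⟩
  map_one' := by decide
  map_mul' := by decide

/-- The action of the symmetries of a hexagon on the two classes of alternate edges. -/
def hexLabelAction : DihedralGroup 6 →* Equiv.Perm (Option (Fin 1)) where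
  toFun
    | .r c => Equiv.swap none (some 0) ^ c.val
    | .sr c => Equiv.swap none (some 0) ^ c.val
  map_one' := by decide
  map_mul' := by decide

theorem hexAction_mul_hexReflection (g : DihedralGroup 6) (l : Option (Fin 1))
    (x : DihedralGroup 3) :
    hexAction g (x * hexReflection l) = hexAction g x * hexReflection (hexLabelAction g l) := by
  revert g l x
  decide

theorem eq_one_of_hexAction {g : DihedralGroup 6} (hlabel : hexLabelAction g = 1)
    (hone : hexAction g 1 = 1) : g = 1 := by
  revert g
  decide

theorem exists_hexAction (σ : Equiv.Perm (Option (Fin 1))) (x : DihedralGroup 3) :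
    ∃ g, hexLabelAction g = σ ∧ hexAction g 1 = x := by
  revert σ x
  decide

/-- The symmetries of the hexagon of triangulations as automorphisms of the flip system. -/
noncomputable def hexToAut : DihedralGroup 6 →* (flipSystem 1).autGroup :=
  ((hexEquiv.permCongrHom.toMonoidHom.comp hexAction).prod hexLabelAction).codRestrict _ <| by
    intro g l f
    obtain ⟨x, rfl⟩ := hexEquiv.surjective f
    change hexEquiv (hexAction g (hexEquiv.symm (flip l (hexEquiv x)))) =
      flip (hexLabelAction g l) (hexEquiv (hexAction g (hexEquiv.symm (hexEquiv x))))
    rw [flip_hexEquiv, hexEquiv.symm_apply_apply, hexEquiv.symm_apply_apply, flip_hexEquiv,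
      hexAction_mul_hexReflection]

theorem hexToAut_apply (g : DihedralGroup 6) :
    (hexToAut g).1.1 (hexEquiv 1) = hexEquiv (hexAction g 1) :=
  congrArg (fun x => hexEquiv (hexAction g x)) (hexEquiv.symm_apply_apply 1)

theorem hexToAut_bijective : Function.Bijective hexToAut := by
  constructor
  · refine (injective_iff_map_eq_one _).2 fun g hg => ?_
    refine eq_one_of_hexAction (congrArg (fun k => k.1.2) hg) (hexEquiv.injective ?_)
    rw [← hexToAut_apply, hg]
    rfl
  · intro k
    obtain ⟨g, hlabel, hone⟩ := exists_hexAction k.1.2 (hexEquiv.symm (k.1.1 (hexEquiv 1)))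
    refine ⟨g, FlipSystem.autGroup_ext hlabel (hexEquiv 1) ?_⟩
    rw [hexToAut_apply, hone, Equiv.apply_symm_apply]

end Rooted

/-! ### Orbits of diagonals of the polygon -/

theorem eq_zero_or_eq_of_dvd_of_lt {m k : ℤ} (hk : m ∣ k) (hlo : -m < k) (hhi : k < 2 * m) :
    k = 0 ∨ k = m := by
  rcases lt_or_ge k m with hlt | hge
  · exact Or.inl (Int.eq_zero_of_abs_lt_dvd hk (abs_lt.2 ⟨hlo, hlt⟩))
  · refine Or.inr (sub_eq_zero.1 (Int.eq_zero_of_abs_lt_dvd (dvd_sub_self_right.2 hk) ?_))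
    exact abs_lt.2 ⟨by omega, by omega⟩

theorem intCast_vertex_eq_iff {i p : ℤ} :
    (i : Vertex n) = (p : Vertex n) ↔ (2 * (n : ℤ) + 4) ∣ p - i := by
  exact_mod_cast ZMod.intCast_eq_intCast_iff_dvd_sub i p (2 * n + 4)

theorem intCast_vertex_add {k : ℤ} (hk : (2 * (n : ℤ) + 4) ∣ k) (i : ℤ) :
    ((i + k : ℤ) : Vertex n) = i :=
  intCast_vertex_eq_iff.2 (by simpa using hk)

theorem dvd_sub_val (i : ℤ) : (2 * (n : ℤ) + 4) ∣ i - (i : Vertex n).val :=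
  intCast_vertex_eq_iff.1 (by simp)

theorem exists_lift_vertex (i : ℤ) (v : Vertex n) :
    ∃ p : ℤ, v = p ∧ i ≤ p ∧ p < i + (2 * (n : ℤ) + 4) := by
  obtain ⟨q, rfl⟩ := ZMod.intCast_surjective v
  refine ⟨i + (q - i) % (2 * (n : ℤ) + 4), intCast_vertex_eq_iff.2 ?_, ?_, ?_⟩
  · rw [show i + (q - i) % (2 * (n : ℤ) + 4) - q =
      -((q - i) - (q - i) % (2 * (n : ℤ) + 4)) by ring]
    exact (Int.dvd_self_sub_emod).neg_right
  · linarith [Int.emod_nonneg (q - i) (b := 2 * (n : ℤ) + 4) (by omega)]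
  · linarith [Int.emod_lt_of_pos (q - i) (b := 2 * (n : ℤ) + 4) (by omega)]

theorem sbtw_intCast_iff {i p j : ℤ} (hip : i ≤ p) (hpi : p < i + (2 * (n : ℤ) + 4)) (hij : i ≤ j)
    (hji : j < i + (2 * (n : ℤ) + 4)) : sbtw (i : Vertex n) p j ↔ i < p ∧ p < j := by
  have hi := ZMod.val_lt (i : Vertex n)
  have hp := ZMod.val_lt (p : Vertex n)
  have hj := ZMod.val_lt (j : Vertex n)
  have hval_p := eq_zero_or_eq_of_dvd_of_lt
    (dvd_sub (dvd_sub_val (n := n) p) (dvd_sub_val (n := n) i)) (by omega) (by omega)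
  have hval_j := eq_zero_or_eq_of_dvd_of_lt
    (dvd_sub (dvd_sub_val (n := n) j) (dvd_sub_val (n := n) i)) (by omega) (by omega)
  have hsbtw (a b c : Vertex n) : sbtw a b c ↔ a.val < b.val ∧ b.val < c.val ∨
      b.val < c.val ∧ c.val < a.val ∨ c.val < a.val ∧ a.val < b.val := Iff.rfl
  rw [hsbtw]
  omega

/-- The segment between the vertices with the lifts `i` and `j`. -/
def diag (n : ℕ) (i j : ℤ) : Sym2 (Vertex n) := s((i : Vertex n), (j : Vertex n))

theorem diag_comm (i j : ℤ) : diag n i j = diag n j i := Sym2.eq_swap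

theorem inversion_diag (i j : ℤ) :
    inversion n (diag n i j) = diag n (i + ((n : ℤ) + 2)) (j + ((n : ℤ) + 2)) := by
  simp [inversion, diag]

theorem diag_add_right {k : ℤ} (hk : (2 * (n : ℤ) + 4) ∣ k) (i j : ℤ) :
    diag n i (j + k) = diag n i j := by
  rw [diag, intCast_vertex_add hk, diag]

theorem diag_add_add {k : ℤ} (hk : (2 * (n : ℤ) + 4) ∣ k) (i j : ℤ) :
    diag n (i + k) (j + k) = diag n i j := by
  rw [diag_add_right hk, diag_comm, diag_add_right hk, diag_comm]

theorem isSide_diag (i : ℤ) : IsSide n (diag n i (i + 1)) := ⟨i, by simp [diag]⟩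

theorem exists_diag {d : Sym2 (Vertex n)} (hd : ¬ d.IsDiag) :
    ∃ i j : ℤ, d = diag n i j ∧ i < j ∧ j ≤ i + ((n : ℤ) + 2) := by
  induction d with
  | h u v =>
    obtain ⟨i, rfl⟩ := ZMod.intCast_surjective u
    obtain ⟨j, rfl, hij, hji⟩ := exists_lift_vertex i v
    have hne : i ≠ j := by
      rintro rfl
      exact hd rfl
    rcases le_or_gt j (i + ((n : ℤ) + 2)) with hle | hgt
    · exact ⟨i, j, rfl, by omega, hle⟩
    · exact ⟨j, i + (2 * (n : ℤ) + 4), by rw [diag_add_right (dvd_refl _), diag_comm]; rfl,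
        by omega, by omega⟩

theorem arc_eq_of_diag_eq {i j p q : ℤ} (hij : i < j) (hji : j ≤ i + ((n : ℤ) + 2)) (hpq : p < q)
    (hqp : q ≤ p + ((n : ℤ) + 2)) (h : diag n i j = diag n p q) : arc n i j = arc n p q := by
  have hdvd : ((n : ℤ) + 2) ∣ 2 * (n : ℤ) + 4 := ⟨2, by ring⟩
  rw [arc_eq_arc_iff]
  simp only [diag, Sym2.eq_iff, intCast_vertex_eq_iff] at h
  rcases h with ⟨hip, hjq⟩ | ⟨hiq, hjp⟩
  · have := eq_zero_or_eq_of_dvd_of_lt (dvd_sub hjq hip) (by omega) (by omega)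
    exact ⟨hdvd.trans hip, by omega⟩
  · have := eq_zero_or_eq_of_dvd_of_lt (dvd_sub hiq hjp) (by omega) (by omega)
    rw [show p - i = p - j + ((n : ℤ) + 2) by omega]
    exact ⟨dvd_add (hdvd.trans hjp) (dvd_refl _), by omega⟩

theorem diag_eq_or_of_arc_eq {i j p q : ℤ} (h : arc n i j = arc n p q) :
    diag n p q = diag n i j ∨ diag n p q = inversion n (diag n i j) := by
  obtain ⟨⟨m, hm⟩, hlen⟩ := arc_eq_arc_iff.1 h
  obtain rfl : p = i + ((n : ℤ) + 2) * m := by omega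
  obtain rfl : q = j + ((n : ℤ) + 2) * m := by omega
  rw [inversion_diag]
  rcases Int.even_or_odd' m with ⟨k, rfl | rfl⟩
  · exact Or.inl (diag_add_add ⟨k, by ring⟩ i j)
  · rw [← diag_add_add ⟨k, rfl⟩ (i + ((n : ℤ) + 2))]
    exact Or.inr (congrArg₂ _ (by ring) (by ring))

/-- The orbit of a segment under the central inversion. Only its values at segments with distinct
ends are meaningful. -/
noncomputable def orbit : Sym2 (Vertex n) → Arc n :=
  Function.extend
    (fun p : {p : ℤ × ℤ // p.1 < p.2 ∧ p.2 ≤ p.1 + ((n : ℤ) + 2)} => diag n p.1.1 p.1.2)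
    (fun p => arc n p.1.1 p.1.2) 0

theorem orbit_diag {i j : ℤ} (hij : i < j) (hji : j ≤ i + ((n : ℤ) + 2)) :
    orbit (diag n i j) = arc n i j := by
  have hfactors : Function.FactorsThrough
      (fun p : {p : ℤ × ℤ // p.1 < p.2 ∧ p.2 ≤ p.1 + ((n : ℤ) + 2)} => arc n p.1.1 p.1.2)
      (fun p => diag n p.1.1 p.1.2) :=
    fun p q h => arc_eq_of_diag_eq p.2.1 p.2.2 q.2.1 q.2.2 h
  exact hfactors.extend_apply 0 ⟨(i, j), hij, hji⟩

theorem not_isDiag_of_orbit {d : Sym2 (Vertex n)} (hd : (orbit d).2 ≠ 0) : ¬ d.IsDiag := by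
  refine fun hdiag => hd (congrArg Prod.snd (Function.extend_apply' _ _ d ?_))
  rintro ⟨⟨⟨i, j⟩, hij, hji⟩, rfl⟩
  dsimp only at hij hji
  have := eq_zero_or_eq_of_dvd_of_lt (intCast_vertex_eq_iff (i := i) (p := j).1 hdiag) (by omega)
    (by omega)
  omega

theorem isDiagonal_iff_two_le {d : Sym2 (Vertex n)} : IsDiagonal n d ↔ 2 ≤ (orbit d).2 := by
  constructor
  · intro hd
    obtain ⟨i, j, rfl, hij, hji⟩ := exists_diag hd.1
    have hne : j ≠ i + 1 := by
      rintro rfl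
      exact hd.2 (isSide_diag i)
    rw [orbit_diag hij hji, arc_snd]
    omega
  · refine fun hd => ⟨not_isDiag_of_orbit (by omega), ?_⟩
    rintro ⟨a, rfl⟩
    obtain ⟨p, rfl⟩ := ZMod.intCast_surjective a
    rw [show s((p : Vertex n), (p : Vertex n) + 1) = diag n p (p + 1) by simp [diag],
      orbit_diag (by omega) (by omega), arc_snd] at hd
    omega

theorem IsDiagonal.exists_diag {d : Sym2 (Vertex n)} (hd : IsDiagonal n d) :
    ∃ i j : ℤ, d = diag n i j ∧ i < j ∧ j ≤ i + ((n : ℤ) + 2) :=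
  Cyclohedron.exists_diag hd.1

theorem IsDiagonal.orbit_inversion {d : Sym2 (Vertex n)} (hd : IsDiagonal n d) :
    orbit (inversion n d) = orbit d := by
  obtain ⟨i, j, rfl, hij, hji⟩ := hd.exists_diag
  rw [inversion_diag, orbit_diag (by omega) (by omega), orbit_diag hij hji, arc_shift (dvd_refl _)]

theorem exists_orbit_eq {α : Arc n} (hα : 2 ≤ α.2) (hα' : α.2 ≤ (n : ℤ) + 2) :
    ∃ d, orbit d = α := by
  obtain ⟨i, hi⟩ := exists_arc α
  exact ⟨diag n i (i + α.2), by rw [orbit_diag (by omega) (by omega), hi]⟩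

theorem IsDiagonal.orbit_eq_iff {d : Sym2 (Vertex n)} (hd : IsDiagonal n d) (e : Sym2 (Vertex n)) :
    orbit e = orbit d ↔ e = d ∨ e = inversion n d := by
  constructor
  · intro h
    have he : IsDiagonal n e := isDiagonal_iff_two_le.2 (h ▸ isDiagonal_iff_two_le.1 hd)
    obtain ⟨i, j, rfl, hij, hji⟩ := hd.exists_diag
    obtain ⟨p, q, rfl, hpq, hqp⟩ := he.exists_diag
    rw [orbit_diag hpq hqp, orbit_diag hij hji] at h
    exact diag_eq_or_of_arc_eq h.symm
  · rintro (rfl | rfl)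
    exacts [rfl, hd.orbit_inversion]

theorem IsDiagonal.isCentral_iff {d : Sym2 (Vertex n)} (hd : IsDiagonal n d) :
    IsCentral n d ↔ (orbit d).2 = (n : ℤ) + 2 := by
  constructor
  · rintro ⟨a, rfl⟩
    obtain ⟨p, rfl⟩ := ZMod.intCast_surjective a
    rw [show s((p : Vertex n), (p : Vertex n) + ((n + 2 : ℕ) : Vertex n)) =
      diag n p (p + ((n : ℤ) + 2)) by simp [diag], orbit_diag (by omega) le_rfl, arc_snd]
    ring
  · obtain ⟨i, j, rfl, hij, hji⟩ := hd.exists_diag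
    rw [orbit_diag hij hji, arc_snd]
    intro h
    obtain rfl : j = i + ((n : ℤ) + 2) := by omega
    exact ⟨i, by simp [diag]⟩

theorem sbtw_intCast {i p j : ℤ} (hip : i < p) (hpj : p < j) (hji : j < i + (2 * (n : ℤ) + 4)) :
    sbtw (i : Vertex n) p j :=
  (sbtw_intCast_iff hip.le (by omega) (by omega) hji).2 ⟨hip, hpj⟩

theorem sbtw_intCast_wrap {i p j : ℤ} (hjp : j < p) (hpi : p < i + (2 * (n : ℤ) + 4))
    (hij : i < j) : sbtw (j : Vertex n) p i := by
  rw [← intCast_vertex_add (dvd_refl _) i]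
  exact sbtw_intCast hjp hpi (by omega)

theorem cross_diag {i p j q : ℤ} (hip : i < p) (hpj : p < j) (hjq : j < q)
    (hqi : q < i + (2 * (n : ℤ) + 4)) : Cross n (diag n i j) (diag n p q) :=
  ⟨i, j, p, q, rfl, rfl, sbtw_intCast hip hpj (by omega),
    sbtw_intCast_wrap hjq hqi (by omega)⟩

theorem exists_lift_of_cross {d e : Sym2 (Vertex n)} (h : Cross n d e) : ∃ i p j q : ℤ,
    d = diag n i j ∧ e = diag n p q ∧ i < p ∧ p < j ∧ j < q ∧ q < i + (2 * (n : ℤ) + 4) := by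
  obtain ⟨a, b, x, y, rfl, rfl, hab, hba⟩ := h
  obtain ⟨i, rfl⟩ := ZMod.intCast_surjective a
  obtain ⟨p, rfl, hip, hpi⟩ := exists_lift_vertex i x
  obtain ⟨j, rfl, hij, hji⟩ := exists_lift_vertex i b
  obtain ⟨hip, hpj⟩ := (sbtw_intCast_iff hip hpi hij hji).1 hab
  obtain ⟨q, rfl, hjq, hqj⟩ := exists_lift_vertex j y
  rw [← intCast_vertex_add (dvd_refl _) i] at hba
  obtain ⟨hjq, hqi⟩ := (sbtw_intCast_iff hjq hqj (by omega) (by omega)).1 hba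
  exact ⟨i, p, j, q, rfl, rfl, hip, hpj, hjq, hqi⟩

theorem Noncrossing.not_cross_of_mem {S : Set (Arc n)} (hS : Noncrossing S) {d e : Sym2 (Vertex n)}
    (hd : orbit d ∈ S) (he : orbit e ∈ S) : ¬ Cross n d e := by
  intro h
  obtain ⟨i, p, j, q, rfl, rfl, hip, hpj, hjq, hqi⟩ := exists_lift_of_cross h
  have key {i p j q : ℤ} (hd : orbit (diag n i j) ∈ S) (he : orbit (diag n p q) ∈ S) (hip : i < p)
      (hpj : p < j) (hjq : j < q) (hji : j ≤ i + ((n : ℤ) + 2)) (hqp : q ≤ p + ((n : ℤ) + 2)) :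
      False := by
    rw [orbit_diag (by omega) hji] at hd
    rw [orbit_diag (by omega) hqp] at he
    exact hS.not_cross i j p q hd he ⟨hip, hpj, hjq⟩
  have hwrap (i j : ℤ) : diag n j (i + (2 * (n : ℤ) + 4)) = diag n i j := by
    rw [diag_add_right (dvd_refl _), diag_comm]
  -- A segment that is too long is replaced by its complement.
  rcases le_or_gt j (i + ((n : ℤ) + 2)) with hj | hj <;>
    rcases le_or_gt q (p + ((n : ℤ) + 2)) with hq | hq
  · exact key hd he hip hpj hjq hj hq
  · rw [← hwrap] at he
    rw [← diag_add_add (dvd_refl _) i j] at hd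
    exact key he hd hqi (by omega) (by omega) (by omega) (by omega)
  · rw [← hwrap] at hd
    exact key he hd hpj hjq hqi hq (by omega)
  · rw [← hwrap] at hd he
    exact key hd he hjq hqi (by omega) (by omega) (by omega)

/-! ### Colored triangulations -/

theorem IsDiagonal.preimage_orbit {d : Sym2 (Vertex n)} (hd : IsDiagonal n d) :
    orbit ⁻¹' {orbit d} = {d, inversion n d} :=
  Set.ext hd.orbit_eq_iff

theorem diag_mem_preimage_iff {S : Set (Arc n)} {i j : ℤ} (hij : i < j)
    (hji : j ≤ i + ((n : ℤ) + 2)) : diag n i j ∈ orbit ⁻¹' S ↔ arc n i j ∈ S := by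
  rw [Set.mem_preimage, orbit_diag hij hji]

namespace Noncrossing

variable {S : Set (Arc n)}

theorem isDiagonal (hS : Noncrossing S) {d : Sym2 (Vertex n)} (hd : orbit d ∈ S) :
    IsDiagonal n d :=
  isDiagonal_iff_two_le.2 (hS.length_mem _ hd).1

theorem isDissection_preimage (hS : Noncrossing S) : IsDissection n (orbit ⁻¹' S) :=
  ⟨fun _ hd => hS.isDiagonal hd, fun _ hd _ he => hS.not_cross_of_mem hd he⟩

theorem isCentrallySymmetric_preimage (hS : Noncrossing S) :
    IsCentrallySymmetric n (orbit ⁻¹' S) := fun d hd => by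
  rwa [Set.mem_preimage, (hS.isDiagonal hd).orbit_inversion]

theorem image_preimage (hS : Noncrossing S) : orbit '' (orbit ⁻¹' S) = S :=
  Set.image_preimage_eq_of_subset fun α hα =>
    exists_orbit_eq (hS.length_mem α hα).1 (hS.length_mem α hα).2

end Noncrossing

section

variable {D : Set (Sym2 (Vertex n))}

theorem IsDissection.preimage_image (hD : IsDissection n D) (hsymm : IsCentrallySymmetric n D) :
    orbit ⁻¹' (orbit '' D) = D := by
  refine Set.Subset.antisymm ?_ (Set.subset_preimage_image orbit D)
  rintro e ⟨d, hd, hde⟩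
  rcases ((hD.1 d hd).orbit_eq_iff e).1 hde.symm with rfl | rfl
  exacts [hd, hsymm d hd]

theorem IsDissection.noncrossing (hD : IsDissection n D) (hsymm : IsCentrallySymmetric n D) :
    Noncrossing (orbit '' D) := by
  have hlength : ∀ α ∈ orbit '' D, 2 ≤ α.2 ∧ α.2 ≤ (n : ℤ) + 2 := by
    rintro _ ⟨d, hd, rfl⟩
    refine ⟨isDiagonal_iff_two_le.1 (hD.1 d hd), ?_⟩
    obtain ⟨i, j, rfl, hij, hji⟩ := (hD.1 d hd).exists_diag
    rw [orbit_diag hij hji, arc_snd]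
    omega
  refine ⟨hlength, fun i j p q hij hpq ⟨hip, hpj, hjq⟩ => ?_⟩
  have hlength_ij := hlength _ hij
  have hlength_pq := hlength _ hpq
  rw [arc_snd] at hlength_ij hlength_pq
  rw [← diag_mem_preimage_iff (by omega) (by omega), hD.preimage_image hsymm] at hij hpq
  exact hD.2 _ hij _ hpq (cross_diag hip hpj hjq (by omega))

theorem IsTriangulation.full (hD : IsTriangulation n D) (hsymm : IsCentrallySymmetric n D) :
    Full (orbit '' D) := by
  refine ⟨hD.1.noncrossing hsymm, fun i j hij hji hcross => ?_⟩
  have hinsert := (hD.1.noncrossing hsymm).insert_arc hij hji hcross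
  have hsub : orbit ⁻¹' insert (arc n i j) (orbit '' D) ⊆ D :=
    hD.2 hinsert.isDissection_preimage fun d hd => Or.inr ⟨d, hd, rfl⟩
  refine Set.image_mono hsub ?_
  rw [hinsert.image_preimage]
  exact Set.mem_insert _ _

theorem Full.isTriangulation_preimage {S : Set (Arc n)} (hS : Full S) :
    IsTriangulation n (orbit ⁻¹' S) := by
  refine ⟨hS.isDissection_preimage, fun D hD hSD d hd => ?_⟩
  have hlength := isDiagonal_iff_two_le.1 (hD.1 d hd)
  obtain ⟨i, j, rfl, hij, hji⟩ := (hD.1 d hd).exists_diag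
  rw [orbit_diag hij hji, arc_snd] at hlength
  rw [diag_mem_preimage_iff hij hji]
  refine hS.arc_mem i j (by omega) hji fun p q hpq => ?_
  have hlength_pq := hS.length_mem _ hpq
  rw [arc_snd] at hlength_pq
  have hpqD := hSD ((diag_mem_preimage_iff (by omega) (by omega)).2 hpq)
  exact ⟨fun h => hD.2 _ hpqD _ hd (cross_diag h.1 h.2.1 h.2.2 (by omega)),
    fun h => hD.2 _ hd _ hpqD (cross_diag h.1 h.2.1 h.2.2 (by omega))⟩

end

theorem isDiagonalFlip_diag {T : Set (Sym2 (Vertex n))} {w x y z : ℤ} (wx : w < x) (xy : x < y)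
    (yz : y < z) (zw : z < w + (2 * (n : ℤ) + 4)) (hmem : diag n w y ∈ T)
    (side_wx : diag n w x ∈ T ∨ IsSide n (diag n w x))
    (side_xy : diag n x y ∈ T ∨ IsSide n (diag n x y))
    (side_yz : diag n y z ∈ T ∨ IsSide n (diag n y z))
    (side_zw : diag n z w ∈ T ∨ IsSide n (diag n z w)) :
    IsDiagonalFlip n T (diag n w y) (diag n x z) := by
  refine ⟨hmem, w, x, y, z, sbtw_intCast wx xy (by omega), sbtw_intCast_wrap yz zw (by omega),
    rfl, rfl, ?_⟩
  rintro f (rfl | rfl | rfl | rfl)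
  exacts [side_wx, side_xy, side_yz, side_zw]

theorem IsDiagonalFlip.cross {T : Set (Sym2 (Vertex n))} {d d' : Sym2 (Vertex n)}
    (h : IsDiagonalFlip n T d d') : Cross n d d' := by
  obtain ⟨-, a, b, c, e, hab, hce, hd, hd', -⟩ := h
  exact ⟨a, c, b, e, hd, hd', hab, hce⟩

theorem Noncrossing.mem_or_isSide {S : Set (Arc n)} (hS : Noncrossing S) {i j : ℤ}
    (h : Edge S i j) : diag n i j ∈ orbit ⁻¹' S ∨ IsSide n (diag n i j) := by
  rcases id h with rfl | hij
  · exact Or.inr (isSide_diag i)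
  · exact Or.inl ((diag_mem_preimage_iff (hS.lt h) (hS.le h)).2 hij)

theorem Exchange.exists_isDiagonalFlip {S : Set (Arc n)} (hS : Noncrossing S) {α β : Arc n}
    (h : Exchange S α β) (hα : α ∈ S) : ∃ d d', orbit d = α ∧ orbit d' = β ∧
      IsDiagonalFlip n (orbit ⁻¹' S) d d' := by
  cases h with
  | @left w x y z h =>
    obtain ⟨wx, xy, yz, le, edge_wx, edge_xy, edge_yz, edge_wz⟩ := h
    refine ⟨_, _, orbit_diag (by omega) (by omega), orbit_diag (by omega) (by omega),
      isDiagonalFlip_diag wx xy yz (by omega) ?_ (hS.mem_or_isSide edge_wx)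
      (hS.mem_or_isSide edge_xy) (hS.mem_or_isSide edge_yz) ?_⟩
    · rwa [diag_mem_preimage_iff (by omega) (by omega)]
    · rw [diag_comm]
      exact hS.mem_or_isSide edge_wz
  | @right w x y z h =>
    obtain ⟨wx, xy, yz, le, edge_wx, edge_xy, edge_yz, edge_wz⟩ := h
    have hwrap (v : ℤ) : diag n v (w + (2 * (n : ℤ) + 4)) = diag n w v := by
      rw [diag_add_right (dvd_refl _), diag_comm]
    refine ⟨diag n x z, diag n y (w + (2 * (n : ℤ) + 4)), orbit_diag (by omega) (by omega), ?_,
      isDiagonalFlip_diag xy yz (by omega) (by omega) ?_ (hS.mem_or_isSide edge_xy)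
      (hS.mem_or_isSide edge_yz) ?_ ?_⟩
    · rw [hwrap, orbit_diag (by omega) (by omega)]
    · rwa [diag_mem_preimage_iff (by omega) (by omega)]
    · rw [hwrap]
      exact hS.mem_or_isSide edge_wz
    · rw [diag_comm, hwrap]
      exact hS.mem_or_isSide edge_wx
  | @central a x h =>
    obtain ⟨ax, xa, edge_ax, edge_xa⟩ := h
    refine ⟨_, _, orbit_diag (by omega) le_rfl, orbit_diag (by omega) le_rfl,
      isDiagonalFlip_diag ax xa (by omega) (by omega) ?_ (hS.mem_or_isSide edge_ax)
      (hS.mem_or_isSide edge_xa) (hS.mem_or_isSide (edge_ax.shift (dvd_refl _))) ?_⟩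
    · rwa [diag_mem_preimage_iff (by omega) le_rfl]
    · rw [← diag_add_right (dvd_refl (2 * (n : ℤ) + 4)) _ a,
        show a + (2 * (n : ℤ) + 4) = a + ((n : ℤ) + 2) + ((n : ℤ) + 2) by ring]
      exact hS.mem_or_isSide (edge_xa.shift (dvd_refl _))

namespace ColoredTriangulation

theorem noncrossing (t : ColoredTriangulation n) : Noncrossing (orbit '' t.supp) :=
  t.isTriangulation.1.noncrossing t.isCentrallySymmetric

theorem color_eq_iff_orbit_eq (t : ColoredTriangulation n) {d e : Sym2 (Vertex n)}
    (hd : d ∈ t.supp) (he : e ∈ t.supp) : t.color d = t.color e ↔ orbit d = orbit e := by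
  have hdiag_d := t.isTriangulation.1.1 d hd
  have hdiag_e := t.isTriangulation.1.1 e he
  have hcentral_d := (t.color_eq_none_iff d hd).trans hdiag_d.isCentral_iff
  have hcentral_e := (t.color_eq_none_iff e he).trans hdiag_e.isCentral_iff
  by_cases hdn : (orbit d).2 = (n : ℤ) + 2 <;> by_cases hen : (orbit e).2 = (n : ℤ) + 2
  · exact iff_of_true ((hcentral_d.2 hdn).trans (hcentral_e.2 hen).symm)
      (t.noncrossing.eq_of_central ⟨d, hd, rfl⟩ ⟨e, he, rfl⟩ hdn hen)
  · exact iff_of_false (fun h => hen (hcentral_e.1 (h ▸ hcentral_d.2 hdn))) fun h => hen (h ▸ hdn)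
  · exact iff_of_false (fun h => hdn (hcentral_d.1 (h ▸ hcentral_e.2 hen))) fun h => hdn (h ▸ hen)
  · rw [t.color_eq_color_iff d hd e he (mt hdiag_d.isCentral_iff.1 hdn)
      (mt hdiag_e.isCentral_iff.1 hen), ← hdiag_d.orbit_eq_iff, eq_comm]

theorem exists_labelling (t : ColoredTriangulation n) : ∃ f : Labelling n,
    Set.range f = orbit '' t.supp ∧ ∀ d ∈ t.supp, f (t.color d) = orbit d := by
  have hfull := t.isTriangulation.full t.isCentrallySymmetric
  choose d hd hdα using fun α : (orbit '' t.supp : Set (Arc n)) => α.2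
  have hbij : Function.Bijective fun α => t.color (d α) := by
    have : Finite (orbit '' t.supp : Set (Arc n)) := hfull.finite
    refine Function.Injective.bijective_of_nat_card_le (fun α β h => Subtype.ext ?_) ?_
    · rw [← hdα, ← hdα, ← t.color_eq_iff_orbit_eq (hd α) (hd β)]
      exact h
    · rw [Nat.card_coe_set_eq, hfull.ncard, Nat.card_eq_fintype_card, Fintype.card_option,
        Fintype.card_fin]
  obtain ⟨e, he⟩ : ∃ e : Option (Fin n) ≃ (orbit '' t.supp : Set (Arc n)),
      ∀ l, t.color (d (e l)) = l :=
    ⟨(Equiv.ofBijective _ hbij).symm, (Equiv.ofBijective _ hbij).apply_symm_apply⟩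
  have hrange : Set.range (fun l => (e l).1) = orbit '' t.supp :=
    (e.surjective.range_comp Subtype.val).trans Subtype.range_coe
  refine ⟨⟨fun l => (e l).1, hrange.symm ▸ t.noncrossing, Subtype.val_injective.comp e.injective⟩,
    hrange, fun c hc => ?_⟩
  change (e (t.color c)).1 = orbit c
  rw [← hdα, ← t.color_eq_iff_orbit_eq (hd _) hc, he]

end ColoredTriangulation

namespace Rooted

open Classical in
/-- The colored triangulation whose diagonals with the label `l` are those in the orbit `f l`. -/
noncomputable def toColored (f : Rooted n) : ColoredTriangulation n where
  supp := orbit ⁻¹' Set.range f.1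
  color d := Function.extend f.1.1 id (fun _ => none) (orbit d)
  isTriangulation := f.1.2.full.isTriangulation_preimage
  isCentrallySymmetric := f.1.2.noncrossing.isCentrallySymmetric_preimage
  color_of_notMem d hd := Function.extend_apply' _ _ _ hd
  color_eq_none_iff := by
    rintro d ⟨l, hl⟩
    rw [(f.1.2.noncrossing.isDiagonal ⟨l, hl⟩).isCentral_iff, ← hl,
      f.1.2.injective.extend_apply, id]
    constructor
    · rintro rfl
      exact f.2
    · exact fun h => f.1.central_unique h f.2
  color_eq_color_iff := by
    rintro d ⟨l, hl⟩ e ⟨k, hk⟩ - -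
    rw [← (f.1.2.noncrossing.isDiagonal ⟨l, hl⟩).orbit_eq_iff, ← hl, ← hk,
      f.1.2.injective.extend_apply, f.1.2.injective.extend_apply, f.1.2.injective.eq_iff]
    exact eq_comm

theorem color_toColored (f : Rooted n) {d : Sym2 (Vertex n)} {l : Option (Fin n)}
    (h : f.1 l = orbit d) : f.toColored.color d = l := by
  change Function.extend f.1.1 id (fun _ => none) (orbit d) = l
  rw [← h, f.1.2.injective.extend_apply, id]

theorem apply_color_toColored (f : Rooted n) {d : Sym2 (Vertex n)} (hd : d ∈ f.toColored.supp) :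
    f.1 (f.toColored.color d) = orbit d := by
  obtain ⟨l, hl⟩ := hd
  rwa [f.color_toColored hl]

theorem exists_orbit_eq_apply (f : Rooted n) (l : Option (Fin n)) : ∃ d, orbit d = f.1 l :=
  exists_orbit_eq (f.1.length_mem l).1 (f.1.length_mem l).2

theorem toColored_injective : Function.Injective (toColored (n := n)) := by
  refine fun f g hfg => Subtype.ext (Subtype.ext (funext fun l => ?_))
  obtain ⟨d, hd⟩ := f.exists_orbit_eq_apply l
  have hmem : d ∈ g.toColored.supp := hfg ▸ (⟨l, hd.symm⟩ : d ∈ f.toColored.supp)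
  rw [← hd, ← g.apply_color_toColored hmem, ← hfg, f.color_toColored hd.symm]

theorem toColored_surjective : Function.Surjective (toColored (n := n)) := by
  intro t
  obtain ⟨f, hrange, hcolor⟩ := t.exists_labelling
  have hnone : (f none).2 = (n : ℤ) + 2 := by
    obtain ⟨d, hd, hdf⟩ : f none ∈ orbit '' t.supp := hrange ▸ ⟨none, rfl⟩
    rw [← hdf, ← (t.isTriangulation.1.1 d hd).isCentral_iff, ← t.color_eq_none_iff d hd]
    exact f.2.injective ((hcolor d hd).trans hdf)
  have hsupp : (toColored ⟨f, hnone⟩).supp = t.supp := by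
    change orbit ⁻¹' Set.range f = _
    rw [hrange, t.isTriangulation.1.preimage_image t.isCentrallySymmetric]
  refine ⟨⟨f, hnone⟩, ColoredTriangulation.ext hsupp (funext fun d => ?_)⟩
  by_cases hd : d ∈ t.supp
  · exact color_toColored ⟨f, hnone⟩ (hcolor d hd)
  · rw [t.color_of_notMem d hd, (toColored ⟨f, hnone⟩).color_of_notMem d (hsupp ▸ hd)]

variable (n) in
/-- The colored triangulations in terms of orbits of diagonals. -/
noncomputable def coloredEquiv : Rooted n ≃ ColoredTriangulation n :=
  Equiv.ofBijective toColored ⟨toColored_injective, toColored_surjective⟩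

theorem eq_flip_of_isFlip {c : Option (Fin n)} {f g : Rooted n}
    (h : IsFlip n c f.toColored g.toColored) : g = flip c f := by
  obtain ⟨d, d', hflip, hd, hsupp, hd', -, hcolor⟩ := h
  have hmem' : d' ∈ g.toColored.supp := hsupp ▸ Or.inr (Or.inl rfl)
  have hdiag := f.1.2.noncrossing.isDiagonal hflip.1
  have hfc : f.1 c = orbit d := hd ▸ f.apply_color_toColored hflip.1
  have hgc : g.1 c = orbit d' := hd' ▸ g.apply_color_toColored hmem'
  refine Subtype.ext ((f.1.flip_eq_iff g.1 c).2 ⟨fun k hk => ?_, fun hne => ?_⟩)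
  · obtain ⟨e, he⟩ := f.exists_orbit_eq_apply k
    have hmem : e ∈ f.toColored.supp \ {d, inversion n d} := by
      refine ⟨⟨k, he.symm⟩, fun hed => hk (f.1.2.injective ?_)⟩
      rw [hfc, ← he]
      exact (hdiag.orbit_eq_iff e).2 hed
    have hek : g.toColored.color e = k := (hcolor e hmem).trans (f.color_toColored he.symm)
    have hmem' : e ∈ g.toColored.supp := hsupp ▸ Or.inl hmem
    rw [← he, ← g.apply_color_toColored hmem', hek]
  · refine f.toColored.isTriangulation.1.2 d hflip.1 d' ⟨c, ?_⟩ hflip.cross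
    rw [← hgc, hne]

theorem isFlip_flip (c : Option (Fin n)) (f : Rooted n) :
    IsFlip n c f.toColored (flip c f).toColored := by
  obtain ⟨d, d', hd, hd', hflip⟩ :=
    (f.1.exchange_flip c).exists_isDiagonalFlip f.1.2.noncrossing ⟨c, rfl⟩
  have hdiag := f.1.2.noncrossing.isDiagonal ⟨c, hd.symm⟩
  have hdiag' := (flip c f).1.2.noncrossing.isDiagonal ⟨c, hd'.symm⟩
  refine ⟨d, d', hflip, f.color_toColored hd.symm, ?_, color_toColored _ hd'.symm,
    color_toColored _ (hd'.symm.trans hdiag'.orbit_inversion.symm), ?_⟩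
  · change orbit ⁻¹' Set.range (f.1.flip c) = _
    rw [f.1.range_flip, Set.insert_eq, Set.preimage_union, Set.preimage_sdiff, ← hd, ← hd',
      hdiag.preimage_orbit, hdiag'.preimage_orbit, Set.union_comm]
    rfl
  · rintro e ⟨⟨k, hk⟩, hed⟩
    have hkc : k ≠ c := by
      rintro rfl
      exact hed ((hdiag.orbit_eq_iff e).1 (hk.symm.trans hd.symm))
    rw [f.color_toColored hk, color_toColored]
    exact (f.1.flip_apply_of_ne hkc).trans hk

theorem isFlip_toColored_iff {c : Option (Fin n)} {f g : Rooted n} :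
    IsFlip n c f.toColored g.toColored ↔ g = flip c f :=
  ⟨eq_flip_of_isFlip, fun h => h ▸ isFlip_flip c f⟩

end Rooted

/-! ### Symmetric dissections -/

/-- The sets of pairwise non-crossing orbits of diagonals, a model of the centrally symmetric
dissections. -/
abbrev NoncrossingSet (n : ℕ) : Type := {S : Set (Arc n) // Noncrossing S}

variable (n) in
/-- The centrally symmetric dissections in terms of orbits of diagonals. -/
def dissectionEquiv : SymmetricDissection n ≃o NoncrossingSet n where
  toFun D := ⟨orbit '' D.1, D.2.1.noncrossing D.2.2⟩
  invFun S := ⟨orbit ⁻¹' S.1, S.2.isDissection_preimage, S.2.isCentrallySymmetric_preimage⟩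
  left_inv D := Subtype.ext (D.2.1.preimage_image D.2.2)
  right_inv S := Subtype.ext S.2.image_preimage
  map_rel_iff' {D E} := by
    change orbit '' D.1 ⊆ orbit '' E.1 ↔ D.1 ⊆ E.1
    rw [Set.image_subset_iff, E.2.1.preimage_image E.2.2]

theorem noncrossing_empty : Noncrossing (∅ : Set (Arc n)) :=
  ⟨fun _ h => h.elim, fun _ _ _ _ h => h.elim⟩

theorem noncrossing_singleton {α : Arc n} (hα : 2 ≤ α.2) (hαn : α.2 ≤ (n : ℤ) + 2) :
    Noncrossing {α} := by
  obtain ⟨i, hi⟩ := exists_arc α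
  have := noncrossing_empty.insert_arc (n := n) (i := i) (j := i + α.2) (by omega) (by omega)
    fun _ _ h => h.elim
  rwa [hi, insert_empty_eq] at this

theorem Noncrossing.singleton {S : Set (Arc n)} (hS : Noncrossing S) {α : Arc n} (hα : α ∈ S) :
    Noncrossing {α} :=
  hS.mono (Set.singleton_subset_iff.2 hα)

namespace NoncrossingSet

instance : OrderBot (NoncrossingSet n) := Subtype.orderBot noncrossing_empty

theorem isAtom_iff {S : NoncrossingSet n} : IsAtom S ↔ ∃ α, S.1 = {α} := by
  constructor
  · intro hS
    obtain ⟨α, hα⟩ : S.1.Nonempty :=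
      Set.nonempty_iff_ne_empty.2 fun h => hS.1 (Subtype.ext h)
    have hle : (⟨{α}, S.2.singleton hα⟩ : NoncrossingSet n) ≤ S := Set.singleton_subset_iff.2 hα
    refine ⟨α, (congrArg Subtype.val ((hS.le_iff.1 hle).resolve_left fun h => ?_)).symm⟩
    exact Set.singleton_ne_empty α (congrArg Subtype.val h)
  · rintro ⟨α, hα⟩
    refine ⟨fun h => Set.singleton_ne_empty α (hα.symm.trans (congrArg Subtype.val h)),
      fun T hT => Subtype.ext ?_⟩
    exact Set.ssubset_singleton_iff.1 (hα ▸ Subtype.coe_lt_coe.2 hT)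

variable (Φ : NoncrossingSet n ≃o NoncrossingSet n)

theorem exists_apply_singleton {α : Arc n} (hα : Noncrossing {α}) :
    ∃ β, (Φ ⟨{α}, hα⟩).1 = {β} :=
  isAtom_iff.1 ((Φ.isAtom_iff _).2 (isAtom_iff.2 ⟨α, rfl⟩))

open Classical in
/-- The map of orbits that an automorphism induces. Its values are junk off the arcs that are
orbits of diagonals. -/
noncomputable def arcMap (α : Arc n) : Arc n :=
  if hα : Noncrossing {α} then (exists_apply_singleton Φ hα).choose else α

theorem coe_apply_singleton {α : Arc n} (hα : Noncrossing {α}) :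
    (Φ ⟨{α}, hα⟩).1 = {arcMap Φ α} := by
  rw [arcMap, dif_pos hα]
  exact (exists_apply_singleton Φ hα).choose_spec

theorem apply_singleton {α : Arc n} (hα : Noncrossing {α}) :
    Φ ⟨{α}, hα⟩ = ⟨{arcMap Φ α}, coe_apply_singleton Φ hα ▸ (Φ _).2⟩ :=
  Subtype.ext (coe_apply_singleton Φ hα)

theorem arcMap_symm_arcMap {α : Arc n} (hα : Noncrossing {α}) :
    arcMap Φ.symm (arcMap Φ α) = α := by
  have h := Φ.symm_apply_apply ⟨{α}, hα⟩
  rw [apply_singleton Φ hα, apply_singleton] at h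
  exact Set.singleton_injective (congrArg Subtype.val h)

theorem arcMap_mem_apply_iff (S : NoncrossingSet n) {α : Arc n} (hα : Noncrossing {α}) :
    arcMap Φ α ∈ (Φ S).1 ↔ α ∈ S.1 := by
  have h : (Φ ⟨{α}, hα⟩).1 ⊆ (Φ S).1 ↔ {α} ⊆ S.1 := Φ.le_iff_le
  rwa [coe_apply_singleton, Set.singleton_subset_iff, Set.singleton_subset_iff] at h

theorem coe_apply (S : NoncrossingSet n) : (Φ S).1 = arcMap Φ '' S.1 := by
  refine Set.Subset.antisymm (fun β hβ => ?_) (Set.image_subset_iff.2 fun α hα =>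
    (arcMap_mem_apply_iff Φ S (S.2.singleton hα)).2 hα)
  have hβs := (Φ S).2.singleton hβ
  refine ⟨arcMap Φ.symm β, ?_, arcMap_symm_arcMap Φ.symm hβs⟩
  have h := (arcMap_mem_apply_iff Φ.symm (Φ S) hβs).2 hβ
  rwa [Φ.symm_apply_apply] at h

theorem injOn_arcMap {S : Set (Arc n)} (hS : Noncrossing S) : Set.InjOn (arcMap Φ) S :=
  Set.LeftInvOn.injOn fun _ hα => arcMap_symm_arcMap Φ (hS.singleton hα)

/-- The action of an automorphism on the labelled triangulations. -/
noncomputable def map (f : Labelling n) : Labelling n :=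
  ⟨arcMap Φ ∘ f, by
    rw [Set.range_comp, ← coe_apply Φ ⟨_, f.2.noncrossing⟩]
    exact (Φ _).2,
  fun _ _ h => f.2.injective (injOn_arcMap Φ f.2.noncrossing ⟨_, rfl⟩ ⟨_, rfl⟩ h)⟩

theorem map_apply (f : Labelling n) (l : Option (Fin n)) : map Φ f l = arcMap Φ (f l) := rfl

theorem map_symm_map (f : Labelling n) : map Φ.symm (map Φ f) = f :=
  Subtype.ext (funext fun l => arcMap_symm_arcMap Φ (f.2.noncrossing.singleton ⟨l, rfl⟩))

theorem map_flip (f : Labelling n) (l : Option (Fin n)) : map Φ (f.flip l) = (map Φ f).flip l := by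
  rw [Labelling.flip_eq_iff]
  refine ⟨fun k hk => congrArg (arcMap Φ) (f.flip_apply_of_ne hk), fun h => f.flip_apply_ne l ?_⟩
  rw [← map_symm_map Φ (f.flip l), map_apply, h, ← map_apply, map_symm_map]

theorem map_relabel (π : Equiv.Perm (Option (Fin n))) (f : Labelling n) :
    map Φ (relabel π f) = relabel π (map Φ f) := rfl

theorem conn_map {f g : Labelling n} (h : Conn f g) : Conn (map Φ f) (map Φ g) :=
  h.induction (P := fun g => Conn (map Φ f) (map Φ g)) (.refl _) fun k hk l => by
    rw [map_flip]
    exact hk.flip l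

/-- The label of the central orbit is the same in the images of all rooted triangulations, hence
fixed by all permutations of the colors. -/
theorem map_none_central (hn : 2 ≤ n) (f : Rooted n) : (map Φ f.1 none).2 = (n : ℤ) + 2 := by
  obtain ⟨m, hm⟩ := (map Φ (Labelling.fan n 0)).exists_central
  have hcentral (g : Rooted n) : (map Φ g.1 m).2 = (n : ℤ) + 2 :=
    (conn_map Φ (conn_fan g.1 g.2)).induction (P := fun k => (k m).2 = (n : ℤ) + 2) hm
      fun k hk l => (k.central_flip_iff l m).2 hk
  cases m with
  | none => exact hcentral f
  | some i =>
    have : Nontrivial (Fin n) := Fin.nontrivial_iff_two_le.2 hn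
    obtain ⟨j, hj⟩ := exists_ne i
    have hswap : (map Φ (Labelling.fan n 0) (some j)).2 = (n : ℤ) + 2 := by
      have h := hcentral ((Equiv.swap i j, (1 : DihedralGroup (n + 2))) • Rooted.fan n)
      rwa [Rooted.coe_smul, map_relabel, relabel_apply, move_one, labelPerm_swap, Equiv.symm_swap,
        Equiv.swap_apply_left] at h
    exact absurd (Option.some_injective _ (central_unique _ hswap hm)) hj

/-- The automorphism of the flip system that an automorphism of the poset of non-crossing sets
induces. -/
noncomputable def toAut (hn : 2 ≤ n) : (Rooted.flipSystem n).autGroup :=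
  ⟨(⟨fun f => ⟨map Φ f.1, map_none_central Φ hn f⟩,
      fun f => ⟨map Φ.symm f.1, map_none_central Φ.symm hn f⟩,
      fun f => Subtype.ext (map_symm_map Φ f.1),
      fun f => Subtype.ext (map_symm_map Φ.symm f.1)⟩, 1),
    fun l f => Subtype.ext (map_flip Φ f.1 l)⟩

theorem exists_arcMap_eq_arcAction (hn : 2 ≤ n) : ∃ g : DihedralGroup (n + 2),
    ∀ α : Arc n, 2 ≤ α.2 → α.2 ≤ (n : ℤ) + 2 → arcMap Φ α = arcAction n g α := by
  obtain ⟨p, hp⟩ := Rooted.toAut_surjective hn (toAut Φ hn)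
  have hlabel : labelPerm p.1 = 1 := congrArg (fun g => g.1.2) hp
  refine ⟨p.2, fun α hα hαn => ?_⟩
  obtain ⟨a, ha⟩ := exists_arc α
  obtain ⟨l, hl⟩ := exists_fanLength_eq hα hαn
  have hroot : (Labelling.fan n a none).2 = (n : ℤ) + 2 := by
    rw [fan_none, arc_snd, add_sub_cancel_left]
  have hfan : (p • (⟨_, hroot⟩ : Rooted n)).1 = map Φ (Labelling.fan n a) :=
    congrArg (fun g => (g.1.1 ⟨_, hroot⟩).1) hp
  rw [Rooted.coe_smul, hlabel, relabel_one] at hfan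
  have := congrArg (fun f : Labelling n => f l) hfan
  simp only [move_apply, map_apply, fan_apply, hl, ha] at this
  exact this.symm

end NoncrossingSet

/-- The action of the dihedral group on the sets of pairwise non-crossing orbits. -/
def noncrossingAction (n : ℕ) :
    DihedralGroup (n + 2) →* (NoncrossingSet n ≃o NoncrossingSet n) where
  toFun g :=
    { toFun := fun S => ⟨arcAction n g '' S.1, S.2.arcAction g⟩
      invFun := fun S => ⟨arcAction n g⁻¹ '' S.1, S.2.arcAction g⁻¹⟩
      left_inv := fun S => Subtype.ext (by simp [Set.image_image])
      right_inv := fun S => Subtype.ext (by simp [Set.image_image])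
      map_rel_iff' := Set.image_subset_image_iff (arcAction n g).injective }
  map_one' := OrderIso.ext (funext fun S => Subtype.ext (by
    change arcAction n 1 '' S.1 = S.1
    rw [map_one]
    exact Set.image_id _))
  map_mul' g k := OrderIso.ext (funext fun S => Subtype.ext (by
    change arcAction n (g * k) '' S.1 = arcAction n g '' (arcAction n k '' S.1)
    rw [map_mul, Set.image_image]
    rfl))

theorem noncrossingAction_injective (hn : 1 ≤ n) : Function.Injective (noncrossingAction n) := by
  rw [injective_iff_map_eq_one]
  intro g hg
  have arc_fixed (k : ℤ) (hk : 2 ≤ k) (hkn : k ≤ (n : ℤ) + 2) :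
      arcAction n g (arc n 0 k) = arc n 0 k := by
    have hk : Noncrossing {arc n 0 k} :=
      noncrossing_singleton (by rw [arc_snd]; omega) (by rw [arc_snd]; omega)
    have himage : arcAction n g '' {arc n 0 k} = {arc n 0 k} :=
      congrArg (fun Φ => (Φ ⟨_, hk⟩).1) hg
    rwa [Set.image_singleton, Set.singleton_eq_singleton_iff] at himage
  exact Rooted.eq_one_of_arcAction (arc_fixed 2 le_rfl (by omega))
    (arc_fixed 3 (by omega) (by omega))

theorem noncrossingAction_surjective (hn : 2 ≤ n) : Function.Surjective (noncrossingAction n) := by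
  intro Φ
  obtain ⟨g, hg⟩ := NoncrossingSet.exists_arcMap_eq_arcAction Φ hn
  refine ⟨g, OrderIso.ext (funext fun S => Subtype.ext ?_)⟩
  rw [NoncrossingSet.coe_apply Φ]
  exact Set.image_congr fun α hα =>
    (hg α (S.2.length_mem α hα).1 (S.2.length_mem α hα).2).symm

section OrderAutomorphisms

variable {P Q : Type*} [PartialOrder P] [PartialOrder Q]

/-- Conjugation by an order isomorphism. -/
def autCongr (e : P ≃o Q) : (P ≃o P) ≃* (Q ≃o Q) where
  toFun φ := e.symm.trans (φ.trans e)
  invFun φ := e.trans (φ.trans e.symm)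
  left_inv φ := by ext x; simp
  right_inv φ := by ext x; simp
  map_mul' φ χ := by ext x; simp [RelIso.mul_apply]

theorem exists_apply_coe_eq_coe (Φ : WithBot P ≃o WithBot Q) (x : P) : ∃ y : Q, Φ x = y := by
  have hne : Φ x ≠ ⊥ := (map_eq_bot_iff Φ).not.2 WithBot.coe_ne_bot
  exact (WithBot.ne_bot_iff_exists.1 hne).imp fun _ => Eq.symm

theorem exists_withBotCongr_eq (Φ : WithBot P ≃o WithBot Q) : ∃ φ : P ≃o Q, φ.withBotCongr = Φ := by
  choose f hf using exists_apply_coe_eq_coe Φ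
  choose g hg using exists_apply_coe_eq_coe Φ.symm
  refine ⟨⟨⟨f, g, fun x => ?_, fun x => ?_⟩, fun {x y} => ?_⟩, OrderIso.ext (funext fun x => ?_)⟩
  · rw [← WithBot.coe_inj, ← hg, ← hf, Φ.symm_apply_apply]
  · rw [← WithBot.coe_inj, ← hf, ← hg, Φ.apply_symm_apply]
  · change f x ≤ f y ↔ x ≤ y
    rw [← WithBot.coe_le_coe, ← hf, ← hf, Φ.le_iff_le, WithBot.coe_le_coe]
  · cases x with
    | bot => exact Φ.map_bot.symm
    | coe x => exact (hf x).symm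

variable (P) in
/-- The automorphisms of an order with an added least element. -/
noncomputable def autWithBot : (P ≃o P) ≃* (WithBot P ≃o WithBot P) := by
  refine .ofBijective (MonoidHom.mk' OrderIso.withBotCongr fun φ χ =>
    OrderIso.ext (funext fun x => by cases x <;> rfl)) ⟨fun φ χ h => ?_, exists_withBotCongr_eq⟩
  ext x
  exact WithBot.coe_injective (congrArg (fun Φ => Φ (x : WithBot P)) h)

variable (P) in
/-- The automorphisms of the dual order. -/
def autDual : (P ≃o P) ≃* (Pᵒᵈ ≃o Pᵒᵈ) where
  toFun := OrderIso.dual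
  invFun φ := φ.dual
  left_inv _ := rfl
  right_inv _ := rfl
  map_mul' _ _ := rfl

end OrderAutomorphisms

theorem nonempty_autGroup_ordinary (hn : 2 ≤ n) :
    Nonempty (AutGroup (OrdinaryCyclohedron n) ≃* DihedralGroup (n + 2)) :=
  ⟨((MulEquiv.ofBijective (noncrossingAction n)
    ⟨noncrossingAction_injective (by omega), noncrossingAction_surjective hn⟩).trans
      ((autCongr (dissectionEquiv n).symm).trans ((autDual _).trans (autWithBot _)))).symm⟩

variable (n) in
/-- The face poset of the colorful cyclohedron in terms of arcs. -/
noncomputable def colorfulIso : ColorfulCyclohedron n ≃o (Rooted.flipSystem n).FacePoset :=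
  (Rooted.flipSystem n).facePosetCongr (Rooted.coloredEquiv n).symm fun c t t' => by
    obtain ⟨f, rfl⟩ := (Rooted.coloredEquiv n).surjective t
    obtain ⟨g, rfl⟩ := (Rooted.coloredEquiv n).surjective t'
    rw [Equiv.symm_apply_apply, Equiv.symm_apply_apply]
    exact Rooted.isFlip_toColored_iff

variable (n) in
/-- The automorphisms of the colorful cyclohedron as pairs of permutations. -/
noncomputable def colorfulAut :
    (Rooted.flipSystem n).autGroup ≃* AutGroup (ColorfulCyclohedron n) :=
  have : Nonempty (Rooted n) := ⟨Rooted.fan n⟩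
  (Rooted.flipSystem n).faceAut.trans (autCongr (colorfulIso n).symm)

theorem nonempty_autGroup_colorful (hn : 2 ≤ n) :
    Nonempty (AutGroup (ColorfulCyclohedron n) ≃* Equiv.Perm (Fin n) × DihedralGroup (n + 2)) :=
  ⟨((MulEquiv.ofBijective (Rooted.toAut n)
    ⟨Rooted.toAut_injective (by omega), Rooted.toAut_surjective hn⟩).trans (colorfulAut n)).symm⟩

theorem nonempty_autGroup_colorful_one :
    Nonempty (AutGroup (ColorfulCyclohedron 1) ≃* DihedralGroup 6) :=
  ⟨((MulEquiv.ofBijective Rooted.hexToAut Rooted.hexToAut_bijective).trans (colorfulAut 1)).symm⟩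

end Cyclohedron

theorem theorem6p4 :
    (∀ n : ℕ, 1 < n →
      Nonempty (Cyclohedron.AutGroup (Cyclohedron.ColorfulCyclohedron n) ≃*
        Equiv.Perm (Fin n) × DihedralGroup (n + 2))) ∧
    Nonempty (Cyclohedron.AutGroup (Cyclohedron.ColorfulCyclohedron 1) ≃* DihedralGroup 6) ∧
    (∀ n : ℕ, 1 < n →
      Nonempty (Cyclohedron.AutGroup (Cyclohedron.OrdinaryCyclohedron n) ≃*
        DihedralGroup (n + 2))) :=
  ⟨fun _ => Cyclohedron.nonempty_autGroup_colorful,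
    Cyclohedron.nonempty_autGroup_colorful_one,
    fun _ => Cyclohedron.nonempty_autGroup_ordinary⟩
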